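/- Theorem 2.1. For $s>0$ let $E_s$ be the space of all real-valued $u\in C^\infty(\mathbb{R})$ with $$\|u\|_s=\sup_{k\in\mathbb{N}}\frac{s^k\|\partial_x^k u\|_{H^1(\mathbb{R})}}{k!/(k+1)^2}<\infty ,\qquad \mathbb{N}=\{0,1,2,\dots\}.$$ Let $G(x)=\tfrac12 e^{-|x|}$, so that $G\star f=(1-\partial_x^2)^{-1}f$ for $f\in L^2(\mathbb{R})$, and consider the Cauchy problem for the generalized Camassa–Holm equation $u_t-u_{txx}=\partial_x(2+\partial_x)[(2-\partial_x)u]^2$ in the form $$u_t=4uu_x-u_x^2+G\star\big[\partial_x(2u_x^2+6u^2)+u_x^2\big],\qquad u(0,x)=u_0(x).\tag{1}$$ For $\sigma>5/2$ and $\varepsilon>0$, a strong solution of class $C((-\varepsilon,\varepsilon);H^\sigma(\mathbb{R}))$ of (1) is a real-valued function $u\in C((-\varepsilon,\varepsilon);H^\sigma(\mathbb{R}))$ (each $u(t,\cdot)$ being identified with its $C^2$ representative) with $u(0,\cdot)=u_0$ that is differentiable in $t$ and satisfies the equation in (1) at every point of $(-\varepsilon,\varepsilon)\times\mathbb{R}$.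 Let $s>0$ and $u_0\in E_s$. Then there exist an $\varepsilon>0$ and a function $u$, real analytic in the two variables $(t,x)$ jointly on $(-\varepsilon,\varepsilon)\times\mathbb{R}$, such that for every $\sigma>5/2$ the function $u$ is the unique strong solution of class $C((-\varepsilon,\varepsilon);H^\sigma(\mathbb{R}))$ of the Cauchy problem (1). -/

import Mathlib

open MeasureTheory Set Filter Topology
open scoped ENNReal Convolution FourierTransform

noncomputable section

/-- The norm `(‖f‖_{L²}² + ‖f'‖_{L²}²)^{1/2}` of `H¹(ℝ)`, for differentiable `f`, with values in
`[0, ∞]`. -/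
def h1ENorm (f : ℝ → ℝ) : ℝ≥0∞ :=
  (eLpNorm f 2 volume ^ 2 + eLpNorm (deriv f) 2 volume ^ 2) ^ (1 / 2 : ℝ)

/-- `‖u‖_s = sup_k s^k ‖∂ₓ^k u‖_{H¹} / (k! / (k+1)²)`, with values in `[0, ∞]`. -/
def analyticENorm (s : ℝ) (u : ℝ → ℝ) : ℝ≥0∞ :=
  ⨆ k : ℕ, ENNReal.ofReal (s ^ k / ((k.factorial : ℝ) / ((k : ℝ) + 1) ^ 2)) *
    h1ENorm (iteratedDeriv k u)

/-- The space `E_s` of smooth functions on the line with `‖u‖_s < ∞`. -/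
def analyticSpace (s : ℝ) : Set (ℝ → ℝ) :=
  {u | ContDiff ℝ (⊤ : ℕ∞) u ∧ analyticENorm s u < ∞}

open Classical in
/-- The norm `‖(1 + |2πξ|²)^{σ/2} f̂‖_{L²}` of the Sobolev space `H^σ(ℝ)`, `σ ≥ 0`, with values
in `[0, ∞]`; here `f̂` is the `L²` Fourier transform, with kernel `e^{-2πixξ}`, and the norm is `∞`
when `f` is not in `L²`. -/
def sobolevENorm (σ : ℝ) (f : ℝ → ℝ) : ℝ≥0∞ :=
  if h : MemLp (fun x => (f x : ℂ)) 2 volume then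
    eLpNorm (fun ξ : ℝ =>
      (((1 + (2 * Real.pi * ξ) ^ 2) ^ (σ / 2) : ℝ) : ℂ) * (𝓕 (h.toLp) : Lp ℂ 2 (volume : Measure ℝ)) ξ)
      2 volume
  else ∞

/-- `v ∈ C((-ε, ε); H^σ(ℝ))`. -/
def ContinuousIntoSobolev (σ ε : ℝ) (v : ℝ → ℝ → ℝ) : Prop :=
  ∀ t ∈ Ioo (-ε) ε, sobolevENorm σ (v t) < ∞ ∧
    Tendsto (fun τ => sobolevENorm σ (v τ - v t)) (𝓝 t) (𝓝 0)

/-- The kernel `G(x) = e^{-|x|} / 2` of `(1 - ∂ₓ²)⁻¹`. -/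
def greenKernel (x : ℝ) : ℝ := Real.exp (-|x|) / 2

/-- The right-hand side `4 w wₓ - wₓ² + G ⋆ [∂ₓ(2 wₓ² + 6 w²) + wₓ²]` of the equation. -/
def gchRHS (w : ℝ → ℝ) (x : ℝ) : ℝ :=
  4 * w x * deriv w x - (deriv w x) ^ 2 +
    (greenKernel ⋆[ContinuousLinearMap.mul ℝ ℝ, volume]
      (fun y => deriv (fun z => 2 * (deriv w z) ^ 2 + 6 * (w z) ^ 2) y + (deriv w y) ^ 2)) x

/-- `v` is a strong solution on `(-ε, ε) × ℝ`, of class `C((-ε, ε); H^σ(ℝ))`, of the Cauchy problem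
with datum `u₀`. For `σ > 5/2` every element of `H^σ(ℝ)` has a `C²` representative, and
`v t` is required to be that representative, so that all derivatives are classical. -/
structure IsStrongSolution (σ ε : ℝ) (u₀ : ℝ → ℝ) (v : ℝ → ℝ → ℝ) : Prop where
  contDiff : ∀ t ∈ Ioo (-ε) ε, ContDiff ℝ 2 (v t)
  continuous_sobolev : ContinuousIntoSobolev σ ε v
  initial : v 0 = u₀
  equation : ∀ t ∈ Ioo (-ε) ε, ∀ x : ℝ, HasDerivAt (fun τ => v τ x) (gchRHS (v t) x) t

end

/-! Existence is a Cauchy–Kovalevskaya argument on the Fourier side. With ω = (2 - ∂ₓ)u the equation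
reads uₜ = ∂ₓ(2 + ∂ₓ)(1 - ∂ₓ²)⁻¹ω² (`gchRHS_eq_sq`), so ω satisfies a quadratic equation whose
multiplier has order one (`norm_two_sub_mul_gchSymbol_le`): exactly one derivative is lost. For a
datum in E_s, summing the exponential series of the derivative bounds gives a Fourier transform that
is square integrable against an exponential weight (`eLpNorm_expWeight_fourier_lt_top`).

Write u = ∑ tⁿuₙ and measure the transforms of ωₙ by `expNorm a`, which carries the weight e^{a|ξ|}.
Convolution is bounded in this norm, and a factor |ξ| costs 1/δ when the width drops from a + δ to
a. The recursion is then majorized by Catalan numbers (`le_pow_of_quadratic_recursion`), and at one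
fixed width a > 0 the n-th coefficient is at most M Rⁿ. The L¹ half of the norm gives the algebra
property and pointwise Fourier inversion; the L² half gives membership in every H^σ. Hence one
series, on one time interval, serves all σ simultaneously.

Joint analyticity comes from writing u(t,x) as the pairing of a functional analytic in t, ∑ tⁿFₙ,
with a damped plane wave analytic in x with values in the bounded continuous functions. Evaluation
is bilinear and continuous, so the pairing is analytic in (t,x).

Uniqueness uses no energy estimate but a maximum principle for d = v₁ - v₂. At a point where |d| is
maximal, dₓ = 0, so the local terms lose no derivative; in the nonlocal terms integration by parts
moves the derivative off d. Hence |dₜ| ≤ C|d| at such points (`abs_gchRHS_sub_le`), and d stays zero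
(`eq_zero_of_abs_deriv_le_at_max`). The condition σ > 5/2 enters through the embedding of H^σ into
C² functions that are bounded with two derivatives and vanish at infinity, so that the maximum
exists and moves continuously in time. -/

noncomputable section

/-! ### Half-line averages: the two factors of (1 - ∂ₓ²)⁻¹. -/

section HalfLineAverage

variable {E : Type*} [NormedAddCommGroup E] [NormedSpace ℝ E]

/-- The average `∫_0^∞ e^{-y} f(x + σ y) dy`; for `σ = ±1` these are the inverses of `1 ∓ ∂ₓ`. -/
def expAverage (σ : ℝ) (f : ℝ → E) (x : ℝ) : E :=
  ∫ y in Ioi (0 : ℝ), Real.exp (-y) • f (x + σ * y)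

theorem integrableOn_exp_neg_smul {f : ℝ → E} {B : ℝ} (hf : AEStronglyMeasurable f)
    (hB : ∀ x, ‖f x‖ ≤ B) :
    IntegrableOn (fun y => Real.exp (-y) • f y) (Ioi 0) := by
  have h := (integrableOn_exp_neg_Ioi 0)
  refine Integrable.mono' (h.mul_const B) ?_ ?_
  · exact (Real.continuous_exp.comp continuous_neg).aestronglyMeasurable.smul hf.restrict
  · refine ae_of_all _ fun y => ?_
    rw [norm_smul, Real.norm_of_nonneg (Real.exp_pos _).le]
    exact mul_le_mul_of_nonneg_left (hB y) (Real.exp_pos _).le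

theorem integrableOn_exp_neg_smul_comp {f : ℝ → E} {B : ℝ} (hf : Continuous f)
    (hB : ∀ x, ‖f x‖ ≤ B) (σ x : ℝ) :
    IntegrableOn (fun y => Real.exp (-y) • f (x + σ * y)) (Ioi 0) :=
  integrableOn_exp_neg_smul (f := fun y => f (x + σ * y))
    ((hf.comp (by fun_prop)).aestronglyMeasurable) fun _ => hB _

theorem norm_expAverage_le {f : ℝ → E} {B : ℝ} (hB : ∀ x, ‖f x‖ ≤ B) (σ x : ℝ) :
    ‖expAverage σ f x‖ ≤ B := by
  have h := norm_integral_le_of_norm_le (μ := volume.restrict (Ioi (0 : ℝ)))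
    (f := fun y => Real.exp (-y) • f (x + σ * y))
    (g := fun y => Real.exp (-y) * B) ((integrableOn_exp_neg_Ioi 0).mul_const B)
    (ae_of_all _ fun y => by
      rw [norm_smul, Real.norm_of_nonneg (Real.exp_pos _).le]
      exact mul_le_mul_of_nonneg_left (hB _) (Real.exp_pos _).le)
  rwa [integral_mul_const, integral_exp_neg_Ioi_zero, one_mul] at h

theorem expAverage_add {f g : ℝ → E} {B C : ℝ} (hf : Continuous f) (hB : ∀ x, ‖f x‖ ≤ B)
    (hg : Continuous g) (hC : ∀ x, ‖g x‖ ≤ C) (σ x : ℝ) :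
    expAverage σ (fun y => f y + g y) x = expAverage σ f x + expAverage σ g x := by
  simp only [expAverage, smul_add]
  exact integral_add (integrableOn_exp_neg_smul_comp hf hB σ x)
    (integrableOn_exp_neg_smul_comp hg hC σ x)

theorem expAverage_const_smul (c : ℝ) (f : ℝ → E) (σ x : ℝ) :
    expAverage σ (fun y => c • f y) x = c • expAverage σ f x := by
  simp only [expAverage]
  rw [← integral_smul]
  congr 1
  ext y
  rw [smul_comm]

end HalfLineAverage

theorem expAverage_const_mul (c : ℝ) (f : ℝ → ℝ) (σ x : ℝ) :
    expAverage σ (fun y => c * f y) x = c * expAverage σ f x :=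
  expAverage_const_smul c f σ x

theorem abs_expAverage_le {f : ℝ → ℝ} {B : ℝ} (hB : ∀ x, |f x| ≤ B) (σ x : ℝ) :
    |expAverage σ f x| ≤ B :=
  norm_expAverage_le (f := f) hB σ x

theorem expAverage_sub {f g : ℝ → ℝ} {B C : ℝ} (hf : Continuous f) (hB : ∀ x, |f x| ≤ B)
    (hg : Continuous g) (hC : ∀ x, |g x| ≤ C) (σ x : ℝ) :
    expAverage σ (fun y => f y - g y) x = expAverage σ f x - expAverage σ g x := by
  simp only [expAverage, smul_sub]
  exact integral_sub (integrableOn_exp_neg_smul_comp hf hB σ x)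
    (integrableOn_exp_neg_smul_comp hg hC σ x)

/-- Integration by parts on e^{-y}f(x + σy): the boundary term at infinity vanishes because f is
bounded, the one at 0 is -f(x), and σ² = 1 allows solving for the average of f'. Derivatives under
the Green kernel are removed this way. -/
theorem expAverage_deriv {f f' : ℝ → ℝ} {B C : ℝ} (hf : ∀ x, HasDerivAt f (f' x) x)
    (hf' : Continuous f') (hB : ∀ x, |f x| ≤ B) (hC : ∀ x, |f' x| ≤ C) {σ : ℝ} (hσ : σ * σ = 1)
    (x : ℝ) : expAverage σ f' x = σ * (expAverage σ f x - f x) := by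
  have hfc : Continuous f := continuous_iff_continuousAt.2 fun x => (hf x).continuousAt
  have hlin : ∀ y : ℝ, HasDerivAt (fun y : ℝ => x + σ * y) σ y := fun y => by
    simpa using ((hasDerivAt_id y).const_mul σ).const_add x
  have hd : ∀ y : ℝ, HasDerivAt (fun y => Real.exp (-y) * f (x + σ * y))
      (σ * (Real.exp (-y) • f' (x + σ * y)) - Real.exp (-y) • f (x + σ * y)) y := fun y => by
    have h1 : HasDerivAt (fun y => Real.exp (-y)) (-Real.exp (-y)) y := by
      simpa using (hasDerivAt_neg y).exp
    have h2 : HasDerivAt (fun y => f (x + σ * y)) (f' (x + σ * y) * σ) y :=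
      (hf (x + σ * y)).comp y (hlin y)
    convert! h1.mul h2 using 1
    simp only [smul_eq_mul]
    ring
  have hi' := integrableOn_exp_neg_smul_comp hf' hC σ x
  have hi := integrableOn_exp_neg_smul_comp hfc hB σ x
  have hlim : Tendsto (fun y => Real.exp (-y) * f (x + σ * y)) atTop (𝓝 0) := by
    refine squeeze_zero_norm (a := fun y => Real.exp (-y) * B) (fun y => ?_) ?_
    · rw [norm_mul, Real.norm_of_nonneg (Real.exp_pos _).le]
      exact mul_le_mul_of_nonneg_left (hB _) (Real.exp_pos _).le
    · simpa using (Real.tendsto_exp_neg_atTop_nhds_zero).mul_const B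
  have key := integral_Ioi_of_hasDerivAt_of_tendsto' (a := 0) (fun y _ => hd y)
    ((hi'.const_mul σ).sub hi) hlim
  rw [integral_sub (hi'.const_mul σ) hi, integral_const_mul] at key
  simp only [neg_zero, Real.exp_zero, mul_zero, add_zero, one_mul] at key
  change σ * expAverage σ f' x - expAverage σ f x = 0 - f x at key
  linear_combination σ * key - expAverage σ f' x * hσ

/-- This is the partial fraction (1 - ∂ₓ²)⁻¹ = ½[(1 - ∂ₓ)⁻¹ + (1 + ∂ₓ)⁻¹], obtained by splitting the
convolution integral at 0. -/
theorem integral_greenKernel_mul {f : ℝ → ℝ} {B : ℝ} (hf : Continuous f) (hB : ∀ x, |f x| ≤ B)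
    (x : ℝ) : (greenKernel ⋆[ContinuousLinearMap.mul ℝ ℝ, volume] f) x =
      (expAverage 1 f x + expAverage (-1) f x) / 2 := by
  have h1 := integrableOn_exp_neg_smul_comp hf hB (-1) x
  have h2 := integrableOn_exp_neg_smul_comp hf hB 1 x
  have hr : ∀ y ∈ Ioi (0 : ℝ), greenKernel y * f (x - y) =
      (1 / 2) * (Real.exp (-y) • f (x + -1 * y)) := fun y hy => by
    simp only [greenKernel, abs_of_pos (mem_Ioi.1 hy), smul_eq_mul]
    ring_nf
  have hl : ∀ y ∈ Ioi (0 : ℝ), greenKernel (-y) * f (x - (-y)) =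
      (1 / 2) * (Real.exp (-y) • f (x + 1 * y)) := fun y hy => by
    simp only [greenKernel, abs_neg, abs_of_pos (mem_Ioi.1 hy), smul_eq_mul]
    ring_nf
  have hir : IntegrableOn (fun y => greenKernel y * f (x - y)) (Ioi 0) :=
    IntegrableOn.congr_fun (h1.const_mul (1 / 2)) (fun y hy => (hr y hy).symm) measurableSet_Ioi
  have hil : IntegrableOn (fun y => greenKernel y * f (x - y)) (Iic 0) := by
    have : IntegrableOn (fun y => greenKernel (-y) * f (x - -y)) (Ioi 0) :=
      IntegrableOn.congr_fun (h2.const_mul (1 / 2)) (fun y hy => (hl y hy).symm) measurableSet_Ioi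
    have h3 := Iff.mpr integrableOn_Ici_iff_integrableOn_Ioi this
    rw [← neg_zero] at h3
    simpa using h3.comp_neg_Iic
  have hsum := setIntegral_union (Iic_disjoint_Ioi le_rfl) measurableSet_Ioi hil hir
  rw [Iic_union_Ioi, setIntegral_univ] at hsum
  rw [convolution_def]
  simp only [ContinuousLinearMap.mul_apply']
  rw [hsum, setIntegral_congr_fun measurableSet_Ioi hr]
  have hneg := integral_comp_neg_Ioi (0 : ℝ) (fun y => greenKernel y * f (x - y))
  rw [neg_zero] at hneg
  rw [← hneg, setIntegral_congr_fun measurableSet_Ioi hl, integral_const_mul, integral_const_mul]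
  simp only [expAverage]
  ring

/-! ### The right-hand side on bounded C² functions. -/

/-- `w` is `C²`, and `w`, `w'` and `w''` are bounded by `B`. -/
structure BoundedC2 (B : ℝ) (w : ℝ → ℝ) : Prop where
  contDiff : ContDiff ℝ 2 w
  abs_le : ∀ x, |w x| ≤ B
  abs_deriv_le : ∀ x, |deriv w x| ≤ B
  abs_deriv_deriv_le : ∀ x, |deriv (deriv w) x| ≤ B

namespace BoundedC2

variable {B : ℝ} {w : ℝ → ℝ}

theorem nonneg (h : BoundedC2 B w) : 0 ≤ B := (abs_nonneg _).trans (h.abs_le 0)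

theorem continuous (h : BoundedC2 B w) : Continuous w := h.contDiff.continuous

theorem contDiff_deriv (h : BoundedC2 B w) : ContDiff ℝ 1 (deriv w) :=
  ((contDiff_succ_iff_deriv (n := 1)).1 h.contDiff).2.2

theorem continuous_deriv (h : BoundedC2 B w) : Continuous (deriv w) := h.contDiff_deriv.continuous

theorem continuous_deriv_deriv (h : BoundedC2 B w) : Continuous (deriv (deriv w)) :=
  h.contDiff_deriv.continuous_deriv le_rfl

theorem hasDerivAt (h : BoundedC2 B w) (x : ℝ) : HasDerivAt w (deriv w x) x :=
  (h.contDiff.differentiable (by norm_num) x).hasDerivAt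

theorem hasDerivAt_deriv (h : BoundedC2 B w) (x : ℝ) :
    HasDerivAt (deriv w) (deriv (deriv w) x) x :=
  (h.contDiff_deriv.differentiable (by norm_num) x).hasDerivAt

end BoundedC2

theorem abs_mul_le_mul {a b A B : ℝ} (ha : |a| ≤ A) (hb : |b| ≤ B) : |a * b| ≤ A * B := by
  rw [abs_mul]
  exact mul_le_mul ha hb (abs_nonneg _) ((abs_nonneg _).trans ha)

theorem abs_const_mul_add_le {a b A B p q : ℝ} (hp : 0 ≤ p) (hq : 0 ≤ q) (ha : |a| ≤ A)
    (hb : |b| ≤ B) : |p * a + q * b| ≤ p * A + q * B := by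
  rw [abs_le] at *
  constructor <;> nlinarith

/-- For F = 2wₓ² + 6w², `expAverage_deriv` with σ = 1 and σ = -1 produces local terms -F and +F,
which cancel. No second derivative of w survives, and the coefficients of the averages of wₓ² are 2
+ 1 and -2 + 1. -/
theorem gchRHS_eq {B : ℝ} {w : ℝ → ℝ} (h : BoundedC2 B w) (x : ℝ) :
    gchRHS w x = 4 * w x * deriv w x - deriv w x ^ 2 +
      (3 * expAverage 1 (fun y => deriv w y * deriv w y) x + 6 * expAverage 1 (fun y => w y * w y) x
        - expAverage (-1) (fun y => deriv w y * deriv w y) x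
        - 6 * expAverage (-1) (fun y => w y * w y) x) / 2 := by
  have c0 := h.continuous
  have c1 := h.continuous_deriv
  have c2 := h.continuous_deriv_deriv
  have b00 : ∀ y, |w y * w y| ≤ B * B := fun y => abs_mul_le_mul (h.abs_le y) (h.abs_le y)
  have b01 : ∀ y, |w y * deriv w y| ≤ B * B := fun y =>
    abs_mul_le_mul (h.abs_le y) (h.abs_deriv_le y)
  have b11 : ∀ y, |deriv w y * deriv w y| ≤ B * B := fun y =>
    abs_mul_le_mul (h.abs_deriv_le y) (h.abs_deriv_le y)
  have b12 : ∀ y, |deriv w y * deriv (deriv w) y| ≤ B * B := fun y =>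
    abs_mul_le_mul (h.abs_deriv_le y) (h.abs_deriv_deriv_le y)
  have hF : ∀ y, HasDerivAt (fun z => 2 * deriv w z ^ 2 + 6 * w z ^ 2)
      (4 * (deriv w y * deriv (deriv w) y) + 12 * (w y * deriv w y)) y := fun y => by
    convert! (((h.hasDerivAt_deriv y).pow 2).const_mul 2).add
      (((h.hasDerivAt y).pow 2).const_mul 6) using 1
    push_cast
    ring
  have bF : ∀ y, |2 * deriv w y ^ 2 + 6 * w y ^ 2| ≤ 2 * (B * B) + 6 * (B * B) := fun y => by
    simpa only [sq] using abs_const_mul_add_le (by norm_num) (by norm_num) (b11 y) (b00 y)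
  have bF' : ∀ y, |4 * (deriv w y * deriv (deriv w) y) + 12 * (w y * deriv w y)| ≤
      4 * (B * B) + 12 * (B * B) := fun y =>
    abs_const_mul_add_le (by norm_num) (by norm_num) (b12 y) (b01 y)
  have cF' : Continuous fun y => 4 * (deriv w y * deriv (deriv w) y) + 12 * (w y * deriv w y) := by
    fun_prop
  have hsplit : ∀ σ, expAverage σ (fun z => 2 * deriv w z ^ 2 + 6 * w z ^ 2) x =
      2 * expAverage σ (fun y => deriv w y * deriv w y) x +
        6 * expAverage σ (fun y => w y * w y) x := fun σ => by
    rw [← expAverage_const_mul, ← expAverage_const_mul,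
      ← expAverage_add (B := 2 * (B * B)) (C := 6 * (B * B)) (by fun_prop) _ (by fun_prop)]
    · simp only [sq]
    · intro y
      rw [Real.norm_eq_abs, abs_mul, abs_of_pos (by norm_num : (0 : ℝ) < 6)]
      exact mul_le_mul_of_nonneg_left (b00 y) (by norm_num)
    · intro y
      rw [Real.norm_eq_abs, abs_mul, abs_two]
      exact mul_le_mul_of_nonneg_left (b11 y) (by norm_num)
  have hG : ∀ σ, expAverage σ (fun y => (4 * (deriv w y * deriv (deriv w) y) +
      12 * (w y * deriv w y)) + deriv w y * deriv w y) x =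
      expAverage σ (fun y => 4 * (deriv w y * deriv (deriv w) y) + 12 * (w y * deriv w y)) x +
        expAverage σ (fun y => deriv w y * deriv w y) x := fun σ =>
    expAverage_add cF' bF' (by fun_prop) b11 σ x
  have hfun : (fun y => deriv (fun z => 2 * deriv w z ^ 2 + 6 * w z ^ 2) y + deriv w y ^ 2) =
      fun y => (4 * (deriv w y * deriv (deriv w) y) + 12 * (w y * deriv w y)) +
        deriv w y * deriv w y := by
    funext y
    rw [(hF y).deriv, sq]
  rw [gchRHS, hfun, integral_greenKernel_mul (B := 4 * (B * B) + 12 * (B * B) + B * B)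
    (by fun_prop) (fun y => (abs_add_le _ _).trans (add_le_add (bF' y) (b11 y))), hG, hG,
    expAverage_deriv hF cF' bF bF' (σ := 1) (by norm_num),
    expAverage_deriv hF cF' bF bF' (σ := -1) (by norm_num), hsplit, hsplit]
  ring

/-- The form `-ω² + G ⋆ ω² + 2 G' ⋆ ω²`, `ω = 2 w - wₓ`, of the right-hand side. -/
theorem gchRHS_eq_sq {B : ℝ} {w : ℝ → ℝ} (h : BoundedC2 B w) (x : ℝ) :
    gchRHS w x = -(2 * w x - deriv w x) ^ 2 +
      (3 * expAverage 1 (fun y => (2 * w y - deriv w y) ^ 2) x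
        - expAverage (-1) (fun y => (2 * w y - deriv w y) ^ 2) x) / 2 := by
  have c0 := h.continuous
  have c1 := h.continuous_deriv
  have b00 : ∀ y, |w y * w y| ≤ B * B := fun y => abs_mul_le_mul (h.abs_le y) (h.abs_le y)
  have b01 : ∀ y, |w y * deriv w y| ≤ B * B := fun y =>
    abs_mul_le_mul (h.abs_le y) (h.abs_deriv_le y)
  have b11 : ∀ y, |deriv w y * deriv w y| ≤ B * B := fun y =>
    abs_mul_le_mul (h.abs_deriv_le y) (h.abs_deriv_le y)
  have hd : ∀ y, HasDerivAt (fun z => w z * w z) (2 * (w y * deriv w y)) y := fun y => by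
    convert! (h.hasDerivAt y).mul (h.hasDerivAt y) using 1
    ring
  have b01' : ∀ y, |2 * (w y * deriv w y)| ≤ 2 * (B * B) := fun y => by
    rw [abs_mul, abs_two]
    exact mul_le_mul_of_nonneg_left (b01 y) (by norm_num)
  -- The cross term -4wwₓ = -2(w²)ₓ is averaged by parts. The local multiples of w² so created
  -- cancel the 4w² in -ω².
  have hsplit : ∀ σ : ℝ, σ * σ = 1 → expAverage σ (fun y => (2 * w y - deriv w y) ^ 2) x =
      4 * expAverage σ (fun y => w y * w y) x + expAverage σ (fun y => deriv w y * deriv w y) x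
        - 2 * (σ * (expAverage σ (fun y => w y * w y) x - w x * w x)) := fun σ hσ => by
    have hfun : (fun y => (2 * w y - deriv w y) ^ 2) =
        fun y => (4 * (w y * w y) + deriv w y * deriv w y) - 2 * (2 * (w y * deriv w y)) := by
      funext y
      ring
    have b4 : ∀ y, |4 * (w y * w y)| ≤ 4 * (B * B) := fun y => by
      rw [abs_mul, abs_of_pos (by norm_num : (0 : ℝ) < 4)]
      exact mul_le_mul_of_nonneg_left (b00 y) (by norm_num)
    have b2 : ∀ y, |2 * (2 * (w y * deriv w y))| ≤ 2 * (2 * (B * B)) := fun y => by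
      rw [abs_mul, abs_two]
      exact mul_le_mul_of_nonneg_left (b01' y) (by norm_num)
    rw [hfun, expAverage_sub (B := 4 * (B * B) + B * B) (by fun_prop)
      (fun y => (abs_add_le _ _).trans (add_le_add (b4 y) (b11 y))) (by fun_prop) b2,
      expAverage_add (by fun_prop) b4 (by fun_prop) b11, expAverage_const_mul, expAverage_const_mul,
      expAverage_deriv hd (by fun_prop) b00 b01' hσ]
  rw [gchRHS_eq h, hsplit 1 (by norm_num), hsplit (-1) (by norm_num)]
  ring

/-- At a critical point of `v₁ - v₂`, the difference of the right-hand sides is controlled by the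
supremum of `|v₁ - v₂|`. -/
theorem abs_gchRHS_sub_le {B m : ℝ} {v₁ v₂ : ℝ → ℝ} (h₁ : BoundedC2 B v₁) (h₂ : BoundedC2 B v₂)
    (hm : ∀ y, |v₁ y - v₂ y| ≤ m) {x : ℝ} (hx : deriv v₁ x = deriv v₂ x) :
    |gchRHS v₁ x - gchRHS v₂ x| ≤ 28 * B * m := by
  have hB := h₁.nonneg
  have hm0 : 0 ≤ m := (abs_nonneg _).trans (hm 0)
  have c0 := h₁.continuous
  have c1 := h₁.continuous_deriv
  have c2 := h₁.continuous_deriv_deriv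
  have e0 := h₂.continuous
  have e1 := h₂.continuous_deriv
  have e2 := h₂.continuous_deriv_deriv
  have sum_le : ∀ {a b : ℝ}, |a| ≤ B → |b| ≤ B → |a + b| ≤ 2 * B := fun ha hb =>
    (abs_add_le _ _).trans (by linarith)
  have sub_le : ∀ {a b : ℝ}, |a| ≤ B → |b| ≤ B → |a - b| ≤ 2 * B := fun ha hb =>
    (abs_sub _ _).trans (by linarith)
  have sqb : ∀ {a : ℝ}, |a| ≤ B → |a * a| ≤ B * B := fun ha => abs_mul_le_mul ha ha
  have bS : ∀ y, |(v₁ y + v₂ y) * (v₁ y - v₂ y)| ≤ 2 * B * m := fun y =>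
    abs_mul_le_mul (sum_le (h₁.abs_le y) (h₂.abs_le y)) (hm y)
  have bS1 : ∀ y, |(deriv v₁ y + deriv v₂ y) * (v₁ y - v₂ y)| ≤ 2 * B * m := fun y =>
    abs_mul_le_mul (sum_le (h₁.abs_deriv_le y) (h₂.abs_deriv_le y)) (hm y)
  have bS2 : ∀ y, |(deriv (deriv v₁) y + deriv (deriv v₂) y) * (v₁ y - v₂ y)| ≤ 2 * B * m :=
    fun y => abs_mul_le_mul (sum_le (h₁.abs_deriv_deriv_le y) (h₂.abs_deriv_deriv_le y)) (hm y)
  have bD : ∀ y, |(deriv v₁ y + deriv v₂ y) * (deriv v₁ y - deriv v₂ y)| ≤ 2 * B * (2 * B) :=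
    fun y => abs_mul_le_mul (sum_le (h₁.abs_deriv_le y) (h₂.abs_deriv_le y))
      (sub_le (h₁.abs_deriv_le y) (h₂.abs_deriv_le y))
  have hd : ∀ y, HasDerivAt (fun z => (deriv v₁ z + deriv v₂ z) * (v₁ z - v₂ z))
      ((deriv (deriv v₁) y + deriv (deriv v₂) y) * (v₁ y - v₂ y) +
        (deriv v₁ y + deriv v₂ y) * (deriv v₁ y - deriv v₂ y)) y := fun y =>
    ((h₁.hasDerivAt_deriv y).add (h₂.hasDerivAt_deriv y)).mul
      ((h₁.hasDerivAt y).sub (h₂.hasDerivAt y))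
  have hsq : ∀ σ, expAverage σ (fun y => v₁ y * v₁ y) x - expAverage σ (fun y => v₂ y * v₂ y) x =
      expAverage σ (fun y => (v₁ y + v₂ y) * (v₁ y - v₂ y)) x := fun σ => by
    rw [← expAverage_sub (by fun_prop) (fun y => sqb (h₁.abs_le y)) (by fun_prop)
      (fun y => sqb (h₂.abs_le y))]
    congr 1
    funext y
    ring
  have hdsq : ∀ σ, expAverage σ (fun y => deriv v₁ y * deriv v₁ y) x -
      expAverage σ (fun y => deriv v₂ y * deriv v₂ y) x =
      expAverage σ (fun y => (deriv v₁ y + deriv v₂ y) * (deriv v₁ y - deriv v₂ y)) x := fun σ => by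
    rw [← expAverage_sub (by fun_prop) (fun y => sqb (h₁.abs_deriv_le y)) (by fun_prop)
      (fun y => sqb (h₂.abs_deriv_le y))]
    congr 1
    funext y
    ring
  -- With d = v₁ - v₂ and S = v₁' + v₂', write S d' = (S d)' - S' d and integrate the first term by
  -- parts. Only sup |d| remains, at the price of a bound on second derivatives; the three resulting
  -- terms are each at most 2Bm.
  have hibp : ∀ σ : ℝ, σ * σ = 1 →
      |expAverage σ (fun y => (deriv v₁ y + deriv v₂ y) * (deriv v₁ y - deriv v₂ y)) x| ≤
        6 * B * m := fun σ hσ => by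
    have h := expAverage_deriv hd (by fun_prop) bS1
      (fun y => (abs_add_le _ _).trans (add_le_add (bS2 y) (bD y))) hσ x
    rw [expAverage_add (by fun_prop) bS2 (by fun_prop) bD] at h
    have i1 := abs_expAverage_le bS1 σ x
    have i2 := abs_expAverage_le bS2 σ x
    have i3 := bS1 x
    rw [abs_le] at *
    rcases mul_self_eq_one_iff.1 hσ with rfl | rfl <;> constructor <;> linarith
  have i1 := abs_expAverage_le bS 1 x
  have i2 := abs_expAverage_le bS (-1) x
  have i3 := hibp 1 (by norm_num)
  have i4 := hibp (-1) (by norm_num)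
  have i5 : |(v₁ x - v₂ x) * deriv v₁ x| ≤ m * B := abs_mul_le_mul (hm x) (h₁.abs_deriv_le x)
  -- Since the derivatives agree at x, the local terms reduce to 4(v₁ - v₂)v₁'. The final constant
  -- is 4 + (3·6 + 6·2 + 6 + 6·2)/2 = 28.
  have key : gchRHS v₁ x - gchRHS v₂ x = 4 * ((v₁ x - v₂ x) * deriv v₁ x) +
      (3 * expAverage 1 (fun y => (deriv v₁ y + deriv v₂ y) * (deriv v₁ y - deriv v₂ y)) x +
        6 * expAverage 1 (fun y => (v₁ y + v₂ y) * (v₁ y - v₂ y)) x -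
        expAverage (-1) (fun y => (deriv v₁ y + deriv v₂ y) * (deriv v₁ y - deriv v₂ y)) x -
        6 * expAverage (-1) (fun y => (v₁ y + v₂ y) * (v₁ y - v₂ y)) x) / 2 := by
    rw [gchRHS_eq h₁, gchRHS_eq h₂, ← hsq, ← hsq, ← hdsq, ← hdsq, hx]
    ring
  rw [key]
  rw [abs_le] at *
  constructor <;> linarith

/-! ### The maximum principle. -/

/-- A continuous function vanishing at infinity attains the maximum of its absolute value. -/
theorem exists_abs_max_of_tendsto_zero {f : ℝ → ℝ} (hf : Continuous f)
    (h0 : Tendsto f (cocompact ℝ) (𝓝 0)) : ∃ x, ∀ y, |f y| ≤ |f x| := by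
  have h0' : Tendsto (fun x => |f x|) (cocompact ℝ) (𝓝 0) := by simpa using h0.abs
  by_cases h : ∀ y, |f y| ≤ |f 0|
  · exact ⟨0, h⟩
  · push Not at h
    obtain ⟨z, hz⟩ := h
    refine hf.abs.exists_forall_ge' z ?_
    exact (h0'.eventually_le_const ((abs_nonneg _).trans_lt hz))

/-- **Maximum principle.** A family `d t` of continuous functions vanishing at infinity, which
depends continuously on `t` in the supremum norm, starts from `0`, and at the points where `|d t|` is
maximal satisfies `|∂ₜ d| ≤ C |d|`, vanishes identically. -/
theorem eq_zero_of_abs_deriv_le_at_max {d r : ℝ → ℝ → ℝ} {T C : ℝ} (hT : 0 ≤ T)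
    (hd0 : ∀ x, d 0 x = 0) (hc : ∀ t ∈ Icc 0 T, Continuous (d t))
    (hz : ∀ t ∈ Icc 0 T, Tendsto (d t) (cocompact ℝ) (𝓝 0))
    (hsup : ∀ t ∈ Icc 0 T, ∀ η > 0, ∀ᶠ τ in 𝓝[Icc 0 T] t, ∀ x, |d τ x - d t x| ≤ η)
    (hder : ∀ t ∈ Icc 0 T, ∀ x, HasDerivAt (fun τ => d τ x) (r t x) t)
    (hr : ∀ t ∈ Icc 0 T, ∀ x, (∀ y, |d t y| ≤ |d t x|) → |r t x| ≤ C * |d t x|) :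
    ∀ t ∈ Icc 0 T, ∀ x, d t x = 0 := by
  choose! p hp using fun t ht => exists_abs_max_of_tendsto_zero (hc t ht) (hz t ht)
  set m : ℝ → ℝ := fun t => |d t (p t)| with hm
  have hmc : ContinuousOn m (Icc 0 T) := by
    intro t ht
    rw [ContinuousWithinAt, Metric.tendsto_nhds]
    intro η hη
    filter_upwards [hsup t ht (η / 2) (by positivity), self_mem_nhdsWithin] with τ hτ hτT
    have h1 := hp τ hτT (p t)
    have h2 := hp t ht (p τ)
    have h3 := abs_sub_abs_le_abs_sub (d τ (p τ)) (d t (p τ))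
    have h4 := abs_sub_abs_le_abs_sub (d t (p t)) (d τ (p t))
    rw [abs_sub_comm] at h4
    have h5 := hτ (p τ)
    have h6 := hτ (p t)
    rw [Real.dist_eq, abs_lt]
    simp only [hm]
    constructor <;> linarith
  -- Any rate above C works: the strict gap makes the derivative below strictly negative. It
  -- suffices to show that m vanishes where e^{-Kt}m(t) is maximal.
  set K : ℝ := C + 1
  set φ : ℝ → ℝ := fun t => Real.exp (-K * t) * m t with hφ
  have hφc : ContinuousOn φ (Icc 0 T) := (by fun_prop : Continuous fun t =>
    Real.exp (-K * t)).continuousOn.mul hmc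
  obtain ⟨t₀, ht₀, hmax⟩ := isCompact_Icc.exists_isMaxOn (nonempty_Icc.2 hT) hφc
  have hm0 : m t₀ = 0 := by
    by_contra hne
    have hpos : 0 < m t₀ := lt_of_le_of_ne (abs_nonneg _) (Ne.symm hne)
    have ht₀pos : 0 < t₀ := by
      refine lt_of_le_of_ne ht₀.1 fun h => hne ?_
      rw [hm, ← h]
      simp [hd0]
    -- The function m need not be differentiable, so the maximizing point is frozen at x. Then ψ ≤
    -- φ² with equality at t₀, so ψ is maximal there over [0, T]; but its derivative at t₀ is
    -- negative, which is absurd to the left of t₀.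
    set x := p t₀
    set ψ : ℝ → ℝ := fun τ => Real.exp (-2 * K * τ) * d τ x ^ 2
    have hψd : HasDerivAt ψ (Real.exp (-2 * K * t₀) *
        (2 * (d t₀ x * r t₀ x) - 2 * K * d t₀ x ^ 2)) t₀ := by
      have h1 : HasDerivAt (fun τ => Real.exp (-2 * K * τ))
          (Real.exp (-2 * K * t₀) * (-2 * K)) t₀ := by
        simpa using ((hasDerivAt_id t₀).const_mul (-2 * K)).exp
      convert! h1.mul ((hder t₀ ht₀ x).pow 2) using 1
      simp only [Pi.pow_apply]
      push_cast
      ring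
    have hneg : Real.exp (-2 * K * t₀) * (2 * (d t₀ x * r t₀ x) - 2 * K * d t₀ x ^ 2) < 0 := by
      refine mul_neg_of_pos_of_neg (Real.exp_pos _) ?_
      have h1 : d t₀ x * r t₀ x ≤ |d t₀ x| * (C * |d t₀ x|) :=
        (le_abs_self _).trans ((abs_mul _ _).le.trans
          (mul_le_mul_of_nonneg_left (hr t₀ ht₀ x (hp t₀ ht₀)) (abs_nonneg _)))
      have h2 : |d t₀ x| * |d t₀ x| = d t₀ x ^ 2 := by rw [← sq, sq_abs]
      have h3 : 0 < d t₀ x ^ 2 := by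
        rw [← h2]
        exact mul_pos hpos hpos
      have h4 : |d t₀ x| * (C * |d t₀ x|) = C * d t₀ x ^ 2 := by rw [← h2]; ring
      simp only [K]
      nlinarith
    have hψle : ∀ τ ∈ Icc 0 T, ψ τ ≤ ψ t₀ := fun τ hτ => by
      have e : ∀ s, Real.exp (-2 * K * s) * d s x ^ 2 = (Real.exp (-K * s) * |d s x|) ^ 2 :=
        fun s => by
          rw [mul_pow, sq_abs, ← Real.exp_nat_mul]
          congr 2
          push_cast
          ring
      have h1 : φ τ ≤ φ t₀ := hmax hτ
      simp only [ψ, e]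
      refine pow_le_pow_left₀ (by positivity) (le_trans ?_ h1) 2
      exact mul_le_mul_of_nonneg_left (hp τ hτ x) (Real.exp_pos _).le
    have hslope := (hasDerivAt_iff_tendsto_slope.1 hψd).eventually_lt_const hneg
    have hleft : ∀ᶠ τ in 𝓝[<] t₀, slope ψ t₀ τ < 0 :=
      hslope.filter_mono (nhdsWithin_mono _ fun y hy => ne_of_lt hy)
    obtain ⟨τ, hτ, hτ1⟩ := (hleft.and (Ioo_mem_nhdsLT ht₀pos)).exists
    rw [slope_def_field] at hτ
    have h1 := hψle τ ⟨hτ1.1.le, hτ1.2.le.trans ht₀.2⟩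
    have h2 : 0 ≤ (ψ τ - ψ t₀) / (τ - t₀) :=
      div_nonneg_of_nonpos (by linarith) (by linarith [hτ1.2])
    linarith
  intro t ht x
  have h1 : φ t ≤ φ t₀ := hmax ht
  simp only [hφ, hm0, mul_zero] at h1
  have h2 : m t ≤ 0 := by
    by_contra hcon
    push Not at hcon
    have := mul_pos (Real.exp_pos (-K * t)) hcon
    linarith
  have h3 := hp t ht x
  exact abs_eq_zero.1 (le_antisymm (h3.trans h2) (abs_nonneg _))

/-! ### The L² Fourier transform and its agreement with the integral transform. -/

section FourierLTwo

open scoped SchwartzMap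

/-- Locally integrable functions with the same integrals against Schwartz functions agree. -/
theorem ae_eq_of_integral_schwartz_smul_eq {f g : ℝ → ℂ} (hf : LocallyIntegrable f)
    (hg : LocallyIntegrable g) (h : ∀ φ : 𝓢(ℝ, ℂ), ∫ x, φ x • f x = ∫ x, φ x • g x) :
    f =ᵐ[volume] g := by
  refine ae_eq_of_integral_contDiff_smul_eq hf hg fun φ hφ hφc => ?_
  have hc : HasCompactSupport (Complex.ofRealCLM ∘ φ) := hφc.comp_left rfl
  have hs : ContDiff ℝ (⊤ : ℕ∞) (Complex.ofRealCLM ∘ φ) := by fun_prop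
  simpa using h (hc.toSchwartzMap hs)

/-- The L² transform is characterised by duality with Schwartz functions; later identities are all
checked against such test functions. -/
theorem integral_schwartz_smul_fourier_lp (F : Lp ℂ 2 (volume : Measure ℝ)) (φ : 𝓢(ℝ, ℂ)) :
    ∫ x, φ x • (𝓕 F : Lp ℂ 2 (volume : Measure ℝ)) x = ∫ x, (𝓕 φ) x • F x := by
  have h := congrArg (fun T => T φ) (Lp.fourier_toTemperedDistribution_eq F)
  simpa using h.symm

theorem integral_schwartz_smul_fourierInv_lp (F : Lp ℂ 2 (volume : Measure ℝ)) (φ : 𝓢(ℝ, ℂ)) :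
    ∫ x, φ x • (𝓕⁻ F : Lp ℂ 2 (volume : Measure ℝ)) x = ∫ x, (𝓕⁻ φ) x • F x := by
  have h := congrArg (fun T => T φ) (Lp.fourierInv_toTemperedDistribution_eq F)
  simpa using h.symm

theorem integral_fourierInv_smul_eq {φ V : ℝ → ℂ} (hφ : Integrable φ) (hV : Integrable V) :
    ∫ x, φ x • 𝓕⁻ V x = ∫ x, 𝓕⁻ φ x • V x := by
  symm
  have h := VectorFourier.integral_fourierIntegral_smul_eq_flip (μ := volume) (ν := volume)
    (L := -innerₗ ℝ) (e := Real.fourierChar) (f := φ) (g := V) Real.continuous_fourierChar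
    (by simp only [LinearMap.neg_apply]; exact continuous_inner.neg) hφ hV
  have e : (-innerₗ ℝ : ℝ →ₗ[ℝ] ℝ →ₗ[ℝ] ℝ).flip = -innerₗ ℝ := by
    ext
    simp
  rw [e] at h
  exact h

theorem continuous_fourierInv {V : ℝ → ℂ} (hV : Integrable V) : Continuous (𝓕⁻ V) := by
  have h : Continuous (𝓕 V) := VectorFourier.fourierIntegral_continuous
    Real.continuous_fourierChar (by exact continuous_inner) hV
  rw [show 𝓕⁻ V = fun x => 𝓕 V (-x) from funext fun x => Real.fourierInv_eq_fourier_neg V x]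
  exact h.comp continuous_neg

theorem norm_fourierInv_le (V : ℝ → ℂ) (x : ℝ) : ‖𝓕⁻ V x‖ ≤ ∫ ξ, ‖V ξ‖ := by
  rw [Real.fourierInv_eq]
  refine (norm_integral_le_integral_norm _).trans_eq ?_
  simp

/-- Tested against a Schwartz function, both the L² transform and the integral move onto the test
function. -/
theorem fourierInv_toLp_ae_eq {V : ℝ → ℂ} (hV : Integrable V) (hV2 : MemLp V 2) :
    (𝓕⁻ hV2.toLp : Lp ℂ 2 (volume : Measure ℝ)) =ᵐ[volume] 𝓕⁻ V := by
  refine ae_eq_of_integral_schwartz_smul_eq ((Lp.memLp _).locallyIntegrable (by norm_num))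
    (continuous_fourierInv hV).locallyIntegrable fun φ => ?_
  rw [integral_schwartz_smul_fourierInv_lp, integral_fourierInv_smul_eq φ.integrable hV]
  refine integral_congr_ae ?_
  filter_upwards [hV2.coeFn_toLp] with x hx
  rw [hx, SchwartzMap.fourierInv_coe]

theorem memLp_fourierInv {V : ℝ → ℂ} (hV : Integrable V) (hV2 : MemLp V 2) :
    MemLp (𝓕⁻ V) 2 :=
  (memLp_congr_ae (fourierInv_toLp_ae_eq hV hV2)).1 (Lp.memLp _)

theorem fourier_toLp_of_ae_eq_fourierInv {f V : ℝ → ℂ} (hV : Integrable V) (hV2 : MemLp V 2)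
    (hf : MemLp f 2) (h : f =ᵐ[volume] 𝓕⁻ V) :
    (𝓕 hf.toLp : Lp ℂ 2 (volume : Measure ℝ)) =ᵐ[volume] V := by
  have e : hf.toLp = 𝓕⁻ hV2.toLp :=
    Lp.ext (hf.coeFn_toLp.trans (h.trans (fourierInv_toLp_ae_eq hV hV2).symm))
  rw [e, FourierTransform.fourier_fourierInv_eq]
  exact hV2.coeFn_toLp

theorem eq_fourierInv_of_integrable_fourier {f V : ℝ → ℂ} (hf : MemLp f 2) (hc : Continuous f)
    (hV : Integrable V) (h : (𝓕 hf.toLp : Lp ℂ 2 (volume : Measure ℝ)) =ᵐ[volume] V) :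
    f = 𝓕⁻ V := by
  have hV2 : MemLp V 2 := (memLp_congr_ae h).1 (Lp.memLp _)
  have e : (𝓕 hf.toLp : Lp ℂ 2 (volume : Measure ℝ)) = hV2.toLp :=
    Lp.ext (h.trans hV2.coeFn_toLp.symm)
  have e2 : hf.toLp = 𝓕⁻ hV2.toLp := by
    rw [← e, FourierTransform.fourierInv_fourier_eq]
  refine MeasureTheory.Measure.eq_of_ae_eq (μ := volume) ?_ hc (continuous_fourierInv hV)
  refine hf.coeFn_toLp.symm.trans ?_
  rw [e2]
  exact fourierInv_toLp_ae_eq hV hV2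

/-- The `L²` Fourier transform turns derivatives into multiplication by `2πiξ`. -/
theorem fourier_toLp_deriv {f f' : ℝ → ℂ} (hd : ∀ x, HasDerivAt f (f' x) x) (hf : MemLp f 2)
    (hf' : MemLp f' 2) : (𝓕 hf'.toLp : Lp ℂ 2 (volume : Measure ℝ)) =ᵐ[volume]
      fun ξ => (2 * Real.pi * Complex.I * ξ) * (𝓕 hf.toLp : Lp ℂ 2 (volume : Measure ℝ)) ξ := by
  set F := (𝓕 hf.toLp : Lp ℂ 2 (volume : Measure ℝ))
  refine ae_eq_of_integral_schwartz_smul_eq ((Lp.memLp _).locallyIntegrable (by norm_num)) ?_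
    fun φ => ?_
  · exact ((Lp.memLp F).locallyIntegrable (by norm_num)).continuous_mul (by fun_prop)
  · have hm : (fun ξ : ℝ => (2 * Real.pi * Complex.I * ξ : ℂ)).HasTemperateGrowth := by fun_prop
    -- The transform of ψ = 2πiξφ is minus the derivative of the transform of φ, so integration by
    -- parts against f exchanges the multiplier for f'.
    set ψ : 𝓢(ℝ, ℂ) := SchwartzMap.smulLeftCLM ℂ (fun ξ : ℝ => (2 * Real.pi * Complex.I * ξ : ℂ)) φ
    have hψ : ∀ x, ψ x = (2 * Real.pi * Complex.I * x) * φ x := fun x =>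
      SchwartzMap.smulLeftCLM_apply_apply hm φ x
    have hxφ : Integrable fun x : ℝ => x • φ x := by
      refine ((SchwartzMap.smulLeftCLM ℂ (fun x : ℝ => (x : ℂ)) φ).integrable (μ := volume)).congr
        (ae_of_all _ fun x => ?_)
      simp [SchwartzMap.smulLeftCLM_apply_apply
        (show (fun x : ℝ => (x : ℂ)).HasTemperateGrowth by fun_prop)]
    have hder : ∀ x, HasDerivAt (𝓕 φ : 𝓢(ℝ, ℂ)) (-(𝓕 ψ : 𝓢(ℝ, ℂ)) x) x := fun x => by
      have h := Real.hasDerivAt_fourier φ.integrable hxφ x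
      convert! h using 1
      rw [SchwartzMap.fourier_coe, Real.fourier_eq, Real.fourier_eq, ← integral_neg]
      congr 1
      funext y
      rw [hψ, ← smul_neg, smul_eq_mul]
      congr 1
      ring
    have i1 : Integrable fun x => (𝓕 φ : 𝓢(ℝ, ℂ)) x * f' x :=
      ((𝓕 φ : 𝓢(ℝ, ℂ)).memLp 2 volume).integrable_mul hf'
    have i2 : Integrable fun x => -(𝓕 ψ : 𝓢(ℝ, ℂ)) x * f x :=
      ((𝓕 ψ : 𝓢(ℝ, ℂ)).memLp 2 volume).neg.integrable_mul hf
    have i3 : Integrable fun x => (𝓕 φ : 𝓢(ℝ, ℂ)) x * f x :=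
      ((𝓕 φ : 𝓢(ℝ, ℂ)).memLp 2 volume).integrable_mul hf
    have hibp := integral_mul_deriv_eq_deriv_mul_of_integrable (fun x _ => hder x)
      (fun x _ => hd x) i1 i2 i3
    calc ∫ x, φ x • (𝓕 hf'.toLp : Lp ℂ 2 (volume : Measure ℝ)) x
        = ∫ x, (𝓕 φ : 𝓢(ℝ, ℂ)) x * f' x := by
          rw [integral_schwartz_smul_fourier_lp]
          refine integral_congr_ae ?_
          filter_upwards [hf'.coeFn_toLp] with x hx
          rw [hx, smul_eq_mul]
      _ = ∫ x, (𝓕 ψ : 𝓢(ℝ, ℂ)) x * f x := by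
          rw [hibp, ← integral_neg]
          simp
      _ = ∫ x, ψ x • F x := by
          rw [integral_schwartz_smul_fourier_lp]
          refine integral_congr_ae ?_
          filter_upwards [hf.coeFn_toLp] with x hx
          rw [hx, smul_eq_mul]
      _ = ∫ x, φ x • ((2 * Real.pi * Complex.I * x) * F x) := by
          refine integral_congr_ae (ae_of_all _ fun x => ?_)
          simp only [hψ, smul_eq_mul]
          ring

end FourierLTwo

/-! ### Derivatives and decay of inverse Fourier transforms. -/

section InverseTransformDerivatives

theorem hasDerivAt_fourierInv {V : ℝ → ℂ} (hV : Integrable V)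
    (hV' : Integrable fun ξ : ℝ => (ξ : ℂ) * V ξ) (x : ℝ) :
    HasDerivAt (𝓕⁻ V) (𝓕⁻ (fun ξ : ℝ => (2 * Real.pi * Complex.I * ξ) * V ξ) x) x := by
  have h := Real.hasDerivAt_fourier (f := fun ξ => V (-ξ)) hV.comp_neg
    (by simpa using! hV'.comp_neg.neg) x
  rw [Real.fourierInv_eq_fourier_comp_neg, Real.fourierInv_eq_fourier_comp_neg]
  convert! h using 3
  push_cast
  rw [smul_eq_mul]
  ring

theorem tendsto_fourierInv_cocompact (V : ℝ → ℂ) : Tendsto (𝓕⁻ V) (cocompact ℝ) (𝓝 0) := by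
  rw [Real.fourierInv_eq_fourier_comp_neg]
  exact Real.zero_at_infty_fourier _

theorem integrable_mul_of_le {w : ℝ → ℝ} {V m : ℝ → ℂ} (hV : AEStronglyMeasurable V)
    (hm : AEStronglyMeasurable m) (hw : Integrable fun ξ => w ξ * ‖V ξ‖)
    (h : ∀ ξ, ‖m ξ‖ ≤ w ξ) : Integrable fun ξ => m ξ * V ξ := by
  refine hw.mono' (hm.mul hV) (ae_of_all _ fun ξ => ?_)
  rw [norm_mul]
  exact mul_le_mul_of_nonneg_right (h ξ) (norm_nonneg _)

/-- A real function whose inverse transform data decay is `C²` with bounds. -/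
theorem boundedC2_of_eq_fourierInv {g : ℝ → ℝ} {V : ℝ → ℂ} (hV : AEStronglyMeasurable V)
    (hint : Integrable fun ξ : ℝ => (1 + (2 * Real.pi * ξ) ^ 2) * ‖V ξ‖)
    (hg : ∀ x, (g x : ℂ) = 𝓕⁻ V x) :
    BoundedC2 (∫ ξ : ℝ, (1 + (2 * Real.pi * ξ) ^ 2) * ‖V ξ‖) g ∧
      (∀ x, ((deriv g x : ℝ) : ℂ) = 𝓕⁻ (fun ξ : ℝ => (2 * Real.pi * Complex.I * ξ) * V ξ) x) ∧
      Tendsto g (cocompact ℝ) (𝓝 0) := by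
  have n1 : ∀ ξ : ℝ, ‖(2 * Real.pi * Complex.I * ξ : ℂ)‖ = |2 * Real.pi * ξ| := fun ξ => by
    simp [abs_mul, abs_of_pos Real.pi_pos]
  have w0 : ∀ ξ : ℝ, ‖(1 : ℂ)‖ ≤ 1 + (2 * Real.pi * ξ) ^ 2 := fun ξ => by
    rw [norm_one]; nlinarith [sq_nonneg (2 * Real.pi * ξ)]
  have w1 : ∀ ξ : ℝ, ‖(2 * Real.pi * Complex.I * ξ : ℂ)‖ ≤ 1 + (2 * Real.pi * ξ) ^ 2 := fun ξ => by
    rw [n1, ← sq_abs (2 * Real.pi * ξ)]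
    nlinarith [sq_nonneg (|2 * Real.pi * ξ| - 1), abs_nonneg (2 * Real.pi * ξ)]
  have w2 : ∀ ξ : ℝ, ‖(2 * Real.pi * Complex.I * ξ : ℂ) * (2 * Real.pi * Complex.I * ξ)‖ ≤
      1 + (2 * Real.pi * ξ) ^ 2 := fun ξ => by
    rw [norm_mul, n1, ← sq, sq_abs]
    linarith
  have wx : ∀ ξ : ℝ, ‖(ξ : ℂ)‖ ≤ 1 + (2 * Real.pi * ξ) ^ 2 := fun ξ => by
    refine le_trans ?_ (w1 ξ)
    rw [n1, Complex.norm_real, Real.norm_eq_abs, abs_mul]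
    refine le_mul_of_one_le_left (abs_nonneg _) ?_
    rw [abs_of_pos Real.two_pi_pos]
    linarith [Real.pi_gt_three]
  have wxx : ∀ ξ : ℝ, ‖(ξ : ℂ) * (2 * Real.pi * Complex.I * ξ)‖ ≤ 1 + (2 * Real.pi * ξ) ^ 2 :=
    fun ξ => by
      refine le_trans ?_ (w2 ξ)
      rw [norm_mul, norm_mul (2 * Real.pi * Complex.I * ξ : ℂ)]
      refine mul_le_mul_of_nonneg_right ?_ (norm_nonneg _)
      rw [n1, Complex.norm_real, Real.norm_eq_abs, abs_mul]
      refine le_mul_of_one_le_left (abs_nonneg _) ?_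
      rw [abs_of_pos Real.two_pi_pos]
      linarith [Real.pi_gt_three]
  set D : ℝ → ℂ := fun ξ => 2 * Real.pi * Complex.I * ξ
  have hD : Continuous D := by fun_prop
  have i0 : Integrable V := by
    simpa using integrable_mul_of_le hV aestronglyMeasurable_const hint w0
  have i1 : Integrable fun ξ => D ξ * V ξ := integrable_mul_of_le hV hD.aestronglyMeasurable hint w1
  have i2 : Integrable fun ξ => D ξ * (D ξ * V ξ) := by
    simpa only [mul_assoc] using
      integrable_mul_of_le (m := fun ξ => D ξ * D ξ) hV (by fun_prop) hint w2
  have ix : Integrable fun ξ : ℝ => (ξ : ℂ) * V ξ :=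
    integrable_mul_of_le hV (by fun_prop) hint wx
  have ixx : Integrable fun ξ : ℝ => (ξ : ℂ) * (D ξ * V ξ) := by
    simpa only [mul_assoc] using integrable_mul_of_le (m := fun ξ : ℝ => (ξ : ℂ) * D ξ) hV
      (by fun_prop) hint wxx
  have bnd : ∀ m : ℝ → ℂ, (∀ ξ, ‖m ξ‖ ≤ 1 + (2 * Real.pi * ξ) ^ 2) → ∀ x,
      ‖𝓕⁻ (fun ξ => m ξ * V ξ) x‖ ≤ ∫ ξ : ℝ, (1 + (2 * Real.pi * ξ) ^ 2) * ‖V ξ‖ := fun m hm x => by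
    refine (norm_fourierInv_le _ x).trans ?_
    refine integral_mono_of_nonneg (ae_of_all _ fun _ => norm_nonneg _) hint
      (ae_of_all _ fun ξ => ?_)
    simp only [norm_mul]
    exact mul_le_mul_of_nonneg_right (hm ξ) (norm_nonneg _)
  -- The derivative of a complex function with real values is real, so differentiating the complex
  -- integral also differentiates g. It is applied twice.
  have re_deriv : ∀ {f : ℝ → ℝ} {F F' : ℝ → ℂ}, (∀ x, (f x : ℂ) = F x) →
      (∀ x, HasDerivAt F (F' x) x) → (∀ x, HasDerivAt f (F' x).re x) ∧
        ∀ x, ((F' x).re : ℂ) = F' x := fun {f F F'} hf hF => by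
    have e : (fun x => (f x : ℂ)) = F := funext hf
    have h1 : ∀ x, HasDerivAt f (F' x).re x := fun x => by
      have h := Complex.reCLM.hasFDerivAt.comp_hasDerivAt x (hF x)
      rw [← e] at h
      exact h
    refine ⟨h1, fun x => ?_⟩
    have h2 := (h1 x).ofReal_comp
    rw [e] at h2
    exact h2.unique (hF x)
  obtain ⟨d1, e1⟩ := re_deriv hg (fun x => hasDerivAt_fourierInv i0 ix x)
  have hg' : deriv g = fun x => (𝓕⁻ (fun ξ => D ξ * V ξ) x).re := funext fun x => (d1 x).deriv
  have hg1 : ∀ x, ((deriv g x : ℝ) : ℂ) = 𝓕⁻ (fun ξ => D ξ * V ξ) x := fun x => by rw [hg', e1 x]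
  obtain ⟨d2, e2⟩ := re_deriv hg1 (fun x => hasDerivAt_fourierInv i1 ixx x)
  have hg'' : deriv (deriv g) = fun x => (𝓕⁻ (fun ξ => D ξ * (D ξ * V ξ)) x).re :=
    funext fun x => (d2 x).deriv
  have hg2 : ∀ x, ((deriv (deriv g) x : ℝ) : ℂ) = 𝓕⁻ (fun ξ => D ξ * (D ξ * V ξ)) x := fun x => by
    rw [hg'', e2 x]
  have hcont2 : Continuous (deriv (deriv g)) := by
    rw [hg'']
    exact Complex.continuous_re.comp (continuous_fourierInv i2)
  refine ⟨⟨?_, fun x => ?_, fun x => ?_, fun x => ?_⟩, hg1, ?_⟩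
  · have c1 : ContDiff ℝ 1 (deriv g) :=
      contDiff_one_iff_deriv.2 ⟨fun x => (d2 x).differentiableAt, hcont2⟩
    exact (contDiff_succ_iff_deriv (n := 1)).2
      ⟨fun x => (d1 x).differentiableAt, by simp, c1⟩
  · have := bnd (fun _ => 1) w0 x
    simp only [one_mul] at this
    rwa [← hg, Complex.norm_real] at this
  · have := bnd D w1 x
    rwa [← hg1, Complex.norm_real] at this
  · have := bnd (fun ξ => D ξ * D ξ) w2 x
    have e : (fun ξ => D ξ * D ξ * V ξ) = fun ξ => D ξ * (D ξ * V ξ) :=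
      funext fun ξ => mul_assoc _ _ _
    rwa [e, ← hg2, Complex.norm_real] at this
  · have h := (Complex.continuous_re.tendsto 0).comp (tendsto_fourierInv_cocompact V)
    simpa [Function.comp_def, ← hg] using h

end InverseTransformDerivatives

/-! ### Sobolev embedding into C². -/

section SobolevEmbedding

theorem memLp_of_sobolevENorm_lt_top {σ : ℝ} {f : ℝ → ℝ} (h : sobolevENorm σ f < ∞) :
    MemLp (fun x => (f x : ℂ)) 2 volume := by
  by_contra hn
  simp [sobolevENorm, hn] at h

/-- Dividing the weight 1 + |2πξ|² needed for two derivatives by the H^σ weight leaves the exponent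
1 - σ/2. Its square decays like |ξ|^{-2(σ-2)}, which is integrable because σ > 5/2. -/
theorem memLp_sobolevWeight {σ : ℝ} (hσ : 5 / 2 < σ) :
    MemLp (fun ξ : ℝ => (1 + (2 * Real.pi * ξ) ^ 2) ^ (1 - σ / 2)) 2 volume := by
  have h := (integrable_rpow_neg_one_add_norm_sq (E := ℝ) (μ := volume) (r := 2 * (σ - 2))
    (by simp; linarith)).comp_mul_left' (R := 2 * Real.pi) Real.two_pi_pos.ne'
  rw [memLp_two_iff_integrable_sq]
  · refine h.congr (ae_of_all _ fun ξ => ?_)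
    have hpos : (0 : ℝ) ≤ 1 + (2 * Real.pi * ξ) ^ 2 := by positivity
    simp only [Real.norm_eq_abs, sq_abs]
    rw [← Real.rpow_mul_natCast hpos]
    congr 1
    push_cast
    ring
  · refine Continuous.aestronglyMeasurable ?_
    refine Continuous.rpow_const (by fun_prop) fun ξ => Or.inl ?_
    positivity

/-- **Sobolev embedding** of `H^σ(ℝ)`, `σ > 5/2`, into the bounded `C²` functions. -/
theorem exists_boundedC2_of_sobolevENorm {σ : ℝ} (hσ : 5 / 2 < σ) :
    ∃ C : ℝ, 0 ≤ C ∧ ∀ f : ℝ → ℝ, Continuous f → sobolevENorm σ f < ∞ →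
      BoundedC2 (C * (sobolevENorm σ f).toReal) f ∧ Tendsto f (cocompact ℝ) (𝓝 0) := by
  refine ⟨(eLpNorm (fun ξ : ℝ => (1 + (2 * Real.pi * ξ) ^ 2) ^ (1 - σ / 2)) 2 volume).toReal,
    ENNReal.toReal_nonneg, fun f hf hfin => ?_⟩
  have hmem := memLp_of_sobolevENorm_lt_top hfin
  set V : ℝ → ℂ := ⇑(𝓕 hmem.toLp : Lp ℂ 2 (volume : Measure ℝ)) with hVdef
  set κ : ℝ → ℝ := fun ξ => (1 + (2 * Real.pi * ξ) ^ 2) ^ (1 - σ / 2)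
  set g : ℝ → ℂ := fun ξ => (((1 + (2 * Real.pi * ξ) ^ 2) ^ (σ / 2) : ℝ) : ℂ) * V ξ
  have hnorm : sobolevENorm σ f = eLpNorm g 2 volume := by
    rw [sobolevENorm, dif_pos hmem]
  have hVm : AEStronglyMeasurable V volume := (Lp.memLp _).aestronglyMeasurable
  have hgm : AEStronglyMeasurable g volume := by
    refine AEStronglyMeasurable.mul (Continuous.aestronglyMeasurable ?_) hVm
    refine Complex.continuous_ofReal.comp (Continuous.rpow_const (by fun_prop) fun ξ => Or.inl ?_)
    positivity
  have hκ := memLp_sobolevWeight hσ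
  have heq : ∀ ξ : ℝ, ‖κ ξ • g ξ‖ = (1 + (2 * Real.pi * ξ) ^ 2) * ‖V ξ‖ := fun ξ => by
    have hpos : (0 : ℝ) < 1 + (2 * Real.pi * ξ) ^ 2 := by positivity
    have hk := Real.rpow_nonneg hpos.le (1 - σ / 2)
    have hk' := Real.rpow_nonneg hpos.le (σ / 2)
    simp only [κ, g, norm_smul, norm_mul, Complex.norm_real]
    rw [Real.norm_of_nonneg hk, Real.norm_of_nonneg hk', ← mul_assoc, ← Real.rpow_add hpos]
    norm_num
  -- Cauchy–Schwarz: the transform weighted for two derivatives is κ ∈ L² times the H^σ density g ∈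
  -- L².
  have hhol : eLpNorm (κ • g) 1 volume ≤ eLpNorm κ 2 volume * eLpNorm g 2 volume :=
    eLpNorm_smul_le_mul_eLpNorm hgm hκ.aestronglyMeasurable
  have hprod : eLpNorm κ 2 volume * eLpNorm g 2 volume < ∞ :=
    ENNReal.mul_lt_top hκ.2 (hnorm ▸ hfin)
  have hmem1 : MemLp (κ • g) 1 volume :=
    ⟨hκ.aestronglyMeasurable.smul hgm, hhol.trans_lt hprod⟩
  have hint : Integrable fun ξ : ℝ => (1 + (2 * Real.pi * ξ) ^ 2) * ‖V ξ‖ :=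
    (memLp_one_iff_integrable.1 hmem1).norm.congr (ae_of_all _ heq)
  have hle : ∫ ξ : ℝ, (1 + (2 * Real.pi * ξ) ^ 2) * ‖V ξ‖ ≤
      (eLpNorm κ 2 volume).toReal * (sobolevENorm σ f).toReal := by
    rw [← ENNReal.toReal_mul, hnorm, ← integral_congr_ae (ae_of_all _ heq)]
    change ∫ ξ, ‖(κ • g) ξ‖ ≤ _
    rw [integral_norm_eq_lintegral_enorm hmem1.aestronglyMeasurable,
      ← eLpNorm_one_eq_lintegral_enorm]
    exact ENNReal.toReal_mono hprod.ne hhol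
  have hVi : Integrable V := by
    simpa using integrable_mul_of_le (m := fun _ => 1) hVm aestronglyMeasurable_const hint
      (fun ξ => by rw [norm_one]; nlinarith [sq_nonneg (2 * Real.pi * ξ)])
  have hfV := eq_fourierInv_of_integrable_fourier hmem (Complex.continuous_ofReal.comp hf) hVi
    (EventuallyEq.refl _ _)
  obtain ⟨h1, -, h3⟩ := boundedC2_of_eq_fourierInv hVm hint (fun x => congrFun hfV x)
  exact ⟨⟨h1.contDiff, fun x => (h1.abs_le x).trans hle, fun x => (h1.abs_deriv_le x).trans hle,
    fun x => (h1.abs_deriv_deriv_le x).trans hle⟩, h3⟩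

end SobolevEmbedding

/-! ### Uniqueness of strong solutions. -/

section Uniqueness

theorem BoundedC2.mono {B C : ℝ} {w : ℝ → ℝ} (h : BoundedC2 B w) (hBC : B ≤ C) : BoundedC2 C w :=
  ⟨h.contDiff, fun x => (h.abs_le x).trans hBC, fun x => (h.abs_deriv_le x).trans hBC,
    fun x => (h.abs_deriv_deriv_le x).trans hBC⟩

theorem BoundedC2.add {B C : ℝ} {f g : ℝ → ℝ} (hf : BoundedC2 B f) (hg : BoundedC2 C g) :
    BoundedC2 (B + C) (f + g) := by
  have h1 : deriv (f + g) = deriv f + deriv g :=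
    funext fun x => ((hf.hasDerivAt x).add (hg.hasDerivAt x)).deriv
  have h2 : deriv (deriv f + deriv g) = deriv (deriv f) + deriv (deriv g) :=
    funext fun x => ((hf.hasDerivAt_deriv x).add (hg.hasDerivAt_deriv x)).deriv
  refine ⟨hf.contDiff.add hg.contDiff, fun x => ?_, fun x => ?_, fun x => ?_⟩
  · exact (abs_add_le _ _).trans (add_le_add (hf.abs_le x) (hg.abs_le x))
  · rw [h1]
    exact (abs_add_le _ _).trans (add_le_add (hf.abs_deriv_le x) (hg.abs_deriv_le x))
  · rw [h1, h2]
    exact (abs_add_le _ _).trans (add_le_add (hf.abs_deriv_deriv_le x) (hg.abs_deriv_deriv_le x))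

variable {σ ε : ℝ} {u₀ : ℝ → ℝ} {v : ℝ → ℝ → ℝ}

/-- The embedding applies to the difference v τ - v t itself, so continuity in H^σ becomes
continuity in the C² norm, uniformly in x. -/
theorem IsStrongSolution.eventually_boundedC2_sub (hσ : 5 / 2 < σ)
    (hv : IsStrongSolution σ ε u₀ v) {t : ℝ} (ht : t ∈ Ioo (-ε) ε) {η : ℝ} (hη : 0 < η) :
    ∀ᶠ τ in 𝓝 t, BoundedC2 η (v τ - v t) := by
  obtain ⟨C, hC0, hC⟩ := exists_boundedC2_of_sobolevENorm hσ
  have hlim := (hv.continuous_sobolev t ht).2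
  -- The denominator is C + 1 because C may be 0.
  have hpos : (0 : ℝ≥0∞) < ENNReal.ofReal (η / (C + 1)) := by
    rw [ENNReal.ofReal_pos]
    positivity
  filter_upwards [hlim.eventually_lt_const hpos, Ioo_mem_nhds ht.1 ht.2] with τ h1 hτ
  have hfin : sobolevENorm σ (v τ - v t) < ∞ := h1.trans ENNReal.ofReal_lt_top
  refine (hC _ ((hv.contDiff τ hτ).continuous.sub (hv.contDiff t ht).continuous) hfin).1.mono ?_
  have h2 : (sobolevENorm σ (v τ - v t)).toReal ≤ η / (C + 1) := by
    refine (ENNReal.toReal_mono ENNReal.ofReal_ne_top h1.le).trans_eq ?_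
    exact ENNReal.toReal_ofReal (by positivity)
  calc C * (sobolevENorm σ (v τ - v t)).toReal ≤ (C + 1) * (η / (C + 1)) :=
        mul_le_mul (by linarith) h2 ENNReal.toReal_nonneg (by positivity)
    _ = η := by field_simp

/-- Near each time the bound is that of v t plus 1; compactness patches these local bounds together.
-/
theorem IsStrongSolution.exists_boundedC2 (hσ : 5 / 2 < σ) (hv : IsStrongSolution σ ε u₀ v)
    {K : Set ℝ} (hK : IsCompact K) (hKε : K ⊆ Ioo (-ε) ε) :
    ∃ B, ∀ t ∈ K, BoundedC2 B (v t) := by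
  obtain ⟨C, hC0, hC⟩ := exists_boundedC2_of_sobolevENorm hσ
  refine hK.induction_on (p := fun s => ∃ B, ∀ t ∈ s, BoundedC2 B (v t)) ⟨0, by simp⟩
    (fun s s' hs ⟨B, hB⟩ => ⟨B, fun t ht => hB t (hs ht)⟩)
    (fun s s' ⟨B, hB⟩ ⟨B', hB'⟩ => ⟨max B B', fun t ht => ht.elim
      (fun h => (hB t h).mono (le_max_left _ _)) fun h => (hB' t h).mono (le_max_right _ _)⟩) ?_
  intro t ht
  have h0 := (hC _ (hv.contDiff t (hKε ht)).continuous (hv.continuous_sobolev t (hKε ht)).1).1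
  refine ⟨{τ | BoundedC2 1 (v τ - v t)}, mem_nhdsWithin_of_mem_nhds
    (hv.eventually_boundedC2_sub hσ (hKε ht) one_pos), C * (sobolevENorm σ (v t)).toReal + 1,
    fun τ hτ => ?_⟩
  have h1 := h0.add (show BoundedC2 1 (v τ - v t) from hτ)
  rwa [add_sub_cancel] at h1

/-- The maximum principle runs forward from time 0, so it is applied to v(eT) with e = 1 and e = -1.
Replacing t by -t only changes the sign of the time derivative, which the principle ignores. -/
theorem IsStrongSolution.eq_of_initial_eq (hσ : 5 / 2 < σ) {v₁ v₂ : ℝ → ℝ → ℝ}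
    (h₁ : IsStrongSolution σ ε u₀ v₁) (h₂ : IsStrongSolution σ ε u₀ v₂) :
    ∀ t ∈ Ioo (-ε) ε, ∀ x, v₁ t x = v₂ t x := by
  have key : ∀ e : ℝ, |e| = 1 → ∀ T, 0 ≤ T → T < ε → ∀ x, v₁ (e * T) x - v₂ (e * T) x = 0 := by
    intro e he T hT hTε
    have hmem : ∀ t ∈ Icc 0 T, e * t ∈ Ioo (-ε) ε := fun t ht => by
      rw [mem_Ioo, ← abs_lt, abs_mul, he, one_mul, abs_of_nonneg ht.1]
      exact ht.2.trans_lt hTε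
    have hcomp : IsCompact ((fun t => e * t) '' Icc 0 T) :=
      isCompact_Icc.image (by fun_prop)
    have hsub : (fun t => e * t) '' Icc 0 T ⊆ Ioo (-ε) ε := by
      rintro _ ⟨t, ht, rfl⟩
      exact hmem t ht
    obtain ⟨B₁, hB₁⟩ := h₁.exists_boundedC2 hσ hcomp hsub
    obtain ⟨B₂, hB₂⟩ := h₂.exists_boundedC2 hσ hcomp hsub
    set B := max B₁ B₂
    have b₁ : ∀ t ∈ Icc 0 T, BoundedC2 B (v₁ (e * t)) := fun t ht =>
      (hB₁ _ (mem_image_of_mem _ ht)).mono (le_max_left _ _)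
    have b₂ : ∀ t ∈ Icc 0 T, BoundedC2 B (v₂ (e * t)) := fun t ht =>
      (hB₂ _ (mem_image_of_mem _ ht)).mono (le_max_right _ _)
    obtain ⟨C, hC0, hC⟩ := exists_boundedC2_of_sobolevENorm hσ
    refine eq_zero_of_abs_deriv_le_at_max (T := T) (C := 28 * B)
      (d := fun t x => v₁ (e * t) x - v₂ (e * t) x)
      (r := fun t x => (gchRHS (v₁ (e * t)) x - gchRHS (v₂ (e * t)) x) * e) hT ?_ ?_ ?_ ?_ ?_ ?_ T
      ⟨hT, le_rfl⟩
    · intro x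
      simp [h₁.initial, h₂.initial]
    · exact fun t ht => (b₁ t ht).continuous.sub (b₂ t ht).continuous
    · intro t ht
      have z₁ := (hC _ (b₁ t ht).continuous (h₁.continuous_sobolev _ (hmem t ht)).1).2
      have z₂ := (hC _ (b₂ t ht).continuous (h₂.continuous_sobolev _ (hmem t ht)).1).2
      simpa using z₁.sub z₂
    · intro t ht η hη
      have hlim : Tendsto (fun τ => e * τ) (𝓝[Icc 0 T] t) (𝓝 (e * t)) :=
        ((continuous_const_mul e).tendsto t).mono_left nhdsWithin_le_nhds
      filter_upwards [hlim.eventually (h₁.eventually_boundedC2_sub hσ (hmem t ht) (half_pos hη)),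
        hlim.eventually (h₂.eventually_boundedC2_sub hσ (hmem t ht) (half_pos hη))] with τ c₁ c₂ x
      have i₁ := c₁.abs_le x
      have i₂ := c₂.abs_le x
      simp only [Pi.sub_apply] at i₁ i₂
      rw [abs_le] at *
      constructor <;> linarith
    · intro t ht x
      have hl : HasDerivAt (fun τ => e * τ) e t := by simpa using (hasDerivAt_id t).const_mul e
      have d₁ := (h₁.equation _ (hmem t ht) x).comp t hl
      have d₂ := (h₂.equation _ (hmem t ht) x).comp t hl
      convert! d₁.sub d₂ using 1
      ring
    · intro t ht x hx
      have hdf : ∀ y, HasDerivAt (fun y => v₁ (e * t) y - v₂ (e * t) y)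
          (deriv (v₁ (e * t)) y - deriv (v₂ (e * t)) y) y := fun y =>
        ((b₁ t ht).hasDerivAt y).sub ((b₂ t ht).hasDerivAt y)
      have hcrit : deriv (v₁ (e * t)) x = deriv (v₂ (e * t)) x := by
        -- |d| may fail to be differentiable, so criticality is read off from d². This says nothing
        -- when d(x) = 0, but then the maximum is 0 and d vanishes identically.
        have hmax : IsLocalMax (fun y => (v₁ (e * t) y - v₂ (e * t) y) ^ 2) x :=
          Eventually.of_forall fun y => sq_le_sq.2 (hx y)
        have h := hmax.hasDerivAt_eq_zero ((hdf x).pow 2)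
        by_cases h0 : v₁ (e * t) x - v₂ (e * t) x = 0
        · have hz : (fun y => v₁ (e * t) y - v₂ (e * t) y) = fun _ => 0 := by
            funext y
            have := hx y
            rw [h0, abs_zero] at this
            exact abs_eq_zero.1 (le_antisymm this (abs_nonneg _))
          have h' := hdf x
          rw [hz] at h'
          have := h'.unique (hasDerivAt_const x (0 : ℝ))
          linarith
        · have : deriv (v₁ (e * t)) x - deriv (v₂ (e * t)) x = 0 := by
            simpa [h0] using h
          linarith
      rw [abs_mul, he, mul_one]
      exact abs_gchRHS_sub_le (b₁ t ht) (b₂ t ht) hx hcrit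
  intro t ht x
  rcases le_total 0 t with h | h
  · have := key 1 (by simp) t h ht.2 x
    rw [one_mul] at this
    linarith
  · have := key (-1) (by simp) (-t) (by linarith) (by linarith [ht.1]) x
    rw [neg_one_mul, neg_neg] at this
    linarith

end Uniqueness

/-! ### Exponentially weighted norms and convolution. -/

section ExponentialWeights

theorem eLpNorm_two_sq {α E : Type*} [MeasurableSpace α] [NormedAddCommGroup E] (μ : Measure α)
    (f : α → E) : eLpNorm f 2 μ ^ 2 = ∫⁻ x, ‖f x‖ₑ ^ 2 ∂μ := by
  have h := eLpNorm_nnreal_pow_eq_lintegral (μ := μ) (f := f) (p := 2) (by norm_num)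
  norm_cast at h
  simpa using! h

/-- Cauchy–Schwarz for the factorization FG = F^{1/2} · (F^{1/2}G). -/
theorem sq_lintegral_mul_le {α : Type*} [MeasurableSpace α] (μ : Measure α) {F G : α → ℝ≥0∞}
    (hF : AEMeasurable F μ) (hG : AEMeasurable G μ) :
    (∫⁻ x, F x * G x ∂μ) ^ 2 ≤ (∫⁻ x, F x ∂μ) * ∫⁻ x, F x * G x ^ 2 ∂μ := by
  have h := ENNReal.lintegral_mul_le_Lp_mul_Lq μ Real.HolderConjugate.two_two
    (f := fun x => F x ^ (1 / 2 : ℝ)) (g := fun x => F x ^ (1 / 2 : ℝ) * G x)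
    (hF.pow_const _) ((hF.pow_const _).mul hG)
  have hhalf : ∀ z : ℝ≥0∞, z ^ (1 / 2 : ℝ) * z ^ (1 / 2 : ℝ) = z := fun z => by
    rw [← ENNReal.rpow_add_of_nonneg _ _ (by norm_num) (by norm_num)]
    norm_num
  have hhalf2 : ∀ z : ℝ≥0∞, (z ^ (1 / 2 : ℝ)) ^ 2 = z := fun z => by rw [sq, hhalf]
  have e1 : ∀ x, ((fun x => F x ^ (1 / 2 : ℝ)) * fun x => F x ^ (1 / 2 : ℝ) * G x) x =
      F x * G x := fun x => by
    simp only [Pi.mul_apply]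
    rw [← mul_assoc, hhalf]
  simp only [e1, ENNReal.rpow_two, hhalf2, mul_pow] at h
  calc (∫⁻ x, F x * G x ∂μ) ^ 2 ≤ ((∫⁻ x, F x ∂μ) ^ (1 / 2 : ℝ) *
        (∫⁻ x, F x * G x ^ 2 ∂μ) ^ (1 / 2 : ℝ)) ^ 2 := by gcongr
    _ = _ := by rw [mul_pow, hhalf2, hhalf2]

/-- **Young's inequality** `L¹ ⋆ L² ⊆ L²`, for functions with values in `[0, ∞]`. -/
theorem lintegral_sq_convolution_le {F G : ℝ → ℝ≥0∞} (hF : AEMeasurable F)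
    (hG : AEMeasurable G) :
    ∫⁻ x, (∫⁻ y, F y * G (x - y)) ^ 2 ≤ (∫⁻ x, F x) ^ 2 * ∫⁻ x, G x ^ 2 := by
  have hGx : ∀ x, AEMeasurable (fun y => G (x - y)) := fun x =>
    hG.comp_quasiMeasurePreserving (quasiMeasurePreserving_sub_left volume x)
  have hprod : AEMeasurable (fun p : ℝ × ℝ => F p.2 * G (p.1 - p.2) ^ 2)
      (volume.prod volume) := by
    refine AEMeasurable.mul (hF.comp_quasiMeasurePreserving
      Measure.quasiMeasurePreserving_snd) (AEMeasurable.pow_const ?_ 2)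
    exact hG.comp_quasiMeasurePreserving
      (quasiMeasurePreserving_sub_of_right_invariant volume volume)
  calc ∫⁻ x, (∫⁻ y, F y * G (x - y)) ^ 2
      ≤ ∫⁻ x, (∫⁻ y, F y) * ∫⁻ y, F y * G (x - y) ^ 2 :=
        lintegral_mono fun x => sq_lintegral_mul_le volume hF (hGx x)
    _ = (∫⁻ y, F y) * ∫⁻ x, ∫⁻ y, F y * G (x - y) ^ 2 :=
        lintegral_const_mul'' _ hprod.lintegral_prod_right'
    _ = (∫⁻ y, F y) * ∫⁻ y, ∫⁻ x, F y * G (x - y) ^ 2 := by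
        rw [lintegral_lintegral_swap hprod]
    _ = (∫⁻ y, F y) * ∫⁻ y, F y * ∫⁻ x, G x ^ 2 := by
        congr 1
        refine lintegral_congr fun y => ?_
        have hy : AEMeasurable fun x => G (x - y) := hG.comp_quasiMeasurePreserving
          (measurePreserving_sub_right volume y).quasiMeasurePreserving
        rw [lintegral_const_mul'' _ (hy.pow_const 2),
          lintegral_sub_right_eq_self (fun x => G x ^ 2) y]
    _ = _ := by
        rw [lintegral_mul_const'' _ hF, sq, mul_assoc]

theorem lintegral_convolution_eq {F G : ℝ → ℝ≥0∞} (hF : AEMeasurable F) (hG : AEMeasurable G) :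
    ∫⁻ x, ∫⁻ y, F y * G (x - y) = (∫⁻ x, F x) * ∫⁻ x, G x := by
  have hprod : AEMeasurable (fun p : ℝ × ℝ => F p.2 * G (p.1 - p.2)) (volume.prod volume) :=
    (hF.comp_quasiMeasurePreserving Measure.quasiMeasurePreserving_snd).mul
      (hG.comp_quasiMeasurePreserving
        (quasiMeasurePreserving_sub_of_right_invariant volume volume))
  rw [lintegral_lintegral_swap hprod, ← lintegral_mul_const'' _ hF]
  refine lintegral_congr fun y => ?_
  have hy : AEMeasurable fun x => G (x - y) := hG.comp_quasiMeasurePreserving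
    (measurePreserving_sub_right volume y).quasiMeasurePreserving
  rw [lintegral_const_mul'' _ hy, lintegral_sub_right_eq_self]

/-- Multiplication by the weight `e^{a|ξ|}`. -/
def expWeight (a : ℝ) (g : ℝ → ℂ) (ξ : ℝ) : ℂ := (Real.exp (a * |ξ|) : ℂ) * g ξ

/-- The sum of the `L¹` and the `L²` norm with weight `e^{a|ξ|}`. -/
def expNorm (a : ℝ) (g : ℝ → ℂ) : ℝ≥0∞ :=
  eLpNorm (expWeight a g) 1 volume + eLpNorm (expWeight a g) 2 volume

theorem norm_expWeight (a : ℝ) (g : ℝ → ℂ) (ξ : ℝ) :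
    ‖expWeight a g ξ‖ = Real.exp (a * |ξ|) * ‖g ξ‖ := by
  rw [expWeight, norm_mul, Complex.norm_real, Real.norm_of_nonneg (Real.exp_pos _).le]

theorem aestronglyMeasurable_expWeight {g : ℝ → ℂ} (hg : AEStronglyMeasurable g) (a : ℝ) :
    AEStronglyMeasurable (expWeight a g) :=
  AEStronglyMeasurable.mul (by fun_prop) hg

theorem expNorm_sum_le {ι : Type*} (s : Finset ι) {f : ι → ℝ → ℂ} (a : ℝ)
    (hf : ∀ i ∈ s, AEStronglyMeasurable (f i)) :
    expNorm a (fun ξ => ∑ i ∈ s, f i ξ) ≤ ∑ i ∈ s, expNorm a (f i) := by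
  have e : expWeight a (fun ξ => ∑ i ∈ s, f i ξ) = ∑ i ∈ s, expWeight a (f i) := by
    funext ξ
    simp [expWeight, Finset.mul_sum]
  have hm : ∀ i ∈ s, AEStronglyMeasurable (expWeight a (f i)) := fun i hi =>
    aestronglyMeasurable_expWeight (hf i hi) a
  simp only [expNorm, e, Finset.sum_add_distrib]
  exact add_le_add (eLpNorm_sum_le hm le_rfl) (eLpNorm_sum_le hm (by norm_num))

theorem expNorm_le_mul {a b c : ℝ} {f g : ℝ → ℂ}
    (h : ∀ ξ, Real.exp (a * |ξ|) * ‖f ξ‖ ≤ c * (Real.exp (b * |ξ|) * ‖g ξ‖)) :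
    expNorm a f ≤ ENNReal.ofReal c * expNorm b g := by
  simp only [← norm_expWeight] at h
  rw [expNorm, expNorm, mul_add]
  exact add_le_add (eLpNorm_le_mul_eLpNorm_of_ae_le_mul (ae_of_all _ h) 1)
    (eLpNorm_le_mul_eLpNorm_of_ae_le_mul (ae_of_all _ h) 2)

theorem aestronglyMeasurable_convolution {f g : ℝ → ℂ} (hf : AEStronglyMeasurable f)
    (hg : AEStronglyMeasurable g) :
    AEStronglyMeasurable (f ⋆[ContinuousLinearMap.mul ℂ ℂ, volume] g) :=
  (hf.convolution_integrand (ContinuousLinearMap.mul ℂ ℂ) hg).integral_prod_right'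

/-- The weight is submultiplicative, since |ξ| ≤ |η| + |ξ - η| and a ≥ 0. -/
theorem enorm_expWeight_convolution_le {a : ℝ} (ha : 0 ≤ a) (f g : ℝ → ℂ) (ξ : ℝ) :
    ‖expWeight a (f ⋆[ContinuousLinearMap.mul ℂ ℂ, volume] g) ξ‖ₑ ≤
      ∫⁻ η, ‖expWeight a f η‖ₑ * ‖expWeight a g (ξ - η)‖ₑ := by
  rw [expWeight, convolution_def, ← integral_const_mul]
  refine (enorm_integral_le_lintegral_enorm _).trans (lintegral_mono fun η => ?_)
  rw [← enorm_mul]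
  refine enorm_le_iff_norm_le.2 ?_
  rw [norm_mul, norm_mul, norm_expWeight, norm_expWeight, ContinuousLinearMap.mul_apply', norm_mul,
    Complex.norm_real, Real.norm_of_nonneg (Real.exp_pos _).le]
  have h1 : Real.exp (a * |ξ|) ≤ Real.exp (a * |η|) * Real.exp (a * |ξ - η|) := by
    rw [← Real.exp_add, ← mul_add]
    refine Real.exp_le_exp.2 (mul_le_mul_of_nonneg_left ?_ ha)
    simpa using abs_add_le η (ξ - η)
  calc Real.exp (a * |ξ|) * (‖f η‖ * ‖g (ξ - η)‖)
      ≤ (Real.exp (a * |η|) * Real.exp (a * |ξ - η|)) * (‖f η‖ * ‖g (ξ - η)‖) :=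
        mul_le_mul_of_nonneg_right h1 (by positivity)
    _ = _ := by ring

/-- The weighted norms are submultiplicative for convolution. -/
theorem expNorm_convolution_le {a : ℝ} (ha : 0 ≤ a) {f g : ℝ → ℂ} (hf : AEStronglyMeasurable f)
    (hg : AEStronglyMeasurable g) :
    expNorm a (f ⋆[ContinuousLinearMap.mul ℂ ℂ, volume] g) ≤ expNorm a f * expNorm a g := by
  have hF := (aestronglyMeasurable_expWeight hf a).enorm
  have hG := (aestronglyMeasurable_expWeight hg a).enorm
  have h1 : eLpNorm (expWeight a (f ⋆[ContinuousLinearMap.mul ℂ ℂ, volume] g)) 1 volume ≤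
      eLpNorm (expWeight a f) 1 volume * eLpNorm (expWeight a g) 1 volume := by
    simp only [eLpNorm_one_eq_lintegral_enorm]
    rw [← lintegral_convolution_eq hF hG]
    exact lintegral_mono fun ξ => enorm_expWeight_convolution_le ha f g ξ
  have h2 : eLpNorm (expWeight a (f ⋆[ContinuousLinearMap.mul ℂ ℂ, volume] g)) 2 volume ≤
      eLpNorm (expWeight a f) 1 volume * eLpNorm (expWeight a g) 2 volume := by
    rw [← ENNReal.pow_le_pow_left_iff two_ne_zero, mul_pow, eLpNorm_two_sq, eLpNorm_two_sq,
      eLpNorm_one_eq_lintegral_enorm]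
    refine le_trans (lintegral_mono fun ξ => ?_) (lintegral_sq_convolution_le hF hG)
    gcongr
    exact enorm_expWeight_convolution_le ha f g ξ
  calc expNorm a (f ⋆[ContinuousLinearMap.mul ℂ ℂ, volume] g)
      ≤ eLpNorm (expWeight a f) 1 volume * expNorm a g := by
        rw [expNorm, expNorm, mul_add]
        exact add_le_add h1 h2
    _ ≤ expNorm a f * expNorm a g := by
        gcongr
        exact le_self_add

/-- The derivative loss: δ|ξ| ≤ e^{δ|ξ|}, so a multiplier of order one is bounded from width a + δ
to width a with norm of order 1/δ. -/
theorem expNorm_mul_le_of_norm_le {K a δ : ℝ} (hK : 0 ≤ K) (hδ : 0 < δ) {q : ℝ → ℂ}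
    (hq : ∀ ξ, ‖q ξ‖ ≤ K * |ξ|) (f : ℝ → ℂ) :
    expNorm a (fun ξ => q ξ * f ξ) ≤ ENNReal.ofReal (K / δ) * expNorm (a + δ) f := by
  refine expNorm_le_mul fun ξ => ?_
  have h1 : |ξ| ≤ Real.exp (δ * |ξ|) / δ := by
    rw [le_div_iff₀ hδ]
    linarith [Real.add_one_le_exp (δ * |ξ|)]
  rw [norm_mul, add_mul, Real.exp_add]
  calc Real.exp (a * |ξ|) * (‖q ξ‖ * ‖f ξ‖)
      ≤ Real.exp (a * |ξ|) * ((K * (Real.exp (δ * |ξ|) / δ)) * ‖f ξ‖) := by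
        gcongr
        exact (hq ξ).trans (by gcongr)
    _ = _ := by ring

/-! ### The Cauchy–Kovalevskaya majorant. -/

theorem catalan_le_four_pow (n : ℕ) : catalan n ≤ 4 ^ n := by
  have h1 := succ_mul_catalan_eq_centralBinom n
  have h2 : n.centralBinom ≤ 4 ^ n := by
    have := Nat.sum_range_choose (2 * n)
    have h3 : (2 * n).choose n ≤ ∑ m ∈ Finset.range (2 * n + 1), (2 * n).choose m :=
      Finset.single_le_sum (f := fun m => (2 * n).choose m) (fun _ _ => Nat.zero_le _)
        (Finset.mem_range.2 (by omega))
    rw [this, pow_mul] at h3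
    simpa [Nat.centralBinom] using h3
  nlinarith

/-- **Abstract Cauchy–Kovalevskaya estimate.** In a scale of norms, a quadratic recursion which loses
one derivative produces coefficients with geometric growth. -/
theorem le_pow_of_quadratic_recursion {N : ℝ → ℕ → ℝ≥0∞} {K M b : ℝ} (hK : 0 ≤ K) (hM : 0 ≤ M)
    (h0 : ∀ a, 0 ≤ a → a < b → N a 0 ≤ ENNReal.ofReal M)
    (hrec : ∀ a δ n, 0 ≤ a → 0 < δ → N a (n + 1) ≤ ENNReal.ofReal (K / δ / (n + 1)) *
      ∑ ij ∈ Finset.HasAntidiagonal.antidiagonal n, N (a + δ) ij.1 * N (a + δ) ij.2) (n : ℕ) :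
    ∀ a, 0 ≤ a → a < b → N a n ≤
      ENNReal.ofReal (M * catalan n * (K * M * Real.exp 1 / (b - a)) ^ n) := by
  induction n using Nat.strong_induction_on with
  | _ n ih =>
    intro a ha hab
    rcases n with _ | n
    · simpa using h0 a ha hab
    have hba : 0 < b - a := by linarith
    -- The width given up at each stage depends on n: this choice leaves the fraction (n + 1)/(n +
    -- 2) of the available width, so the accumulated losses stay bounded.
    set δ := (b - a) / (n + 2) with hδ
    have hδ0 : 0 < δ := by positivity
    have hδb : b - (a + δ) = (b - a) * ((n + 1) / (n + 2)) := by
      rw [hδ]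
      field_simp
      ring
    have hlt : a + δ < b := by
      have : 0 < b - (a + δ) := by
        rw [hδb]
        positivity
      linarith
    set L := K * M * Real.exp 1 / (b - (a + δ)) with hL
    have hL0 : 0 ≤ L := by
      rw [hL, hδb]
      positivity
    have hsum : ∑ ij ∈ Finset.HasAntidiagonal.antidiagonal n, N (a + δ) ij.1 * N (a + δ) ij.2 ≤
        ENNReal.ofReal (M ^ 2 * catalan (n + 1) * L ^ n) := by
      -- The quadratic sum of the induction bounds is the Catalan recursion.
      rw [catalan_succ', Nat.cast_sum, Finset.mul_sum, Finset.sum_mul,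
        ENNReal.ofReal_sum_of_nonneg fun ij _ => by positivity]
      refine Finset.sum_le_sum fun ij hij => ?_
      have hij' := Finset.HasAntidiagonal.mem_antidiagonal.1 hij
      have i1 := ih ij.1 (by omega) (a + δ) (by positivity) hlt
      have i2 := ih ij.2 (by omega) (a + δ) (by positivity) hlt
      refine (mul_le_mul' i1 i2).trans_eq ?_
      rw [← ENNReal.ofReal_mul (by positivity), ← hij', pow_add]
      congr 1
      push_cast
      ring
    refine (hrec a δ n ha hδ0).trans ((mul_le_mul_right hsum _).trans ?_)
    rw [← ENNReal.ofReal_mul (by positivity)]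
    refine ENNReal.ofReal_le_ofReal ?_
    -- Of these n + 1 factors, n come from evaluating Lⁿ at the larger width a + δ and one from
    -- 1/(δ(n + 1)). Their product (1 + 1/(n + 1))^{n+1} is at most e, which is the e in the rate.
    have hexp : (((n : ℝ) + 2) / (n + 1)) ^ (n + 1) ≤ Real.exp 1 := by
      have h := Real.add_one_le_exp (1 / ((n : ℝ) + 1))
      have h2 : ((n : ℝ) + 2) / (n + 1) = 1 / ((n : ℝ) + 1) + 1 := by
        field_simp
        ring
      rw [h2]
      refine (pow_le_pow_left₀ (by positivity) h _).trans_eq ?_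
      rw [← Real.exp_nat_mul]
      congr 1
      push_cast
      field_simp
    have key : K / δ / (n + 1) * (M ^ 2 * catalan (n + 1) * L ^ n) =
        M * catalan (n + 1) * (K * M / (b - a)) * (K * M * Real.exp 1 / (b - a)) ^ n *
          (((n : ℝ) + 2) / (n + 1)) ^ (n + 1) := by
      rw [hL, hδb, hδ, pow_succ (((n : ℝ) + 2) / (n + 1)),
        show K * M * Real.exp 1 / ((b - a) * ((n + 1) / (n + 2))) =
          (K * M * Real.exp 1 / (b - a)) * (((n : ℝ) + 2) / (n + 1)) by field_simp, mul_pow]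
      field_simp
    rw [key]
    calc _ ≤ M * catalan (n + 1) * (K * M / (b - a)) * (K * M * Real.exp 1 / (b - a)) ^ n *
          Real.exp 1 := mul_le_mul_of_nonneg_left hexp (by positivity)
      _ = _ := by
        rw [pow_succ]
        ring

end ExponentialWeights

/-! ### Fourier transforms of data in E_s. -/

section AnalyticData

theorem memLp_exp_neg_mul_abs {c : ℝ} (hc : 0 < c) :
    MemLp (fun ξ : ℝ => Real.exp (-c * |ξ|)) 2 volume := by
  have hcont : Continuous fun ξ : ℝ => Real.exp (-c * |ξ|) := by fun_prop
  rw [memLp_two_iff_integrable_sq hcont.aestronglyMeasurable]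
  refine ((integrable_inv_one_add_sq).comp_mul_left' hc.ne').mono'
    (hcont.pow 2).aestronglyMeasurable (ae_of_all _ fun ξ => ?_)
  rw [Real.norm_of_nonneg (by positivity), ← Real.exp_nat_mul]
  have hy : 0 ≤ c * |ξ| := by positivity
  have h2 : (c * ξ) ^ 2 = (c * |ξ|) ^ 2 := by rw [mul_pow, mul_pow, sq_abs]
  rw [h2, show ((2 : ℕ) : ℝ) * (-c * |ξ|) = -(2 * (c * |ξ|)) by push_cast; ring, Real.exp_neg]
  refine inv_anti₀ (by positivity) ?_
  have h3 := Real.add_one_le_exp (c * |ξ|)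
  rw [two_mul, Real.exp_add]
  nlinarith

/-- A weighted `L²` bound gives a weighted `L¹` bound with a smaller weight. -/
theorem expNorm_lt_top_of_eLpNorm_two {b c : ℝ} (hbc : b < c) {h : ℝ → ℂ}
    (hm : AEStronglyMeasurable h) (hh : eLpNorm (expWeight c h) 2 volume < ∞) :
    expNorm b h < ∞ := by
  have hc : 0 < c - b := by linarith
  have hk := memLp_exp_neg_mul_abs hc
  refine ENNReal.add_lt_top.2 ⟨?_, ?_⟩
  · have e : expWeight b h = (fun ξ : ℝ => Real.exp (-(c - b) * |ξ|)) • expWeight c h := by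
      funext ξ
      simp only [expWeight, Pi.smul_apply', Complex.real_smul]
      rw [← mul_assoc, ← Complex.ofReal_mul, ← Real.exp_add]
      congr 3
      ring
    rw [e]
    exact (eLpNorm_smul_le_mul_eLpNorm (p := 2) (q := 2) (r := 1)
      (aestronglyMeasurable_expWeight hm c) hk.aestronglyMeasurable).trans_lt
      (ENNReal.mul_lt_top hk.2 hh)
  · refine (eLpNorm_mono fun ξ => ?_).trans_lt hh
    rw [norm_expWeight, norm_expWeight]
    gcongr

theorem eLpNorm_fourier_toLp {f : ℝ → ℂ} (hf : MemLp f 2) :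
    eLpNorm (𝓕 hf.toLp : Lp ℂ 2 (volume : Measure ℝ)) 2 volume = eLpNorm f 2 volume := by
  have h := Lp.norm_fourier_eq (E := ℝ) (F := ℂ) hf.toLp
  rw [Lp.norm_def, Lp.norm_def, ENNReal.toReal_eq_toReal_iff' (Lp.eLpNorm_ne_top _)
    (Lp.eLpNorm_ne_top _)] at h
  rw [h]
  exact eLpNorm_congr_ae hf.coeFn_toLp

variable {s : ℝ} {u₀ : ℝ → ℝ}

/-- Both the factor (k + 1)² ≥ 1 and the derivative half of the H¹ norm are discarded: only the
growth k!/sᵏ is needed. -/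
theorem eLpNorm_iteratedDeriv_le (hs : 0 < s) (k : ℕ) :
    eLpNorm (iteratedDeriv k u₀) 2 volume ≤
      ENNReal.ofReal (k.factorial / s ^ k) * analyticENorm s u₀ := by
  have h1 : eLpNorm (iteratedDeriv k u₀) 2 volume ≤ h1ENorm (iteratedDeriv k u₀) := by
    rw [h1ENorm]
    calc eLpNorm (iteratedDeriv k u₀) 2 volume
        = (eLpNorm (iteratedDeriv k u₀) 2 volume ^ 2) ^ (1 / 2 : ℝ) := by
          rw [← ENNReal.rpow_natCast, ← ENNReal.rpow_mul]
          norm_num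
      _ ≤ _ := by
          gcongr
          exact le_self_add
  have h2 : ENNReal.ofReal (s ^ k / ((k.factorial : ℝ) / ((k : ℝ) + 1) ^ 2)) *
      h1ENorm (iteratedDeriv k u₀) ≤ analyticENorm s u₀ :=
    le_iSup (fun k : ℕ => ENNReal.ofReal (s ^ k / ((k.factorial : ℝ) / ((k : ℝ) + 1) ^ 2)) *
      h1ENorm (iteratedDeriv k u₀)) k
  have hk : (0 : ℝ) < k.factorial := by exact_mod_cast k.factorial_pos
  have h3 : (1 : ℝ) ≤ k.factorial / s ^ k * (s ^ k / ((k.factorial : ℝ) / ((k : ℝ) + 1) ^ 2)) := by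
    have : (k.factorial : ℝ) / s ^ k * (s ^ k / ((k.factorial : ℝ) / ((k : ℝ) + 1) ^ 2)) =
      ((k : ℝ) + 1) ^ 2 := by field_simp
    rw [this]
    nlinarith [k.cast_nonneg (α := ℝ)]
  calc eLpNorm (iteratedDeriv k u₀) 2 volume ≤ 1 * h1ENorm (iteratedDeriv k u₀) := by
        rwa [one_mul]
    _ ≤ ENNReal.ofReal (k.factorial / s ^ k * (s ^ k / ((k.factorial : ℝ) / ((k : ℝ) + 1) ^ 2))) *
        h1ENorm (iteratedDeriv k u₀) := by
        gcongr
        exact ENNReal.one_le_ofReal.2 h3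
    _ ≤ _ := by
        rw [ENNReal.ofReal_mul (by positivity), mul_assoc]
        gcongr

theorem memLp_iteratedDeriv (hs : 0 < s) (hu : u₀ ∈ analyticSpace s) (k : ℕ) :
    MemLp (fun x => ((iteratedDeriv k u₀ x : ℝ) : ℂ)) 2 volume := by
  have hc : Continuous (iteratedDeriv k u₀) :=
    hu.1.continuous_iteratedDeriv k (by exact_mod_cast le_top)
  refine MemLp.ofReal (K := ℂ) ⟨hc.aestronglyMeasurable, ?_⟩
  exact (eLpNorm_iteratedDeriv_le hs k).trans_lt (ENNReal.mul_lt_top ENNReal.ofReal_lt_top hu.2)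

theorem fourier_iteratedDeriv_ae_eq (hs : 0 < s) (hu : u₀ ∈ analyticSpace s) (k : ℕ) :
    (𝓕 (memLp_iteratedDeriv hs hu k).toLp : Lp ℂ 2 (volume : Measure ℝ)) =ᵐ[volume] fun ξ =>
      (2 * Real.pi * Complex.I * ξ) ^ k *
        (𝓕 (memLp_iteratedDeriv hs hu 0).toLp : Lp ℂ 2 (volume : Measure ℝ)) ξ := by
  induction k with
  | zero => simp
  | succ k ih =>
    have hd : ∀ x, HasDerivAt (fun x => ((iteratedDeriv k u₀ x : ℝ) : ℂ))
        ((iteratedDeriv (k + 1) u₀ x : ℝ) : ℂ) x := fun x => by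
      have hdiff : Differentiable ℝ (iteratedDeriv k u₀) :=
        hu.1.differentiable_iteratedDeriv k (by exact_mod_cast ENat.natCast_lt_top k)
      rw [iteratedDeriv_succ]
      exact (hdiff x).hasDerivAt.ofReal_comp
    filter_upwards [ih, fourier_toLp_deriv hd (memLp_iteratedDeriv hs hu k)
      (memLp_iteratedDeriv hs hu (k + 1))] with ξ h1 h2
    rw [h2, h1, pow_succ]
    ring

/-- The Fourier transform of an element of `E_s` decays exponentially in `L²`. -/
theorem eLpNorm_expWeight_fourier_lt_top (hs : 0 < s) (hu : u₀ ∈ analyticSpace s) :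
    eLpNorm (expWeight (Real.pi * s)
      (𝓕 (memLp_iteratedDeriv hs hu 0).toLp : Lp ℂ 2 (volume : Measure ℝ))) 2 volume < ∞ := by
  set h : ℝ → ℂ := ⇑(𝓕 (memLp_iteratedDeriv hs hu 0).toLp : Lp ℂ 2 (volume : Measure ℝ)) with hh
  have hm : AEStronglyMeasurable h volume := (Lp.memLp _).aestronglyMeasurable
  set A := analyticENorm s u₀
  -- These are the terms of the series of e^{πs|ξ|} times h. As πs|ξ| = (s/2)(2π|ξ|), Plancherel
  -- bounds the k-th by (s/2)ᵏ/k! times the norm of the k-th derivative, hence by a multiple of 2⁻ᵏ.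
  set f : ℕ → ℝ → ℂ := fun k ξ => (((Real.pi * s * |ξ|) ^ k / k.factorial : ℝ) : ℂ) * h ξ
  have hfm : ∀ k, AEStronglyMeasurable (f k) volume := fun k =>
    AEStronglyMeasurable.mul (by fun_prop) hm
  have hf : ∀ k, eLpNorm (f k) 2 volume ≤ ENNReal.ofReal ((1 / 2) ^ k) * A := fun k => by
    have h1 : eLpNorm (f k) 2 volume ≤ ENNReal.ofReal ((s / 2) ^ k / k.factorial) *
        eLpNorm (fun ξ : ℝ => (2 * Real.pi * Complex.I * ξ) ^ k * h ξ) 2 volume := by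
      refine eLpNorm_le_mul_eLpNorm_of_ae_le_mul (ae_of_all _ fun ξ => ?_) 2
      simp only [f, norm_mul, norm_pow, Complex.norm_real, Complex.norm_I, mul_one,
        Complex.norm_ofNat, Real.norm_eq_abs, abs_of_pos Real.pi_pos]
      rw [abs_of_nonneg (by positivity), show Real.pi * s * |ξ| = s / 2 * (2 * Real.pi * |ξ|) by ring,
        mul_pow]
      refine le_of_eq ?_
      ring
    rw [← eLpNorm_congr_ae (fourier_iteratedDeriv_ae_eq hs hu k), eLpNorm_fourier_toLp] at h1
    have h2 : eLpNorm (fun x => ((iteratedDeriv k u₀ x : ℝ) : ℂ)) 2 volume =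
        eLpNorm (iteratedDeriv k u₀) 2 volume :=
      eLpNorm_congr_norm_ae (ae_of_all _ fun x => by simp)
    rw [h2] at h1
    refine h1.trans ?_
    refine (mul_le_mul_right (eLpNorm_iteratedDeriv_le hs k) _).trans_eq ?_
    rw [← mul_assoc, ← ENNReal.ofReal_mul (by positivity)]
    congr 2
    have hk : (k.factorial : ℝ) ≠ 0 := by exact_mod_cast k.factorial_ne_zero
    rw [div_pow, div_pow]
    field_simp
    simp
  have hbound : ∀ n, eLpNorm (fun ξ => ∑ k ∈ Finset.range n, f k ξ) 2 volume ≤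
      ENNReal.ofReal 2 * A := fun n => by
    have e : (fun ξ => ∑ k ∈ Finset.range n, f k ξ) = ∑ k ∈ Finset.range n, f k := by
      funext ξ
      simp
    rw [e]
    refine (eLpNorm_sum_le (fun k _ => hfm k) (by norm_num)).trans ?_
    refine (Finset.sum_le_sum fun k _ => hf k).trans ?_
    rw [← Finset.sum_mul, ← ENNReal.ofReal_sum_of_nonneg fun _ _ => by positivity]
    gcongr
    exact (Summable.sum_le_tsum _ (fun _ _ => by positivity) summable_geometric_two).trans_eq
      tsum_geometric_two
  -- Fatou's lemma passes the uniform bound on partial sums to the full exponential weight.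
  refine (Lp.eLpNorm_le_of_ae_tendsto (u := atTop) (Eventually.of_forall hbound)
    (fun n => ?_) (ae_of_all _ fun ξ => ?_)).trans_lt
    (ENNReal.mul_lt_top ENNReal.ofReal_lt_top hu.2)
  · exact Finset.aestronglyMeasurable_fun_sum _ fun k _ => hfm k
  · have hexp := (NormedSpace.expSeries_div_hasSum_exp (Real.pi * s * |ξ|)).tendsto_sum_nat
    rw [← Real.exp_eq_exp_ℝ] at hexp
    have h2 := ((Complex.continuous_ofReal.tendsto _).comp hexp).mul_const (h ξ)
    refine h2.congr fun n => ?_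
    simp [f, Finset.sum_mul]

theorem expNorm_comp_neg {h : ℝ → ℂ} (hm : AEStronglyMeasurable h) (b : ℝ) :
    expNorm b (fun ξ => (starRingEnd ℂ) (h (-ξ))) = expNorm b h := by
  have e : ∀ p, eLpNorm (expWeight b fun ξ => (starRingEnd ℂ) (h (-ξ))) p volume =
      eLpNorm (expWeight b h) p volume := fun p => by
    rw [← eLpNorm_comp_measurePreserving (aestronglyMeasurable_expWeight hm b)
      (Measure.measurePreserving_neg volume)]
    refine eLpNorm_congr_norm_ae (ae_of_all _ fun ξ => ?_)
    simp [norm_expWeight]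
  rw [expNorm, e, e, expNorm]

theorem integrable_expWeight_of_expNorm_lt_top {b : ℝ} {h : ℝ → ℂ} (hm : AEStronglyMeasurable h)
    (hh : expNorm b h < ∞) : Integrable (expWeight b h) :=
  memLp_one_iff_integrable.1 ⟨aestronglyMeasurable_expWeight hm b,
    lt_of_le_of_lt le_self_add hh⟩

theorem expNorm_mono {a b : ℝ} (hab : a ≤ b) (h : ℝ → ℂ) : expNorm a h ≤ expNorm b h := by
  have := expNorm_le_mul (a := a) (b := b) (c := 1) (f := h) (g := h) fun ξ => by
    rw [one_mul]
    gcongr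
  simpa using this

theorem integrable_of_expNorm_lt_top {b : ℝ} (hb : 0 ≤ b) {h : ℝ → ℂ}
    (hm : AEStronglyMeasurable h) (hh : expNorm b h < ∞) : Integrable h := by
  have := integrable_expWeight_of_expNorm_lt_top hm ((expNorm_mono hb h).trans_lt hh)
  refine this.congr (ae_of_all _ fun ξ => ?_)
  simp [expWeight]

theorem integrable_fourierInv_integrand {f : ℝ → ℂ} (hf : Integrable f) (x : ℝ) :
    Integrable fun ξ : ℝ => Real.fourierChar (inner ℝ ξ x) • f ξ := by
  simpa using (Real.fourierIntegral_convergent_iff (μ := volume) (-x)).2 hf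

theorem fourierInv_fun_add {f g : ℝ → ℂ} (hf : Integrable f) (hg : Integrable g) (x : ℝ) :
    𝓕⁻ (fun ξ => f ξ + g ξ) x = 𝓕⁻ f x + 𝓕⁻ g x := by
  simp only [Real.fourierInv_eq, smul_add]
  exact integral_add (integrable_fourierInv_integrand hf x) (integrable_fourierInv_integrand hg x)

theorem fourierInv_const_mul (c : ℂ) (f : ℝ → ℂ) (x : ℝ) :
    𝓕⁻ (fun ξ => c * f ξ) x = c * 𝓕⁻ f x := by
  simp only [Real.fourierInv_eq]
  rw [← integral_const_mul]
  congr 1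
  funext ξ
  simp only [Circle.smul_def, smul_eq_mul]
  ring

/-- The inverse Fourier transform of a function with Hermitian symmetry is real. -/
theorem conj_fourierInv (h : ℝ → ℂ) (x : ℝ) :
    (starRingEnd ℂ) (𝓕⁻ h x) = 𝓕⁻ (fun ξ => (starRingEnd ℂ) (h (-ξ))) x := by
  rw [Real.fourierInv_eq', Real.fourierInv_eq', ← integral_conj,
    ← integral_neg_eq_self (fun v : ℝ => Complex.exp _ • (starRingEnd ℂ) (h (-v)))]
  congr 1
  funext v
  simp only [smul_eq_mul, map_mul, neg_neg, ← Complex.exp_conj]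
  congr 2
  simp [Complex.conj_ofReal, Complex.conj_ofNat]

theorem ofReal_re_fourierInv {h : ℝ → ℂ} (hh : ∀ ξ, h (-ξ) = (starRingEnd ℂ) (h ξ)) (x : ℝ) :
    ((𝓕⁻ h x).re : ℂ) = 𝓕⁻ h x := by
  refine Complex.conj_eq_iff_re.1 ?_
  rw [conj_fourierInv]
  simp [hh]

/-- An L² class determines h only almost everywhere, whereas the symmetry is wanted at every ξ.
Averaging h with its reflected conjugate enforces it and keeps the inverse transform, since u₀ is
real. Half of the width πs is spent on passing from L² to L¹. -/
theorem exists_fourier_data (hs : 0 < s) (hu : u₀ ∈ analyticSpace s) :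
    ∃ b : ℝ, 0 < b ∧ ∃ h : ℝ → ℂ, AEStronglyMeasurable h ∧
      (∀ ξ, h (-ξ) = (starRingEnd ℂ) (h ξ)) ∧ expNorm b h < ∞ ∧ ∀ x, (u₀ x : ℂ) = 𝓕⁻ h x := by
  have hmem := memLp_iteratedDeriv hs hu 0
  set h : ℝ → ℂ := ⇑(𝓕 hmem.toLp : Lp ℂ 2 (volume : Measure ℝ)) with hh
  have hm : AEStronglyMeasurable h volume := (Lp.memLp _).aestronglyMeasurable
  have hπ : 0 < Real.pi * s := mul_pos Real.pi_pos hs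
  have hb : 0 < Real.pi * s / 2 := by positivity
  have hfin : expNorm (Real.pi * s / 2) h < ∞ :=
    expNorm_lt_top_of_eLpNorm_two (by linarith) hm (eLpNorm_expWeight_fourier_lt_top hs hu)
  have hint := integrable_of_expNorm_lt_top hb.le hm hfin
  have hinv : (fun x => ((iteratedDeriv 0 u₀ x : ℝ) : ℂ)) = 𝓕⁻ h :=
    eq_fourierInv_of_integrable_fourier hmem
      (by simpa [Function.comp_def] using Complex.continuous_ofReal.comp hu.1.continuous) hint (EventuallyEq.refl _ _)
  have hm' : AEStronglyMeasurable (fun ξ => (starRingEnd ℂ) (h (-ξ))) volume :=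
    Complex.continuous_conj.comp_aestronglyMeasurable
      (hm.comp_measurePreserving (Measure.measurePreserving_neg volume))
  have hfin' : expNorm (Real.pi * s / 2) (fun ξ => (starRingEnd ℂ) (h (-ξ))) < ∞ := by
    rwa [expNorm_comp_neg hm]
  have hint' := integrable_of_expNorm_lt_top hb.le hm' hfin'
  refine ⟨Real.pi * s / 2, hb, fun ξ => (1 / 2) * (h ξ + (starRingEnd ℂ) (h (-ξ))),
    (hm.add hm').const_mul _, fun ξ => ?_, ?_, fun x => ?_⟩
  · simp [add_comm, Complex.conj_ofNat]
  · have h1 := expNorm_sum_le Finset.univ (f := ![h, fun ξ => (starRingEnd ℂ) (h (-ξ))])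
      (Real.pi * s / 2) (fun i _ => by fin_cases i <;> simp [hm, hm'])
    simp only [Fin.sum_univ_two, Matrix.cons_val_zero, Matrix.cons_val_one] at h1
    refine (expNorm_le_mul (c := 1) (b := Real.pi * s / 2)
      (g := fun ξ => h ξ + (starRingEnd ℂ) (h (-ξ))) fun ξ => ?_).trans_lt
      (ENNReal.mul_lt_top ENNReal.ofReal_lt_top (h1.trans_lt (ENNReal.add_lt_top.2 ⟨hfin, hfin'⟩)))
    rw [norm_mul, one_mul]
    gcongr
    refine mul_le_of_le_one_left (norm_nonneg _) (by norm_num)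
  · have e1 : 𝓕⁻ h x = u₀ x := by simpa using (congrFun hinv x).symm
    have e2 := conj_fourierInv h x
    rw [e1, Complex.conj_ofReal] at e2
    have e3 : 𝓕⁻ (fun ξ => (1 / 2 : ℂ) * (h ξ + (starRingEnd ℂ) (h (-ξ)))) x =
        (1 / 2) * (𝓕⁻ h x + 𝓕⁻ (fun ξ => (starRingEnd ℂ) (h (-ξ))) x) := by
      rw [fourierInv_const_mul, fourierInv_fun_add hint hint']
    rw [e3, e1, ← e2]
    ring

end AnalyticData

/-! ### The power series coefficients in time and their growth. -/

section Coefficients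

/-- The symbol `2πiξ` of `∂ₓ`. -/
def derivSymbol (ξ : ℝ) : ℂ := 2 * Real.pi * Complex.I * ξ

/-- The symbol `-1 + (3 / (1 - 2πiξ) - 1 / (1 + 2πiξ)) / 2` of `∂ₓ (2 + ∂ₓ) (1 - ∂ₓ²)⁻¹`. -/
def gchSymbol (ξ : ℝ) : ℂ :=
  -1 + (3 * (1 - derivSymbol ξ)⁻¹ - (1 + derivSymbol ξ)⁻¹) / 2

/-- The Fourier transforms of the coefficients `uₙ` of the solution `∑ tⁿ uₙ`: they satisfy
`(n + 1) uₙ₊₁ = ∂ₓ (2 + ∂ₓ) (1 - ∂ₓ²)⁻¹ ∑ ωᵢ ωₙ₋ᵢ` with `ωᵢ = (2 - ∂ₓ) uᵢ`. -/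
def gchCoeff (h : ℝ → ℂ) : ℕ → ℝ → ℂ
  | 0 => h
  | n + 1 => fun ξ => gchSymbol ξ * ((n + 1 : ℂ)⁻¹ * ∑ i : Fin (n + 1),
      ((fun η => (2 - derivSymbol η) * gchCoeff h i η) ⋆[ContinuousLinearMap.mul ℂ ℂ, volume]
        (fun η => (2 - derivSymbol η) * gchCoeff h (n - i) η)) ξ)

/-- The Fourier transform of `ωₙ = (2 - ∂ₓ) uₙ`. -/
def gchMomentum (h : ℝ → ℂ) (n : ℕ) (ξ : ℝ) : ℂ := (2 - derivSymbol ξ) * gchCoeff h n ξ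

theorem gchCoeff_zero (h : ℝ → ℂ) : gchCoeff h 0 = h := by
  rw [gchCoeff]

/-- The definition sums over `Fin (n + 1)` so that the recursion is visibly well founded; the
antidiagonal form matches convolutions and Catalan numbers. -/
theorem gchCoeff_succ (h : ℝ → ℂ) (n : ℕ) (ξ : ℝ) :
    gchCoeff h (n + 1) ξ = gchSymbol ξ * ((n + 1 : ℂ)⁻¹ *
      ∑ ij ∈ Finset.HasAntidiagonal.antidiagonal n,
        (gchMomentum h ij.1 ⋆[ContinuousLinearMap.mul ℂ ℂ, volume] gchMomentum h ij.2) ξ) := by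
  rw [gchCoeff, Finset.Nat.sum_antidiagonal_eq_sum_range_succ
    (fun i j => (gchMomentum h i ⋆[ContinuousLinearMap.mul ℂ ℂ, volume] gchMomentum h j) ξ) n,
    Finset.sum_range]
  rfl

theorem continuous_derivSymbol : Continuous derivSymbol := by
  unfold derivSymbol
  fun_prop

theorem norm_derivSymbol (ξ : ℝ) : ‖derivSymbol ξ‖ = 2 * Real.pi * |ξ| := by
  simp [derivSymbol, abs_of_pos Real.pi_pos]

theorem derivSymbol_eq (ξ : ℝ) : derivSymbol ξ = ((2 * Real.pi * ξ : ℝ) : ℂ) * Complex.I := by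
  rw [derivSymbol]
  push_cast
  ring

theorem one_sub_derivSymbol_ne_zero (ξ : ℝ) : 1 - derivSymbol ξ ≠ 0 := fun h => by
  have := congrArg Complex.re h
  rw [derivSymbol_eq] at this
  simp at this

theorem one_add_derivSymbol_ne_zero (ξ : ℝ) : 1 + derivSymbol ξ ≠ 0 := fun h => by
  have := congrArg Complex.re h
  rw [derivSymbol_eq] at this
  simp at this

theorem two_le_norm_two_sub_derivSymbol (ξ : ℝ) : 2 ≤ ‖2 - derivSymbol ξ‖ := by
  refine le_trans ?_ (Complex.abs_re_le_norm _)
  rw [derivSymbol_eq]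
  simp

theorem norm_two_sub_derivSymbol_le (ξ : ℝ) : ‖2 - derivSymbol ξ‖ ≤ 2 + 2 * Real.pi * |ξ| := by
  refine (norm_sub_le _ _).trans ?_
  rw [norm_derivSymbol]
  simp

theorem continuous_gchSymbol : Continuous gchSymbol := by
  have := continuous_derivSymbol
  unfold gchSymbol
  refine continuous_const.add (Continuous.div_const (Continuous.sub
    (continuous_const.mul (Continuous.inv₀ (by fun_prop) one_sub_derivSymbol_ne_zero))
    (Continuous.inv₀ (by fun_prop) one_add_derivSymbol_ne_zero)) 2)

theorem conj_derivSymbol (ξ : ℝ) : (starRingEnd ℂ) (derivSymbol ξ) = derivSymbol (-ξ) := by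
  simp [derivSymbol_eq, Complex.conj_ofNat]

theorem conj_gchSymbol (ξ : ℝ) : (starRingEnd ℂ) (gchSymbol ξ) = gchSymbol (-ξ) := by
  simp [gchSymbol, conj_derivSymbol, Complex.conj_ofNat]

/-- With D = iy the symbol is D(2 + D)/(1 - D²), so multiplying by 2 - D gives D(4 + y²)/(1 + y²).
The quotient is at most 4 and |D| = 2π|ξ|, whence 8π. -/
theorem norm_two_sub_mul_gchSymbol_le (ξ : ℝ) :
    ‖(2 - derivSymbol ξ) * gchSymbol ξ‖ ≤ 8 * Real.pi * |ξ| := by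
  set D := derivSymbol ξ with hD
  have h1 : 1 - D ≠ 0 := one_sub_derivSymbol_ne_zero ξ
  have h2 : 1 + D ≠ 0 := one_add_derivSymbol_ne_zero ξ
  set y : ℝ := 2 * Real.pi * ξ
  have hDD : D * D = -((y ^ 2 : ℝ) : ℂ) := by
    have hy : D = (y : ℂ) * Complex.I := derivSymbol_eq ξ
    rw [hy]
    push_cast
    linear_combination ((y : ℂ) ^ 2) * Complex.I_mul_I
  have e : (2 - D) * gchSymbol ξ = D * (((4 + y ^ 2) / (1 + y ^ 2) : ℝ) : ℂ) := by
    have h3 : ((1 + y ^ 2 : ℝ) : ℂ) ≠ 0 := by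
      norm_cast
      positivity
    have h4 : (1 - D) * (1 + D) = ((1 + y ^ 2 : ℝ) : ℂ) := by
      push_cast at hDD ⊢
      linear_combination -hDD
    have h5 : (2 - D) * (2 + D) = ((4 + y ^ 2 : ℝ) : ℂ) := by
      push_cast at hDD ⊢
      linear_combination -hDD
    rw [Complex.ofReal_div, ← h4, ← h5, gchSymbol, ← hD]
    field_simp
    ring
  rw [e, norm_mul, hD, norm_derivSymbol, Complex.norm_real, Real.norm_of_nonneg (by positivity)]
  have h6 : (4 + y ^ 2) / (1 + y ^ 2) ≤ 4 := by
    rw [div_le_iff₀ (by positivity)]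
    nlinarith [sq_nonneg y]
  calc 2 * Real.pi * |ξ| * ((4 + y ^ 2) / (1 + y ^ 2)) ≤ 2 * Real.pi * |ξ| * 4 :=
        mul_le_mul_of_nonneg_left h6 (by positivity)
    _ = _ := by ring

theorem aestronglyMeasurable_gchCoeff {h : ℝ → ℂ} (hm : AEStronglyMeasurable h) (n : ℕ) :
    AEStronglyMeasurable (gchCoeff h n) := by
  induction n using Nat.strong_induction_on with
  | _ n ih =>
    rcases n with _ | n
    · rwa [gchCoeff_zero]
    · have e : gchCoeff h (n + 1) = fun ξ => gchSymbol ξ * ((n + 1 : ℂ)⁻¹ *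
        ∑ ij ∈ Finset.HasAntidiagonal.antidiagonal n,
          (gchMomentum h ij.1 ⋆[ContinuousLinearMap.mul ℂ ℂ, volume] gchMomentum h ij.2) ξ) :=
        funext fun ξ => gchCoeff_succ h n ξ
      rw [e]
      have hc := continuous_derivSymbol
      refine continuous_gchSymbol.aestronglyMeasurable.mul (AEStronglyMeasurable.const_mul
        (Finset.aestronglyMeasurable_fun_sum _ fun ij hij => ?_) _)
      have := Finset.HasAntidiagonal.mem_antidiagonal.1 hij
      exact aestronglyMeasurable_convolution
        (AEStronglyMeasurable.mul (by fun_prop) (ih _ (by omega)))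
        (AEStronglyMeasurable.mul (by fun_prop) (ih _ (by omega)))

theorem aestronglyMeasurable_gchMomentum {h : ℝ → ℂ} (hm : AEStronglyMeasurable h) (n : ℕ) :
    AEStronglyMeasurable (gchMomentum h n) :=
  ((continuous_const.sub continuous_derivSymbol).aestronglyMeasurable).mul
    (aestronglyMeasurable_gchCoeff hm n)

theorem convolution_neg_eq_conj {f g : ℝ → ℂ} (hf : ∀ ξ, f (-ξ) = (starRingEnd ℂ) (f ξ))
    (hg : ∀ ξ, g (-ξ) = (starRingEnd ℂ) (g ξ)) (ξ : ℝ) :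
    (f ⋆[ContinuousLinearMap.mul ℂ ℂ, volume] g) (-ξ) =
      (starRingEnd ℂ) ((f ⋆[ContinuousLinearMap.mul ℂ ℂ, volume] g) ξ) := by
  rw [convolution_def, convolution_def, ← integral_conj, ← integral_neg_eq_self]
  congr 1
  funext η
  simp only [ContinuousLinearMap.mul_apply', map_mul]
  rw [hf, ← hg]
  congr 2
  ring

theorem gchCoeff_neg {h : ℝ → ℂ} (hh : ∀ ξ, h (-ξ) = (starRingEnd ℂ) (h ξ)) (n : ℕ) :
    ∀ ξ, gchCoeff h n (-ξ) = (starRingEnd ℂ) (gchCoeff h n ξ) := by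
  induction n using Nat.strong_induction_on with
  | _ n ih =>
    intro ξ
    rcases n with _ | n
    · rw [gchCoeff_zero, hh]
    · rw [gchCoeff_succ, gchCoeff_succ, map_mul, map_mul, map_sum, conj_gchSymbol]
      congr 1
      congr 1
      · simp
      · refine Finset.sum_congr rfl fun ij hij => ?_
        have := Finset.HasAntidiagonal.mem_antidiagonal.1 hij
        refine convolution_neg_eq_conj (fun η => ?_) (fun η => ?_) ξ <;>
          rw [gchMomentum, gchMomentum, ih _ (by omega), ← conj_derivSymbol, map_mul, map_sub,
            Complex.conj_ofNat]

theorem gchMomentum_neg {h : ℝ → ℂ} (hh : ∀ ξ, h (-ξ) = (starRingEnd ℂ) (h ξ)) (n : ℕ) (ξ : ℝ) :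
    gchMomentum h n (-ξ) = (starRingEnd ℂ) (gchMomentum h n ξ) := by
  rw [gchMomentum, gchMomentum, gchCoeff_neg hh, ← conj_derivSymbol, map_mul, map_sub,
    Complex.conj_ofNat]

/-- Recursing on ωₙ instead of uₙ makes the quadratic term a plain convolution, leaving an outer
multiplier of order one. This is the recursion hypothesis of `le_pow_of_quadratic_recursion` with K
= 8π. -/
theorem expNorm_gchMomentum_succ_le {h : ℝ → ℂ} (hm : AEStronglyMeasurable h) {a δ : ℝ} (n : ℕ)
    (ha : 0 ≤ a) (hδ : 0 < δ) :
    expNorm a (gchMomentum h (n + 1)) ≤ ENNReal.ofReal (8 * Real.pi / δ / (n + 1)) *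
      ∑ ij ∈ Finset.HasAntidiagonal.antidiagonal n,
        expNorm (a + δ) (gchMomentum h ij.1) * expNorm (a + δ) (gchMomentum h ij.2) := by
  set S : ℝ → ℂ := fun ξ => ∑ ij ∈ Finset.HasAntidiagonal.antidiagonal n,
    (gchMomentum h ij.1 ⋆[ContinuousLinearMap.mul ℂ ℂ, volume] gchMomentum h ij.2) ξ
  have e : gchMomentum h (n + 1) = fun ξ =>
      ((2 - derivSymbol ξ) * gchSymbol ξ * (n + 1 : ℂ)⁻¹) * S ξ := by
    funext ξ
    rw [gchMomentum, gchCoeff_succ]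
    ring
  have hq : ∀ ξ, ‖(2 - derivSymbol ξ) * gchSymbol ξ * (n + 1 : ℂ)⁻¹‖ ≤
      (8 * Real.pi / (n + 1)) * |ξ| := fun ξ => by
    have hn : ‖(n + 1 : ℂ)‖ = n + 1 := by
      have := Complex.norm_natCast (n + 1)
      push_cast at this
      exact this
    rw [norm_mul, norm_inv, hn, ← div_eq_mul_inv, div_mul_eq_mul_div]
    gcongr
    exact norm_two_sub_mul_gchSymbol_le ξ
  rw [e]
  refine (expNorm_mul_le_of_norm_le (by positivity) hδ hq S).trans ?_
  rw [div_right_comm]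
  refine mul_le_mul_right ?_ _
  refine (expNorm_sum_le _ _ fun ij _ => aestronglyMeasurable_convolution
    (aestronglyMeasurable_gchMomentum hm _) (aestronglyMeasurable_gchMomentum hm _)).trans ?_
  exact Finset.sum_le_sum fun ij _ => expNorm_convolution_le (by positivity)
    (aestronglyMeasurable_gchMomentum hm _) (aestronglyMeasurable_gchMomentum hm _)

/-- The coefficients of the solution grow at most geometrically in a weighted norm. -/
theorem exists_expNorm_gchMomentum_le {h : ℝ → ℂ} (hm : AEStronglyMeasurable h) {b : ℝ}
    (hb : 0 < b) (hh : expNorm b h < ∞) :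
    ∃ a M R : ℝ, 0 < a ∧ 0 ≤ M ∧ 0 < R ∧
      ∀ n, expNorm a (gchMomentum h n) ≤ ENNReal.ofReal (M * R ^ n) := by
  -- Half the width pays for the factor 2 - D that turns u₀ into ω₀.
  have h0 : expNorm (b / 2) (gchMomentum h 0) < ∞ := by
    have h1 : expNorm (b / 2) (gchMomentum h 0) ≤
        ENNReal.ofReal (2 + 2 * Real.pi * (2 / b)) * expNorm b h := by
      refine expNorm_le_mul fun ξ => ?_
      rw [gchMomentum, gchCoeff_zero, norm_mul, ← mul_assoc, ← mul_assoc]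
      refine mul_le_mul_of_nonneg_right ?_ (norm_nonneg _)
      have e : Real.exp (b * |ξ|) = Real.exp (b / 2 * |ξ|) * Real.exp (b / 2 * |ξ|) := by
        rw [← Real.exp_add]
        congr 1
        ring
      rw [e, mul_comm, ← mul_assoc]
      refine mul_le_mul_of_nonneg_right ?_ (Real.exp_pos _).le
      refine (norm_two_sub_derivSymbol_le ξ).trans ?_
      have h2 := Real.add_one_le_exp (b / 2 * |ξ|)
      have h3 : |ξ| ≤ 2 / b * Real.exp (b / 2 * |ξ|) := by
        rw [div_mul_eq_mul_div, le_div_iff₀ hb]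
        linarith
      have h4 : 1 ≤ Real.exp (b / 2 * |ξ|) := Real.one_le_exp (by positivity)
      calc 2 + 2 * Real.pi * |ξ|
          ≤ 2 * Real.exp (b / 2 * |ξ|) + 2 * Real.pi * (2 / b * Real.exp (b / 2 * |ξ|)) := by
            gcongr
            linarith
        _ = _ := by ring
    exact h1.trans_lt (ENNReal.mul_lt_top ENNReal.ofReal_lt_top hh)
  set M := (expNorm (b / 2) (gchMomentum h 0)).toReal
  have hM : 0 ≤ M := ENNReal.toReal_nonneg
  set L := 8 * Real.pi * M * Real.exp 1 / (b / 2 - b / 4)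
  have hL : 0 ≤ L := div_nonneg (by positivity) (by linarith)
  -- The factor 4 absorbs the Catalan numbers, and the added 1 keeps the rate positive when L = 0.
  refine ⟨b / 4, M, 4 * L + 1, by positivity, hM, by positivity, fun n => ?_⟩
  have key := le_pow_of_quadratic_recursion (N := fun a n => expNorm a (gchMomentum h n))
    (K := 8 * Real.pi) (M := M) (b := b / 2) (by positivity) hM
    (fun a ha hab => by
      rw [ENNReal.ofReal_toReal h0.ne]
      exact expNorm_mono hab.le _)
    (fun a δ n ha hδ => expNorm_gchMomentum_succ_le hm n ha hδ) n (b / 4) (by positivity)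
    (by linarith)
  refine key.trans (ENNReal.ofReal_le_ofReal ?_)
  have hc : (catalan n : ℝ) ≤ 4 ^ n := by exact_mod_cast catalan_le_four_pow n
  rw [mul_assoc]
  refine mul_le_mul_of_nonneg_left ?_ hM
  calc (catalan n : ℝ) * L ^ n ≤ 4 ^ n * L ^ n := by gcongr
    _ = (4 * L) ^ n := by rw [mul_pow]
    _ ≤ (4 * L + 1) ^ n := by
      gcongr
      linarith

end Coefficients

/-! ### Fourier multipliers versus half-line averages. -/

section MultiplierDictionary

theorem fourierInv_convolution {f g : ℝ → ℂ} (hf : Integrable f) (hg : Integrable g) (x : ℝ) :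
    𝓕⁻ (f ⋆[ContinuousLinearMap.mul ℂ ℂ, volume] g) x = 𝓕⁻ f x * 𝓕⁻ g x := by
  simp only [Real.fourierInv_eq_fourier_neg]
  exact Real.fourier_mul_convolution_eq hf hg (-x)

theorem integral_exp_neg_mul_exp (ξ σ : ℝ) :
    ∫ y in Ioi (0 : ℝ), Complex.exp (-(1 - σ * derivSymbol ξ) * y) =
      (1 - σ * derivSymbol ξ)⁻¹ := by
  have hre : (-(1 - σ * derivSymbol ξ)).re < 0 := by
    rw [derivSymbol_eq]
    simp
  rw [integral_exp_mul_complex_Ioi hre, Complex.ofReal_zero, mul_zero, Complex.exp_zero,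
    neg_div_neg_eq, one_div]

/-- A translation by σy is the multiplier e^{σyD}, with D = 2πiξ; by Fubini, averaging over y leaves
∫₀^∞ e^{-(1-σD)y} dy = (1 - σD)⁻¹. -/
theorem expAverage_fourierInv {g : ℝ → ℂ} (hg : Integrable g) (σ x : ℝ) :
    expAverage σ (𝓕⁻ g) x = 𝓕⁻ (fun ξ => (1 - σ * derivSymbol ξ)⁻¹ * g ξ) x := by
  have hprod : Integrable (Function.uncurry fun (y : ℝ) (ξ : ℝ) =>
      Real.exp (-y) • (Real.fourierChar (inner ℝ ξ (x + σ * y)) • g ξ))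
      ((volume.restrict (Ioi (0 : ℝ))).prod volume) := by
    have h1 : Integrable (fun p : ℝ × ℝ => Real.exp (-p.1) • g p.2)
        ((volume.restrict (Ioi (0 : ℝ))).prod volume) :=
      (show Integrable (fun y : ℝ => Real.exp (-y)) (volume.restrict (Ioi (0 : ℝ))) from
        integrableOn_exp_neg_Ioi 0).smul_prod hg
    refine h1.mono ?_ (ae_of_all _ fun p => ?_)
    · refine AEStronglyMeasurable.smul (f := fun p : ℝ × ℝ => Real.exp (-p.1))
        (Real.continuous_exp.comp continuous_fst.neg).aestronglyMeasurable
        (AEStronglyMeasurable.smul ?_ ?_)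
      · exact (continuous_subtype_val.comp (Real.continuous_fourierChar.comp
          (show Continuous fun p : ℝ × ℝ => inner ℝ p.2 (x + σ * p.1) by
            fun_prop))).aestronglyMeasurable
      · exact hg.aestronglyMeasurable.comp_snd
    · simp [Function.uncurry]
  simp only [expAverage, Real.fourierInv_eq]
  simp only [← integral_smul]
  rw [integral_integral_swap hprod]
  congr 1
  funext ξ
  rw [← integral_exp_neg_mul_exp, ← integral_mul_const, Circle.smul_def, ← integral_smul]
  refine setIntegral_congr_fun measurableSet_Ioi fun y _ => ?_
  simp only [Circle.smul_def, Real.fourierChar_apply, smul_eq_mul, Complex.real_smul,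
    Complex.ofReal_exp]
  rw [← mul_assoc, ← mul_assoc, ← Complex.exp_add, ← Complex.exp_add]
  congr 2
  simp only [derivSymbol, RCLike.inner_apply, conj_trivial]
  push_cast
  ring

theorem integrable_inv_mul {g : ℝ → ℂ} (hg : Integrable g) (σ : ℝ) :
    Integrable fun ξ => (1 - σ * derivSymbol ξ)⁻¹ * g ξ := by
  have hc := continuous_derivSymbol
  have hre : ∀ ξ, (1 - σ * derivSymbol ξ).re = 1 := fun ξ => by
    rw [derivSymbol_eq]
    simp
  have hcont : Continuous fun ξ => (1 - σ * derivSymbol ξ)⁻¹ :=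
    Continuous.inv₀ (by fun_prop) fun ξ h => by
      have := hre ξ
      rw [h] at this
      simp at this
  refine hg.bdd_mul (c := 1) hcont.aestronglyMeasurable (ae_of_all _ fun ξ => ?_)
  rw [norm_inv]
  refine inv_le_one_of_one_le₀ ?_
  refine le_trans ?_ (Complex.abs_re_le_norm _)
  rw [hre, abs_one]

/-- The operator `f ↦ -f + G ⋆ f + 2 G' ⋆ f`. -/
def gchOperator (f : ℝ → ℝ) (x : ℝ) : ℝ := -f x + (3 * expAverage 1 f x - expAverage (-1) f x) / 2

theorem fourierInv_gchSymbol_mul {f : ℝ → ℝ} {g : ℝ → ℂ} (hg : Integrable g)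
    (hf : ∀ x, (f x : ℂ) = 𝓕⁻ g x) (x : ℝ) :
    𝓕⁻ (fun ξ => gchSymbol ξ * g ξ) x = gchOperator f x := by
  have hA : ∀ σ, ((expAverage σ f x : ℝ) : ℂ) =
      𝓕⁻ (fun ξ => (1 - σ * derivSymbol ξ)⁻¹ * g ξ) x := fun σ => by
    rw [← expAverage_fourierInv hg, expAverage, expAverage, ← integral_complex_ofReal]
    congr 1
    funext y
    rw [← hf]
    simp
  have i1 := integrable_inv_mul hg 1
  have i2 := integrable_inv_mul hg (-1)
  have e : (fun ξ => gchSymbol ξ * g ξ) = fun ξ => (-1 : ℂ) * g ξ +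
      ((3 / 2 : ℂ) * ((1 - ((1 : ℝ) : ℂ) * derivSymbol ξ)⁻¹ * g ξ) +
        (-1 / 2 : ℂ) * ((1 - ((-1 : ℝ) : ℂ) * derivSymbol ξ)⁻¹ * g ξ)) := by
    funext ξ
    have h1 : 1 - ((-1 : ℝ) : ℂ) * derivSymbol ξ = 1 + derivSymbol ξ := by
      push_cast
      ring
    rw [gchSymbol, h1, Complex.ofReal_one, one_mul]
    ring
  have j1 := i1.const_mul (3 / 2 : ℂ)
  have j2 := i2.const_mul (-1 / 2 : ℂ)
  have j12 : Integrable fun ξ => (3 / 2 : ℂ) * ((1 - ((1 : ℝ) : ℂ) * derivSymbol ξ)⁻¹ * g ξ) +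
      (-1 / 2 : ℂ) * ((1 - ((-1 : ℝ) : ℂ) * derivSymbol ξ)⁻¹ * g ξ) := j1.add j2
  rw [e, fourierInv_fun_add (hg.const_mul _) j12, fourierInv_fun_add j1 j2, fourierInv_const_mul,
    fourierInv_const_mul, fourierInv_const_mul, ← hA, ← hA, ← hf, gchOperator]
  push_cast
  ring

theorem fourierInv_sum {ι : Type*} (s : Finset ι) {f : ι → ℝ → ℂ}
    (hf : ∀ i ∈ s, Integrable (f i)) (x : ℝ) :
    𝓕⁻ (fun ξ => ∑ i ∈ s, f i ξ) x = ∑ i ∈ s, 𝓕⁻ (f i) x := by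
  simp only [Real.fourierInv_eq, Finset.smul_sum]
  exact integral_finsetSum _ fun i hi => integrable_fourierInv_integrand (hf i hi) x

/-- The operator `gchOperator` commutes with uniformly convergent series. -/
theorem gchOperator_tsum {c : ℕ → ℝ → ℝ} {B : ℕ → ℝ} (hc : ∀ n, Continuous (c n))
    (hB : ∀ n x, |c n x| ≤ B n) (hsum : Summable B) (x : ℝ) :
    HasSum (fun n => gchOperator (c n) x) (gchOperator (fun y => ∑' n, c n y) x) := by
  have hA : ∀ σ, HasSum (fun n => expAverage σ (c n) x)
      (expAverage σ (fun y => ∑' n, c n y) x) := fun σ => by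
    have h := hasSum_integral_of_summable_integral_norm
      (μ := volume.restrict (Ioi (0 : ℝ)))
      (F := fun n y => Real.exp (-y) • c n (x + σ * y))
      (fun n => integrableOn_exp_neg_smul_comp (hc n) (hB n) σ x) ?_
    · convert! h using 1
      rw [expAverage]
      congr 1
      funext y
      simp only [smul_eq_mul]
      rw [tsum_mul_left]
    · refine Summable.of_nonneg_of_le (fun n => integral_nonneg fun y => norm_nonneg _)
        (fun n => ?_) hsum
      refine (integral_mono_of_nonneg (ae_of_all _ fun y => norm_nonneg _)
        ((integrableOn_exp_neg_Ioi 0).mul_const (B n)) (ae_of_all _ fun y => ?_)).trans_eq ?_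
      · simp only [norm_smul, Real.norm_eq_abs, abs_of_pos (Real.exp_pos _)]
        exact mul_le_mul_of_nonneg_left (hB n _) (Real.exp_pos _).le
      · rw [integral_mul_const, integral_exp_neg_Ioi_zero, one_mul]
  have hs : HasSum (fun n => c n x) (∑' n, c n x) :=
    (Summable.of_norm_bounded hsum fun n => hB n x).hasSum
  exact hs.neg.add ((((hA 1).mul_left 3).sub (hA (-1))).div_const 2)

end MultiplierDictionary

/-! ### Series in weighted norms and passage to Sobolev spaces. -/

section WeightedSeries

variable {a : ℝ}

theorem eLpNorm_one_le_expNorm (ha : 0 ≤ a) (f : ℝ → ℂ) : eLpNorm f 1 volume ≤ expNorm a f := by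
  refine le_trans (eLpNorm_mono fun ξ => ?_) (le_self_add : _ ≤ expNorm a f)
  rw [norm_expWeight]
  exact le_mul_of_one_le_left (norm_nonneg _) (Real.one_le_exp (by positivity))

theorem eLpNorm_two_le_expNorm (ha : 0 ≤ a) (f : ℝ → ℂ) : eLpNorm f 2 volume ≤ expNorm a f := by
  refine le_trans (eLpNorm_mono fun ξ => ?_) (le_add_self : _ ≤ expNorm a f)
  rw [norm_expWeight]
  exact le_mul_of_one_le_left (norm_nonneg _) (Real.one_le_exp (by positivity))

theorem integral_norm_le_of_eLpNorm_one_le {f : ℝ → ℂ} (hf : AEStronglyMeasurable f) {B : ℝ}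
    (hB : 0 ≤ B) (h : eLpNorm f 1 volume ≤ ENNReal.ofReal B) : ∫ ξ, ‖f ξ‖ ≤ B := by
  rw [integral_norm_eq_lintegral_enorm hf, ← eLpNorm_one_eq_lintegral_enorm]
  exact ENNReal.toReal_le_of_le_ofReal hB h

theorem hasSum_fourierInv {f : ℕ → ℝ → ℂ} (hf : ∀ n, Integrable (f n))
    (hs : Summable fun n => ∫ ξ, ‖f n ξ‖) (x : ℝ) :
    HasSum (fun n => 𝓕⁻ (f n) x) (𝓕⁻ (fun ξ => ∑' n, f n ξ) x) := by
  simp only [Real.fourierInv_eq]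
  convert! hasSum_integral_of_summable_integral_norm (μ := volume)
    (F := fun n ξ => Real.fourierChar (inner ℝ ξ x) • f n ξ)
    (fun n => integrable_fourierInv_integrand (hf n) x) ?_ using 1
  · congr 1
    funext ξ
    simp only [Circle.smul_def, smul_eq_mul, tsum_mul_left]
  · simpa only [Circle.norm_smul] using hs

/-- A series whose terms have summable weighted norms. -/
theorem tsum_of_expNorm_le (ha : 0 ≤ a) {f : ℕ → ℝ → ℂ} {B : ℕ → ℝ}
    (hf : ∀ n, AEStronglyMeasurable (f n)) (hB0 : ∀ n, 0 ≤ B n) (hB : Summable B)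
    (h : ∀ n, expNorm a (f n) ≤ ENNReal.ofReal (B n)) :
    AEStronglyMeasurable (fun ξ => ∑' n, f n ξ) ∧
      expNorm a (fun ξ => ∑' n, f n ξ) ≤ ENNReal.ofReal (2 * ∑' n, B n) ∧
      ∀ x, HasSum (fun n => 𝓕⁻ (f n) x) (𝓕⁻ (fun ξ => ∑' n, f n ξ) x) := by
  have hsum : ∑' n, ENNReal.ofReal (B n) = ENNReal.ofReal (∑' n, B n) :=
    (ENNReal.ofReal_tsum_of_nonneg hB0 hB).symm
  have h1 : ∀ᵐ ξ, Summable fun n => ‖f n ξ‖ := by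
    refine summable_norm_of_tsum_eLpNorm_ne_top le_rfl hf (ne_of_lt ?_)
    exact (ENNReal.tsum_le_tsum fun n => (eLpNorm_one_le_expNorm ha (f n)).trans (h n)).trans_lt
      (hsum ▸ ENNReal.ofReal_lt_top)
  have hm : ∀ n, AEStronglyMeasurable (fun ξ => ∑ i ∈ Finset.range n, f i ξ) := fun n =>
    Finset.aestronglyMeasurable_fun_sum _ fun i _ => hf i
  have hlim : ∀ᵐ ξ, Tendsto (fun n => ∑ i ∈ Finset.range n, f i ξ) atTop (𝓝 (∑' n, f n ξ)) := by
    filter_upwards [h1] with ξ hξ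
    exact hξ.of_norm.hasSum.tendsto_sum_nat
  have hbound : ∀ n, expNorm a (fun ξ => ∑ i ∈ Finset.range n, f i ξ) ≤
      ENNReal.ofReal (∑' n, B n) := fun n => by
    refine (expNorm_sum_le _ a fun i _ => hf i).trans ?_
    refine (Finset.sum_le_sum fun i _ => h i).trans ?_
    rw [← hsum]
    exact ENNReal.sum_le_tsum _
  -- Fatou on the partial sums, used for p = 1 and p = 2; adding the two bounds gives the factor 2
  -- in the statement.
  have hlp : ∀ p : ℝ≥0∞, (∀ g, eLpNorm (expWeight a g) p volume ≤ expNorm a g) →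
      eLpNorm (expWeight a fun ξ => ∑' n, f n ξ) p volume ≤ ENNReal.ofReal (∑' n, B n) := by
    intro p hp
    refine Lp.eLpNorm_le_of_ae_tendsto (u := atTop)
      (f := fun n => expWeight a (fun ξ => ∑ i ∈ Finset.range n, f i ξ))
      (Eventually.of_forall fun n => (hp _).trans (hbound n))
      (fun n => aestronglyMeasurable_expWeight (hm n) a) ?_
    filter_upwards [hlim] with ξ hξ
    exact hξ.const_mul _
  refine ⟨aestronglyMeasurable_of_tendsto_ae atTop hm hlim, ?_, fun x => ?_⟩
  · rw [two_mul, ENNReal.ofReal_add (tsum_nonneg hB0) (tsum_nonneg hB0)]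
    exact add_le_add (hlp 1 fun g => le_self_add) (hlp 2 fun g => le_add_self)
  · refine hasSum_fourierInv (fun n => integrable_of_expNorm_lt_top ha (hf n)
      ((h n).trans_lt ENNReal.ofReal_lt_top)) (hB.of_nonneg_of_le
        (fun n => integral_nonneg fun ξ => norm_nonneg _) fun n => ?_) x
    exact integral_norm_le_of_eLpNorm_one_le (hf n) (hB0 n)
      ((eLpNorm_one_le_expNorm ha (f n)).trans (h n))

theorem one_add_le_mul_exp {b : ℝ} (ha : 0 < a) (hb : 0 ≤ b) {y : ℝ} (hy : 0 ≤ y) :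
    1 + b * y ≤ (1 + b / a) * Real.exp (a * y) := by
  have h1 := Real.add_one_le_exp (a * y)
  have h2 : 0 ≤ a * y := by positivity
  have h3 : b * y = b / a * (a * y) := by field_simp
  rw [h3]
  have h4 : 0 ≤ b / a := by positivity
  nlinarith

/-- The weight is at most (1 + 2π|ξ|)^σ. Bounding each factor by an exponential of rate a/σ makes
the σ-th power have rate exactly a, so one width serves every σ. -/
theorem rpow_le_mul_exp (ha : 0 < a) {σ : ℝ} (hσ : 0 < σ) (ξ : ℝ) :
    (1 + (2 * Real.pi * ξ) ^ 2) ^ (σ / 2) ≤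
      (1 + 2 * Real.pi / (a / σ)) ^ σ * Real.exp (a * |ξ|) := by
  have hpi := Real.pi_pos
  have h1 : 1 + (2 * Real.pi * ξ) ^ 2 ≤ (1 + 2 * Real.pi * |ξ|) ^ 2 := by
    have : (2 * Real.pi * ξ) ^ 2 = (2 * Real.pi * |ξ|) ^ 2 := by rw [mul_pow, mul_pow _ |ξ|, sq_abs]
    rw [this]
    nlinarith [show 0 ≤ 2 * Real.pi * |ξ| by positivity]
  calc (1 + (2 * Real.pi * ξ) ^ 2) ^ (σ / 2)
      ≤ ((1 + 2 * Real.pi * |ξ|) ^ 2) ^ (σ / 2) := by gcongr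
    _ = (1 + 2 * Real.pi * |ξ|) ^ σ := by
        rw [← Real.rpow_natCast, ← Real.rpow_mul (by positivity)]
        congr 1
        push_cast
        ring
    _ ≤ ((1 + 2 * Real.pi / (a / σ)) * Real.exp (a / σ * |ξ|)) ^ σ := by
        gcongr
        exact one_add_le_mul_exp (by positivity) (by positivity) (abs_nonneg ξ)
    _ = _ := by
        rw [Real.mul_rpow (by positivity) (by positivity), ← Real.exp_mul]
        congr 2
        field_simp

/-- Functions with exponentially decaying Fourier transform belong to every `H^σ`. -/
theorem sobolevENorm_le_expNorm (ha : 0 < a) {σ : ℝ} (hσ : 0 < σ) {f : ℝ → ℝ} {V : ℝ → ℂ}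
    (hV : AEStronglyMeasurable V) (hVa : expNorm a V < ∞) (hf : ∀ x, (f x : ℂ) = 𝓕⁻ V x) :
    sobolevENorm σ f ≤ ENNReal.ofReal ((1 + 2 * Real.pi / (a / σ)) ^ σ) * expNorm a V := by
  have hi : Integrable V := integrable_of_expNorm_lt_top ha.le hV hVa
  have hV2 : MemLp V 2 := ⟨hV, (eLpNorm_two_le_expNorm ha.le V).trans_lt hVa⟩
  have hf' : (fun x => (f x : ℂ)) = 𝓕⁻ V := funext hf
  have hfm : MemLp (fun x => (f x : ℂ)) 2 volume := hf' ▸ memLp_fourierInv hi hV2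
  rw [sobolevENorm, dif_pos hfm]
  refine le_trans ?_ (mul_le_mul_right (le_add_self : eLpNorm (expWeight a V) 2 volume ≤ _) _)
  refine eLpNorm_le_mul_eLpNorm_of_ae_le_mul ?_ 2
  filter_upwards [fourier_toLp_of_ae_eq_fourierInv hi hV2 hfm (Eventually.of_forall hf)] with ξ hξ
  rw [hξ, norm_expWeight, norm_mul, Complex.norm_real, Real.norm_of_nonneg (by positivity),
    ← mul_assoc]
  exact mul_le_mul_of_nonneg_right (rpow_le_mul_exp ha hσ ξ) (norm_nonneg _)

theorem exists_boundedC2_of_expNorm (ha : 0 < a) {f : ℝ → ℝ} {V : ℝ → ℂ}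
    (hV : AEStronglyMeasurable V) (hVa : expNorm a V < ∞) (hf : ∀ x, (f x : ℂ) = 𝓕⁻ V x) :
    (∃ B, BoundedC2 B f) ∧ ∀ x, ((2 * f x - deriv f x : ℝ) : ℂ) =
      𝓕⁻ (fun ξ => (2 - derivSymbol ξ) * V ξ) x := by
  have hE := integrable_expWeight_of_expNorm_lt_top hV hVa
  have key : Integrable fun ξ : ℝ => (1 + (2 * Real.pi * ξ) ^ 2) * ‖V ξ‖ := by
    refine (hE.norm.const_mul ((1 + 2 * Real.pi / (a / 2)) ^ (2 : ℝ))).mono'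
      (AEStronglyMeasurable.mul (by fun_prop) hV.norm) (ae_of_all _ fun ξ => ?_)
    rw [Real.norm_of_nonneg (by positivity), norm_expWeight, ← mul_assoc]
    refine mul_le_mul_of_nonneg_right ?_ (norm_nonneg _)
    have := rpow_le_mul_exp ha two_pos ξ
    rwa [div_self two_ne_zero, Real.rpow_one] at this
  obtain ⟨h1, h2, -⟩ := boundedC2_of_eq_fourierInv hV key hf
  refine ⟨⟨_, h1⟩, fun x => ?_⟩
  have hi : Integrable V := integrable_of_expNorm_lt_top ha.le hV hVa
  have hD : Integrable fun ξ => derivSymbol ξ * V ξ := by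
    refine key.mono' (continuous_derivSymbol.aestronglyMeasurable.mul hV) (ae_of_all _ fun ξ => ?_)
    rw [norm_mul, norm_derivSymbol]
    refine mul_le_mul_of_nonneg_right ?_ (norm_nonneg _)
    have : (2 * Real.pi * ξ) ^ 2 = (2 * Real.pi * |ξ|) ^ 2 := by rw [mul_pow, mul_pow _ |ξ|, sq_abs]
    rw [this]
    nlinarith [sq_nonneg (2 * Real.pi * |ξ| - 1), Real.pi_pos,
      show 0 ≤ 2 * Real.pi * |ξ| by have := Real.pi_pos; positivity]
  have e : (fun ξ => (2 - derivSymbol ξ) * V ξ) =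
      fun ξ => (2 : ℂ) * V ξ + (-1 : ℂ) * (derivSymbol ξ * V ξ) := by
    funext ξ
    ring
  rw [e, fourierInv_fun_add (hi.const_mul _) (hD.const_mul _), fourierInv_const_mul,
    fourierInv_const_mul, ← hf]
  have h3 := h2 x
  have e2 : (fun ξ : ℝ => 2 * Real.pi * Complex.I * ξ * V ξ) = fun ξ => derivSymbol ξ * V ξ := rfl
  rw [e2] at h3
  rw [← h3]
  push_cast
  ring

end WeightedSeries

/-! ### The series solves the equation. -/

section SeriesSolution

theorem hasDerivAt_tsum_pow_mul {c : ℕ → ℝ} {M R t : ℝ} (hR : 0 < R)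
    (hc : ∀ n, |c n| ≤ M * R ^ n) (ht : |t| * R < 1) :
    HasDerivAt (fun τ => ∑' n, τ ^ n * c n) (∑' n : ℕ, t ^ n * ((n + 1) * c (n + 1))) t := by
  have hM : 0 ≤ M := by simpa using (abs_nonneg _).trans (hc 0)
  -- The room between |t|R and 1 gives an interval around t on which the differentiated series is
  -- dominated by a multiple of n qⁿ.
  obtain ⟨q, hq1, hq2⟩ := exists_between ht
  have hq0 : 0 < q := lt_of_le_of_lt (by positivity) hq1
  have hmem : ∀ y ∈ Ioo (-(q / R)) (q / R), |y| * R ≤ q := fun y hy => by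
    have h1 : |y| ≤ q / R := (abs_lt.2 ⟨hy.1, hy.2⟩).le
    rwa [le_div_iff₀ hR] at h1
  have hsum : Summable fun n : ℕ => M * R / q * (n * q ^ n) := by
    have := summable_pow_mul_geometric_of_norm_lt_one 1 (r := q)
      (by rwa [Real.norm_of_nonneg hq0.le])
    simpa using this.mul_left (M * R / q)
  have ht' : t ∈ Ioo (-(q / R)) (q / R) := abs_lt.1 (by rwa [lt_div_iff₀ hR])
  have hbound : ∀ n : ℕ, ∀ y ∈ Ioo (-(q / R)) (q / R),
      ‖(n * y ^ (n - 1)) * c n‖ ≤ M * R / q * (n * q ^ n) := fun n y hy => by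
    rcases n with _ | n
    · simp
    · have h1 := hmem y hy
      have h2 : |y| ^ n * R ^ n ≤ q ^ n := by
        rw [← mul_pow]
        gcongr
      rw [Real.norm_eq_abs, abs_mul, abs_mul, abs_pow, Nat.abs_cast, Nat.add_sub_cancel]
      calc ((n + 1 : ℕ) : ℝ) * |y| ^ n * |c (n + 1)|
          ≤ ((n + 1 : ℕ) : ℝ) * |y| ^ n * (M * R ^ (n + 1)) := by gcongr; exact hc _
        _ = ((n + 1 : ℕ) : ℝ) * M * R * (|y| ^ n * R ^ n) := by ring
        _ ≤ ((n + 1 : ℕ) : ℝ) * M * R * q ^ n := by gcongr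
        _ = _ := by
          field_simp
          ring
  have h0 : (0 : ℝ) ∈ Ioo (-(q / R)) (q / R) := by
    have : 0 < q / R := by positivity
    constructor <;> linarith
  have key := hasDerivAt_tsum_of_isPreconnected hsum isOpen_Ioo isPreconnected_Ioo
    (g := fun n y => y ^ n * c n) (g' := fun n y => (n * y ^ (n - 1)) * c n)
    (fun n y _ => (hasDerivAt_pow n y).mul_const (c n)) hbound h0
    (summable_of_ne_finset_zero (s := {0}) fun n hn => by
      have : n ≠ 0 := by simpa using hn
      simp [this]) ht'
  convert! key using 1
  have hs : Summable fun n : ℕ => (n * t ^ (n - 1)) * c n :=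
    Summable.of_norm_bounded hsum fun n => hbound n t ht'
  rw [hs.tsum_eq_zero_add]
  simp only [Nat.cast_zero, zero_mul, zero_add, Nat.add_sub_cancel, Nat.cast_add, Nat.cast_one]
  congr 1
  funext n
  ring

/-- Hermitian data whose momentum coefficients grow at most geometrically. -/
structure GeometricData (h : ℝ → ℂ) (a M R : ℝ) : Prop where
  aestronglyMeasurable : AEStronglyMeasurable h
  hermitian : ∀ ξ, h (-ξ) = (starRingEnd ℂ) (h ξ)
  width_pos : 0 < a
  bound_nonneg : 0 ≤ M
  rate_pos : 0 < R
  expNorm_le : ∀ n, expNorm a (gchMomentum h n) ≤ ENNReal.ofReal (M * R ^ n)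

/-- The coefficient `uₙ` of the solution. -/
def seriesCoeff (h : ℝ → ℂ) (n : ℕ) (x : ℝ) : ℝ := (𝓕⁻ (gchCoeff h n) x).re

/-- The coefficient `ωₙ = (2 - ∂ₓ) uₙ`. -/
def seriesMomentum (h : ℝ → ℂ) (n : ℕ) (x : ℝ) : ℝ := (𝓕⁻ (gchMomentum h n) x).re

/-- The solution `∑ tⁿ uₙ`. -/
def seriesSolution (h : ℝ → ℂ) (t x : ℝ) : ℝ := ∑' n, t ^ n * seriesCoeff h n x

/-- The Fourier transform of the solution at time `t`. -/
def seriesFourier (h : ℝ → ℂ) (t ξ : ℝ) : ℂ := ∑' n, ((t ^ n : ℝ) : ℂ) * gchCoeff h n ξ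

/-- A crude form of |τⁿ - tⁿ| ≤ n ρⁿ⁻¹|τ - t|: replacing n by 2ⁿ keeps the bound geometric, and the
factor ρ on the left avoids the exponent n - 1. -/
theorem mul_abs_pow_sub_pow_le {τ t ρ : ℝ} (hτ : |τ| ≤ ρ) (ht : |t| ≤ ρ) (n : ℕ) :
    ρ * |τ ^ n - t ^ n| ≤ |τ - t| * (2 * ρ) ^ n := by
  have hρ : 0 ≤ ρ := (abs_nonneg _).trans hτ
  induction n with
  | zero => simp
  | succ n ih =>
    have e : τ ^ (n + 1) - t ^ (n + 1) = τ * (τ ^ n - t ^ n) + (τ - t) * t ^ n := by ring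
    have h1 : |τ ^ (n + 1) - t ^ (n + 1)| ≤ ρ * |τ ^ n - t ^ n| + |τ - t| * ρ ^ n := by
      rw [e]
      refine (abs_add_le _ _).trans ?_
      rw [abs_mul, abs_mul, abs_pow]
      gcongr
    calc ρ * |τ ^ (n + 1) - t ^ (n + 1)|
        ≤ ρ * (|τ - t| * (2 * ρ) ^ n + |τ - t| * ρ ^ n) := by
          gcongr
          linarith
      _ ≤ ρ * (|τ - t| * (2 * ρ) ^ n + |τ - t| * (2 * ρ) ^ n) := by
          gcongr
          linarith
      _ = _ := by ring

theorem abs_pow_mul_pow_le (R t : ℝ) (n : ℕ) :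
    |t ^ n| * R ^ n ≤ 1 * (|t| * R) ^ n := by
  rw [abs_pow, mul_pow, one_mul]

theorem norm_gchCoeff_le (h : ℝ → ℂ) (n : ℕ) (ξ : ℝ) : ‖gchCoeff h n ξ‖ ≤ ‖gchMomentum h n ξ‖ := by
  rw [gchMomentum, norm_mul]
  exact le_mul_of_one_le_left (norm_nonneg _) (by linarith [two_le_norm_two_sub_derivSymbol ξ])

theorem gchOperator_const_mul (c : ℝ) (f : ℝ → ℝ) (x : ℝ) :
    gchOperator (fun y => c * f y) x = c * gchOperator f x := by
  rw [gchOperator, gchOperator, expAverage_const_mul, expAverage_const_mul]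
  ring

namespace GeometricData

variable {h : ℝ → ℂ} {a M R : ℝ}

theorem expNorm_gchCoeff_le (H : GeometricData h a M R) (n : ℕ) :
    expNorm a (gchCoeff h n) ≤ ENNReal.ofReal (M * R ^ n) := by
  refine le_trans ?_ (H.expNorm_le n)
  have := expNorm_le_mul (a := a) (b := a) (c := 1) (f := gchCoeff h n) (g := gchMomentum h n)
    fun ξ => by
      rw [one_mul]
      exact mul_le_mul_of_nonneg_left (norm_gchCoeff_le h n ξ) (Real.exp_pos _).le
  simpa using this

theorem integrable_gchMomentum (H : GeometricData h a M R) (n : ℕ) :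
    Integrable (gchMomentum h n) :=
  integrable_of_expNorm_lt_top H.width_pos.le
    (aestronglyMeasurable_gchMomentum H.aestronglyMeasurable n)
    ((H.expNorm_le n).trans_lt ENNReal.ofReal_lt_top)

theorem integrable_gchCoeff (H : GeometricData h a M R) (n : ℕ) : Integrable (gchCoeff h n) :=
  (H.integrable_gchMomentum n).mono (aestronglyMeasurable_gchCoeff H.aestronglyMeasurable n)
    (ae_of_all _ fun ξ => norm_gchCoeff_le h n ξ)

theorem ofReal_seriesCoeff (H : GeometricData h a M R) (n : ℕ) (x : ℝ) :
    (seriesCoeff h n x : ℂ) = 𝓕⁻ (gchCoeff h n) x :=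
  ofReal_re_fourierInv (gchCoeff_neg H.hermitian n) x

theorem ofReal_seriesMomentum (H : GeometricData h a M R) (n : ℕ) (x : ℝ) :
    (seriesMomentum h n x : ℂ) = 𝓕⁻ (gchMomentum h n) x :=
  ofReal_re_fourierInv (gchMomentum_neg H.hermitian n) x

theorem bound_mul_pow_nonneg (H : GeometricData h a M R) (n : ℕ) : 0 ≤ M * R ^ n :=
  mul_nonneg H.bound_nonneg (pow_nonneg H.rate_pos.le n)

theorem integral_norm_gchMomentum_le (H : GeometricData h a M R) (n : ℕ) :
    ∫ ξ, ‖gchMomentum h n ξ‖ ≤ M * R ^ n :=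
  integral_norm_le_of_eLpNorm_one_le (H.integrable_gchMomentum n).aestronglyMeasurable
    (H.bound_mul_pow_nonneg n)
    ((eLpNorm_one_le_expNorm H.width_pos.le _).trans (H.expNorm_le n))

theorem abs_seriesMomentum_le (H : GeometricData h a M R) (n : ℕ) (x : ℝ) :
    |seriesMomentum h n x| ≤ M * R ^ n :=
  (Complex.abs_re_le_norm _).trans ((norm_fourierInv_le _ x).trans
    (H.integral_norm_gchMomentum_le n))

theorem abs_seriesCoeff_le (H : GeometricData h a M R) (n : ℕ) (x : ℝ) :
    |seriesCoeff h n x| ≤ M * R ^ n :=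
  (Complex.abs_re_le_norm _).trans ((norm_fourierInv_le _ x).trans
    ((integral_mono (H.integrable_gchCoeff n).norm (H.integrable_gchMomentum n).norm
      fun ξ => norm_gchCoeff_le h n ξ).trans (H.integral_norm_gchMomentum_le n)))

theorem continuous_seriesMomentum (H : GeometricData h a M R) (n : ℕ) :
    Continuous (seriesMomentum h n) :=
  Complex.continuous_re.comp (continuous_fourierInv (H.integrable_gchMomentum n))

/-- The recursion for the coefficients. -/
theorem succ_mul_seriesCoeff_succ (H : GeometricData h a M R) (n : ℕ) (x : ℝ) :
    (n + 1) * seriesCoeff h (n + 1) x =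
      gchOperator (fun y => ∑ ij ∈ Finset.HasAntidiagonal.antidiagonal n,
        seriesMomentum h ij.1 y * seriesMomentum h ij.2 y) x := by
  set g : ℝ → ℂ := fun ξ => ∑ ij ∈ Finset.HasAntidiagonal.antidiagonal n,
    (gchMomentum h ij.1 ⋆[ContinuousLinearMap.mul ℂ ℂ, volume] gchMomentum h ij.2) ξ with hg
  have hi : ∀ ij : ℕ × ℕ, Integrable
      (gchMomentum h ij.1 ⋆[ContinuousLinearMap.mul ℂ ℂ, volume] gchMomentum h ij.2) := fun ij =>
    (H.integrable_gchMomentum ij.1).integrable_convolution _ (H.integrable_gchMomentum ij.2)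
  have hgi : Integrable g := integrable_finsetSum _ fun ij _ => hi ij
  have hf : ∀ y, ((∑ ij ∈ Finset.HasAntidiagonal.antidiagonal n,
      seriesMomentum h ij.1 y * seriesMomentum h ij.2 y : ℝ) : ℂ) = 𝓕⁻ g y := fun y => by
    rw [hg, fourierInv_sum _ fun ij _ => hi ij]
    push_cast
    refine Finset.sum_congr rfl fun ij _ => ?_
    rw [fourierInv_convolution (H.integrable_gchMomentum _) (H.integrable_gchMomentum _),
      H.ofReal_seriesMomentum, H.ofReal_seriesMomentum]
  have e : gchCoeff h (n + 1) = fun ξ => (n + 1 : ℂ)⁻¹ * (gchSymbol ξ * g ξ) := by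
    funext ξ
    rw [gchCoeff_succ]
    ring
  have hn : (n + 1 : ℂ) ≠ 0 := by exact_mod_cast n.succ_ne_zero
  apply Complex.ofReal_injective
  rw [← fourierInv_gchSymbol_mul hgi hf, Complex.ofReal_mul, H.ofReal_seriesCoeff, e,
    fourierInv_const_mul, ← mul_assoc]
  push_cast
  rw [mul_inv_cancel₀ hn, one_mul]

/-- Series `∑ cₙ uₙ` are represented by their Fourier transforms. -/
theorem exists_fourier_tsum (H : GeometricData h a M R) {c : ℕ → ℝ} {K q : ℝ} (hK : 0 ≤ K)
    (hq0 : 0 ≤ q) (hq : q < 1) (hc : ∀ n, |c n| * R ^ n ≤ K * q ^ n) {f : ℕ → ℝ → ℂ}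
    (hf : ∀ n, AEStronglyMeasurable (f n)) (hfa : ∀ n, expNorm a (f n) ≤ ENNReal.ofReal (M * R ^ n)) :
    AEStronglyMeasurable (fun ξ => ∑' n, (c n : ℂ) * f n ξ) ∧
      expNorm a (fun ξ => ∑' n, (c n : ℂ) * f n ξ) ≤ ENNReal.ofReal (2 * (M * K / (1 - q))) ∧
      ∀ x, HasSum (fun n => (c n : ℂ) * 𝓕⁻ (f n) x) (𝓕⁻ (fun ξ => ∑' n, (c n : ℂ) * f n ξ) x) := by
  have hM := H.bound_nonneg
  have hB : HasSum (fun n => M * K * q ^ n) (M * K / (1 - q)) := by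
    rw [div_eq_mul_inv]
    exact (hasSum_geometric_of_lt_one hq0 hq).mul_left _
  have key := tsum_of_expNorm_le H.width_pos.le (f := fun n ξ => (c n : ℂ) * f n ξ)
    (B := fun n => M * K * q ^ n) (fun n => (hf n).const_mul _) (fun n => by positivity)
    hB.summable fun n => ?_
  · obtain ⟨h1, h2, h3⟩ := key
    rw [hB.tsum_eq] at h2
    refine ⟨h1, h2, fun x => ?_⟩
    simpa only [fourierInv_const_mul] using h3 x
  · refine (expNorm_le_mul (b := a) (c := |c n|) (g := f n) fun ξ => le_of_eq ?_).trans ?_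
    · rw [norm_mul, Complex.norm_real, Real.norm_eq_abs]
      ring
    · refine (mul_le_mul_right (hfa n) _).trans ?_
      rw [← ENNReal.ofReal_mul (abs_nonneg _)]
      refine ENNReal.ofReal_le_ofReal ?_
      calc |c n| * (M * R ^ n) = M * (|c n| * R ^ n) := by ring
        _ ≤ M * (K * q ^ n) := mul_le_mul_of_nonneg_left (hc n) hM
        _ = _ := by ring

theorem abs_mul_nonneg (H : GeometricData h a M R) (t : ℝ) : 0 ≤ |t| * R :=
  mul_nonneg (abs_nonneg t) H.rate_pos.le

theorem hasSum_seriesSolution (H : GeometricData h a M R) {t : ℝ} (ht : |t| * R < 1) (x : ℝ) :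
    HasSum (fun n => t ^ n * seriesCoeff h n x) (seriesSolution h t x) := by
  refine (Summable.of_norm_bounded ((summable_geometric_of_lt_one (H.abs_mul_nonneg t) ht).mul_left
    M) fun n => ?_).hasSum
  rw [norm_mul, norm_pow, Real.norm_eq_abs, Real.norm_eq_abs, mul_pow]
  calc |t| ^ n * |seriesCoeff h n x| ≤ |t| ^ n * (M * R ^ n) := by
        gcongr
        exact H.abs_seriesCoeff_le n x
    _ = _ := by ring

theorem seriesFourier_spec (H : GeometricData h a M R) {t : ℝ} (ht : |t| * R < 1) :
    AEStronglyMeasurable (seriesFourier h t) ∧ expNorm a (seriesFourier h t) < ∞ ∧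
      ∀ x, (seriesSolution h t x : ℂ) = 𝓕⁻ (seriesFourier h t) x := by
  obtain ⟨h1, h2, h3⟩ := H.exists_fourier_tsum zero_le_one (H.abs_mul_nonneg t) ht
    (abs_pow_mul_pow_le R t) (fun n => aestronglyMeasurable_gchCoeff H.aestronglyMeasurable n)
    H.expNorm_gchCoeff_le
  refine ⟨h1, h2.trans_lt ENNReal.ofReal_lt_top, fun x => ?_⟩
  refine HasSum.unique ?_ (h3 x)
  simp only [← H.ofReal_seriesCoeff, ← Complex.ofReal_mul]
  exact_mod_cast Complex.hasSum_ofReal.2 (H.hasSum_seriesSolution ht x)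

theorem exists_boundedC2 (H : GeometricData h a M R) {t : ℝ} (ht : |t| * R < 1) :
    ∃ B, BoundedC2 B (seriesSolution h t) := by
  obtain ⟨h1, h2, h3⟩ := H.seriesFourier_spec ht
  exact (exists_boundedC2_of_expNorm H.width_pos h1 h2 h3).1

/-- The operator 2 - ∂ₓ is applied to the sum on the Fourier side, where it is multiplication by 2 -
D; no termwise differentiation in x is required. -/
theorem hasSum_momentum (H : GeometricData h a M R) {t : ℝ} (ht : |t| * R < 1) (x : ℝ) :
    HasSum (fun n => t ^ n * seriesMomentum h n x)
      (2 * seriesSolution h t x - deriv (seriesSolution h t) x) := by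
  obtain ⟨h1, h2, h3⟩ := H.seriesFourier_spec ht
  have h4 := (exists_boundedC2_of_expNorm H.width_pos h1 h2 h3).2 x
  obtain ⟨-, -, h5⟩ := H.exists_fourier_tsum zero_le_one (H.abs_mul_nonneg t) ht
    (abs_pow_mul_pow_le R t) (fun n => aestronglyMeasurable_gchMomentum H.aestronglyMeasurable n)
    H.expNorm_le
  have e : (fun ξ => (2 - derivSymbol ξ) * seriesFourier h t ξ) =
      fun ξ => ∑' n, ((t ^ n : ℝ) : ℂ) * gchMomentum h n ξ := by
    funext ξ
    rw [seriesFourier, ← tsum_mul_left]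
    congr 1
    funext n
    rw [gchMomentum]
    ring
  have h6 := h5 x
  rw [← e, ← h4] at h6
  simp only [← H.ofReal_seriesMomentum, ← Complex.ofReal_mul] at h6
  exact Complex.hasSum_ofReal.1 h6

/-- The Cauchy product of the absolutely convergent momentum series with itself. -/
theorem tsum_momentum_mul_eq_sq (H : GeometricData h a M R) {t : ℝ} (ht : |t| * R < 1) (x : ℝ) :
    ∑' n, t ^ n * ∑ ij ∈ Finset.HasAntidiagonal.antidiagonal n,
      seriesMomentum h ij.1 x * seriesMomentum h ij.2 x =
      (2 * seriesSolution h t x - deriv (seriesSolution h t) x) ^ 2 := by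
  have hs := H.hasSum_momentum ht x
  have hn := hs.summable.norm
  rw [← hs.tsum_eq, sq, tsum_mul_tsum_eq_tsum_sum_antidiagonal_of_summable_norm hn hn]
  congr 1
  funext n
  rw [Finset.mul_sum]
  refine Finset.sum_congr rfl fun ij hij => ?_
  rw [← Finset.HasAntidiagonal.mem_antidiagonal.1 hij, pow_add]
  ring

/-- The series solves the equation. -/
theorem hasDerivAt_seriesSolution (H : GeometricData h a M R) {t : ℝ} (ht : |t| * R < 1) (x : ℝ) :
    HasDerivAt (fun τ => seriesSolution h τ x) (gchRHS (seriesSolution h t) x) t := by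
  have key := hasDerivAt_tsum_pow_mul H.rate_pos (fun n => H.abs_seriesCoeff_le n x) ht
  convert! key using 1
  obtain ⟨B, hB⟩ := H.exists_boundedC2 ht
  set p : ℕ → ℝ → ℝ := fun n y => ∑ ij ∈ Finset.HasAntidiagonal.antidiagonal n,
    seriesMomentum h ij.1 y * seriesMomentum h ij.2 y with hp
  have hpb : ∀ n y, |t ^ n * p n y| ≤ M ^ 2 * ((n + 1) * (|t| * R) ^ n) := fun n y => by
    have h1 : |p n y| ≤ (n + 1) * (M ^ 2 * R ^ n) := by
      refine (Finset.abs_sum_le_sum_abs _ _).trans ?_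
      refine (Finset.sum_le_card_nsmul _ _ (M ^ 2 * R ^ n) fun ij hij => ?_).trans_eq ?_
      · rw [abs_mul]
        refine (mul_le_mul (H.abs_seriesMomentum_le _ y) (H.abs_seriesMomentum_le _ y)
          (abs_nonneg _) (H.bound_mul_pow_nonneg _)).trans_eq ?_
        rw [← Finset.HasAntidiagonal.mem_antidiagonal.1 hij, pow_add]
        ring
      · rw [Finset.Nat.card_antidiagonal, nsmul_eq_mul]
        push_cast
        rfl
    rw [abs_mul, abs_pow]
    calc |t| ^ n * |p n y| ≤ |t| ^ n * ((n + 1) * (M ^ 2 * R ^ n)) := by gcongr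
      _ = _ := by ring
  have hsum : Summable fun n : ℕ => M ^ 2 * ((n + 1) * (|t| * R) ^ n) := by
    have hr : ‖|t| * R‖ < 1 := by rwa [Real.norm_of_nonneg (H.abs_mul_nonneg t)]
    have h1 := summable_pow_mul_geometric_of_norm_lt_one 1 hr
    have h2 := summable_pow_mul_geometric_of_norm_lt_one 0 hr
    refine ((h1.add h2).mul_left (M ^ 2)).congr fun n => ?_
    ring
  -- Applied to the power series of ω², this yields term by term the recursion
  -- `succ_mul_seriesCoeff_succ`, so it matches the differentiated series.
  have hop := gchOperator_tsum (c := fun n y => t ^ n * p n y)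
    (fun n => continuous_const.mul (continuous_finsetSum _ fun ij _ =>
      (H.continuous_seriesMomentum _).mul (H.continuous_seriesMomentum _))) hpb hsum x
  have e : (fun y => ∑' n, t ^ n * p n y) =
      fun y => (2 * seriesSolution h t y - deriv (seriesSolution h t) y) ^ 2 :=
    funext fun y => H.tsum_momentum_mul_eq_sq ht y
  rw [e] at hop
  rw [gchRHS_eq_sq hB]
  refine hop.tsum_eq.symm.trans ?_
  congr 1
  funext n
  rw [gchOperator_const_mul, H.succ_mul_seriesCoeff_succ]

/-- The series is Lipschitz in time with values in every `H^σ`. -/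
theorem sobolevENorm_sub_le (H : GeometricData h a M R) {σ : ℝ} (hσ : 0 < σ) {τ t : ℝ}
    (hτ : |τ| * R ≤ 1 / 4) (ht : |t| * R ≤ 1 / 4) :
    sobolevENorm σ (seriesSolution h τ - seriesSolution h t) ≤
      ENNReal.ofReal ((1 + 2 * Real.pi / (a / σ)) ^ σ) *
        ENNReal.ofReal (|τ - t| * (16 * M * R)) := by
  have hR := H.rate_pos
  -- The doubling in `mul_abs_pow_sub_pow_le` turns the ratio ρR = 1/4 into 1/2, still summable. The
  -- constant 16MR is 2·M·(4R)/(1 - 1/2).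
  set ρ := 1 / (4 * R) with hρ
  have hρ0 : 0 < ρ := by positivity
  have hle : ∀ z : ℝ, |z| * R ≤ 1 / 4 → |z| ≤ ρ := fun z hz => by
    rw [hρ, le_div_iff₀ (by positivity)]
    linarith
  have hc : ∀ n, |τ ^ n - t ^ n| * R ^ n ≤ |τ - t| * (4 * R) * (1 / 2) ^ n := fun n => by
    have h1 := mul_abs_pow_sub_pow_le (hle τ hτ) (hle t ht) n
    have e1 : |τ ^ n - t ^ n| * R ^ n = 4 * R * (ρ * |τ ^ n - t ^ n|) * R ^ n := by
      rw [hρ]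
      field_simp
    have e2 : (2 * ρ) ^ n * R ^ n = (1 / 2) ^ n := by
      rw [← mul_pow, hρ]
      congr 1
      field_simp
      norm_num
    rw [e1, ← e2]
    calc 4 * R * (ρ * |τ ^ n - t ^ n|) * R ^ n
        ≤ 4 * R * (|τ - t| * (2 * ρ) ^ n) * R ^ n := by gcongr
      _ = _ := by ring
  obtain ⟨h1, h2, h3⟩ := H.exists_fourier_tsum (by positivity) (by norm_num) (by norm_num) hc
    (fun n => aestronglyMeasurable_gchCoeff H.aestronglyMeasurable n) H.expNorm_gchCoeff_le
  have hf : ∀ x, (((seriesSolution h τ - seriesSolution h t) x : ℝ) : ℂ) =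
      𝓕⁻ (fun ξ => ∑' n, ((τ ^ n - t ^ n : ℝ) : ℂ) * gchCoeff h n ξ) x := fun x => by
    refine HasSum.unique ?_ (h3 x)
    simp only [← H.ofReal_seriesCoeff, ← Complex.ofReal_mul, sub_mul, Pi.sub_apply]
    exact Complex.hasSum_ofReal.2 ((H.hasSum_seriesSolution (by linarith) x).sub
      (H.hasSum_seriesSolution (by linarith) x))
  refine (sobolevENorm_le_expNorm H.width_pos hσ h1 (h2.trans_lt ENNReal.ofReal_lt_top) hf).trans ?_
  refine mul_le_mul_right (h2.trans_eq ?_) _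
  congr 1
  ring

theorem continuousIntoSobolev (H : GeometricData h a M R) {σ : ℝ} (hσ : 0 < σ) :
    ContinuousIntoSobolev σ (1 / (4 * R)) (seriesSolution h) := by
  have hR := H.rate_pos
  have hle : ∀ z ∈ Ioo (-(1 / (4 * R))) (1 / (4 * R)), |z| * R ≤ 1 / 4 := fun z hz => by
    have h1 : |z| < 1 / (4 * R) := abs_lt.2 ⟨hz.1, hz.2⟩
    rw [lt_div_iff₀ (by positivity)] at h1
    linarith
  intro t ht
  constructor
  · obtain ⟨h1, h2, h3⟩ := H.seriesFourier_spec (t := t) (by linarith [hle t ht])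
    exact (sobolevENorm_le_expNorm H.width_pos hσ h1 h2 h3).trans_lt
      (ENNReal.mul_lt_top ENNReal.ofReal_lt_top h2)
  · have hlim : Tendsto (fun τ => ENNReal.ofReal ((1 + 2 * Real.pi / (a / σ)) ^ σ) *
        ENNReal.ofReal (|τ - t| * (16 * M * R))) (𝓝 t) (𝓝 0) := by
      have h1 : Tendsto (fun τ : ℝ => ENNReal.ofReal (|τ - t| * (16 * M * R))) (𝓝 t) (𝓝 0) := by
        have h2 : Continuous fun τ : ℝ => ENNReal.ofReal (|τ - t| * (16 * M * R)) :=
          ENNReal.continuous_ofReal.comp (by fun_prop)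
        simpa using h2.tendsto t
      simpa using ENNReal.Tendsto.const_mul h1 (Or.inr ENNReal.ofReal_ne_top)
    refine tendsto_of_tendsto_of_tendsto_of_le_of_le' tendsto_const_nhds hlim
      (Eventually.of_forall fun _ => zero_le) ?_
    filter_upwards [isOpen_Ioo.mem_nhds ht] with τ hτ
    exact H.sobolevENorm_sub_le hσ (hle τ hτ) (hle t ht)

end GeometricData

end SeriesSolution

/-! ### Joint analyticity in time and space. -/

section JointAnalyticity

/-- A power series in one variable with geometrically bounded coefficients is analytic. -/
theorem analyticAt_tsum_pow_smul {E : Type*} [NormedAddCommGroup E] [NormedSpace ℝ E]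
    [CompleteSpace E] {c : ℕ → E} {C K : ℝ} (hK : 0 < K) (hc : ∀ n, ‖c n‖ ≤ C * K ^ n) {t : ℝ}
    (ht : |t| * K < 1) : AnalyticAt ℝ (fun τ : ℝ => ∑' n, τ ^ n • c n) t := by
  set p : FormalMultilinearSeries ℝ ℝ E := fun n =>
    ContinuousMultilinearMap.mkPiRing ℝ (Fin n) (c n) with hp
  have hrad : ENNReal.ofReal K⁻¹ ≤ p.radius := by
    refine p.le_radius_of_bound C fun n => ?_
    rw [hp, ContinuousMultilinearMap.norm_mkPiRing, Real.coe_toNNReal _ (by positivity)]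
    calc ‖c n‖ * K⁻¹ ^ n ≤ C * K ^ n * K⁻¹ ^ n := by
          gcongr
          exact hc n
      _ = C := by rw [mul_assoc, ← mul_pow, mul_inv_cancel₀ hK.ne', one_pow, mul_one]
  have hpos : 0 < ENNReal.ofReal K⁻¹ := ENNReal.ofReal_pos.2 (inv_pos.2 hK)
  have hb := (p.hasFPowerSeriesOnBall (hpos.trans_le hrad)).mono hpos hrad
  have e : p.sum = fun τ : ℝ => ∑' n, τ ^ n • c n := by
    funext τ
    simp [FormalMultilinearSeries.sum, hp]
  rw [← e]
  refine hb.analyticAt_of_mem ?_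
  rw [Metric.mem_eball, edist_dist, dist_zero_right, Real.norm_eq_abs,
    ENNReal.ofReal_lt_ofReal_iff (inv_pos.2 hK), ← one_div, lt_div_iff₀ hK]
  exact ht

open scoped BoundedContinuousFunction

/-- The integral against a fixed integrable function, as a functional on bounded functions. -/
def pairingFunctional {f : ℝ → ℂ} (hf : Integrable f) : (ℝ →ᵇ ℂ) →L[ℝ] ℝ :=
  LinearMap.mkContinuous
    { toFun := fun φ => (∫ ξ, f ξ * φ ξ).re
      map_add' := fun φ ψ => by
        have h : ∀ φ : ℝ →ᵇ ℂ, Integrable fun ξ => f ξ * φ ξ := fun φ =>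
          hf.mul_bdd (c := ‖φ‖) φ.continuous.aestronglyMeasurable
            (ae_of_all _ φ.norm_coe_le_norm)
        simp only [BoundedContinuousFunction.coe_add, Pi.add_apply, mul_add]
        rw [integral_add (h φ) (h ψ), Complex.add_re]
      map_smul' := fun r φ => by
        simp only [BoundedContinuousFunction.coe_smul, Complex.real_smul, mul_left_comm (f _),
          RingHom.id_apply, smul_eq_mul]
        rw [integral_const_mul, Complex.re_ofReal_mul] }
    (∫ ξ, ‖f ξ‖) fun φ => by
      refine (Complex.abs_re_le_norm _).trans ((norm_integral_le_integral_norm _).trans ?_)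
      rw [← integral_mul_const]
      refine integral_mono_of_nonneg (ae_of_all _ fun ξ => norm_nonneg _)
        (hf.norm.mul_const _) (ae_of_all _ fun ξ => ?_)
      simp only [norm_mul]
      exact mul_le_mul_of_nonneg_left (φ.norm_coe_le_norm ξ) (norm_nonneg _)

theorem pairingFunctional_apply {f : ℝ → ℂ} (hf : Integrable f) (φ : ℝ →ᵇ ℂ) :
    pairingFunctional hf φ = (∫ ξ, f ξ * φ ξ).re := rfl

theorem norm_pairingFunctional_le {f : ℝ → ℂ} (hf : Integrable f) :
    ‖pairingFunctional hf‖ ≤ ∫ ξ, ‖f ξ‖ :=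
  LinearMap.mkContinuous_norm_le _ (integral_nonneg fun _ => norm_nonneg _) _

/-- The wave has modulus one, and (a|ξ|)ᵏ/k! ≤ e^{a|ξ|} is absorbed by the damping. The bound is
uniform in ξ and geometric in k, so the radius of analyticity in x does not depend on the point. -/
theorem norm_pow_div_factorial_mul_exp_le {a : ℝ} (ha : 0 < a) (k : ℕ) (x ξ : ℝ) :
    ‖derivSymbol ξ ^ k / k.factorial * Complex.exp (derivSymbol ξ * x - (a * |ξ| : ℝ))‖ ≤
      (2 * Real.pi / a) ^ k := by
  have hpi := Real.pi_pos
  have h1 : ‖Complex.exp (derivSymbol ξ * x - (a * |ξ| : ℝ))‖ = Real.exp (-(a * |ξ|)) := by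
    rw [Complex.norm_exp]
    congr 1
    simp [derivSymbol_eq]
  have h2 := Real.pow_div_factorial_le_exp (a * |ξ|) (by positivity) k
  rw [norm_mul, norm_div, norm_pow, norm_derivSymbol, h1, Complex.norm_natCast]
  have e : (2 * Real.pi * |ξ|) ^ k = (2 * Real.pi / a) ^ k * (a * |ξ|) ^ k := by
    rw [← mul_pow]
    congr 1
    field_simp
  rw [e, mul_div_assoc, mul_assoc]
  refine mul_le_of_le_one_right (by positivity) ?_
  calc (a * |ξ|) ^ k / k.factorial * Real.exp (-(a * |ξ|))
      ≤ Real.exp (a * |ξ|) * Real.exp (-(a * |ξ|)) := by gcongr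
    _ = 1 := by rw [← Real.exp_add, add_neg_cancel, Real.exp_zero]

/-- The Taylor coefficients of `x ↦ e^{2πixξ - a|ξ|}`. -/
def planeWaveCoeff {a : ℝ} (ha : 0 < a) (x : ℝ) (k : ℕ) : ℝ →ᵇ ℂ :=
  BoundedContinuousFunction.ofNormedAddCommGroup
    (fun ξ => derivSymbol ξ ^ k / k.factorial *
      Complex.exp (derivSymbol ξ * x - (a * |ξ| : ℝ)))
    (by
      have := continuous_derivSymbol
      fun_prop)
    ((2 * Real.pi / a) ^ k) (norm_pow_div_factorial_mul_exp_le ha k x)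

theorem planeWaveCoeff_apply {a : ℝ} (ha : 0 < a) (x : ℝ) (k : ℕ) (ξ : ℝ) :
    planeWaveCoeff ha x k ξ = derivSymbol ξ ^ k / k.factorial *
      Complex.exp (derivSymbol ξ * x - (a * |ξ| : ℝ)) := rfl

theorem norm_planeWaveCoeff_le {a : ℝ} (ha : 0 < a) (x : ℝ) (k : ℕ) :
    ‖planeWaveCoeff ha x k‖ ≤ (2 * Real.pi / a) ^ k :=
  BoundedContinuousFunction.norm_ofNormedAddCommGroup_le _
    (pow_nonneg (div_nonneg (by positivity) ha.le) k) _

/-- The k = 0 coefficient is the damped wave itself. Its Taylor series at x₀ converges in the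
supremum norm near x₀, and its sum is identified pointwise in ξ with the exponential series. -/
theorem analyticAt_planeWave {a : ℝ} (ha : 0 < a) (x₀ : ℝ) :
    AnalyticAt ℝ (fun x => planeWaveCoeff ha x 0) x₀ := by
  set K := 2 * Real.pi / a
  have hK : 0 < K := div_pos (by positivity) ha
  have han : AnalyticAt ℝ (fun x : ℝ => ∑' k, (x - x₀) ^ k • planeWaveCoeff ha x₀ k) x₀ := by
    have h1 := analyticAt_tsum_pow_smul (c := planeWaveCoeff ha x₀) (C := 1) hK
      (fun k => by simpa using norm_planeWaveCoeff_le ha x₀ k) (t := x₀ - x₀) (by simp)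
    exact AnalyticAt.comp (f := fun x => x - x₀) h1 (by fun_prop)
  refine han.congr ?_
  have hnear : ∀ᶠ x in 𝓝 x₀, |x - x₀| * K < 1 := by
    have hc : Continuous fun x : ℝ => |x - x₀| * K := by fun_prop
    exact (hc.tendsto x₀).eventually_lt_const (by simp)
  filter_upwards [hnear] with x hx
  have hsum : Summable fun k => (x - x₀) ^ k • planeWaveCoeff ha x₀ k := by
    refine Summable.of_norm_bounded (summable_geometric_of_lt_one (by positivity) hx) fun k => ?_
    rw [norm_smul, norm_pow, Real.norm_eq_abs, mul_pow]
    gcongr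
    exact norm_planeWaveCoeff_le ha x₀ k
  ext ξ
  have h1 := hsum.hasSum.mapL (BoundedContinuousFunction.evalCLM ℝ ξ)
  refine h1.unique ?_
  simp only [BoundedContinuousFunction.evalCLM_apply, BoundedContinuousFunction.coe_smul,
    planeWaveCoeff_apply]
  have h2 := NormedSpace.expSeries_div_hasSum_exp (𝔸 := ℂ) (derivSymbol ξ * (x - x₀))
  rw [← Complex.exp_eq_exp_ℂ] at h2
  have h3 := h2.mul_right (Complex.exp (derivSymbol ξ * x₀ - (a * |ξ| : ℝ)))
  convert! h3 using 1
  · funext k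
    rw [Complex.real_smul, mul_pow]
    push_cast
    ring
  · rw [← Complex.exp_add]
    simp only [pow_zero, Nat.factorial_zero, Nat.cast_one, div_one, one_mul]
    congr 1
    ring

/-- The weight e^{a|ξ|} on f and the damping e^{-a|ξ|} of the wave cancel. -/
theorem pairingFunctional_planeWave {a : ℝ} (ha : 0 < a) {f : ℝ → ℂ}
    (hf : Integrable (expWeight a f)) (x : ℝ) :
    pairingFunctional hf (planeWaveCoeff ha x 0) = (𝓕⁻ f x).re := by
  rw [pairingFunctional_apply, Real.fourierInv_eq]
  congr 2
  funext ξ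
  rw [planeWaveCoeff_apply, expWeight, Circle.smul_def, smul_eq_mul, Real.fourierChar_apply,
    Complex.ofReal_exp, pow_zero, Nat.factorial_zero, Nat.cast_one, div_one, one_mul,
    mul_right_comm, ← Complex.exp_add]
  congr 2
  simp only [derivSymbol, RCLike.inner_apply, conj_trivial]
  push_cast
  ring

namespace GeometricData

variable {h : ℝ → ℂ} {a M R : ℝ}

theorem integrable_expWeight_gchCoeff (H : GeometricData h a M R) (n : ℕ) :
    Integrable (expWeight a (gchCoeff h n)) :=
  integrable_expWeight_of_expNorm_lt_top
    (aestronglyMeasurable_gchCoeff H.aestronglyMeasurable n)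
    ((H.expNorm_gchCoeff_le n).trans_lt ENNReal.ofReal_lt_top)

theorem norm_pairingFunctional_gchCoeff_le (H : GeometricData h a M R) (n : ℕ) :
    ‖pairingFunctional (H.integrable_expWeight_gchCoeff n)‖ ≤ M * R ^ n :=
  (norm_pairingFunctional_le _).trans (integral_norm_le_of_eLpNorm_one_le
    (H.integrable_expWeight_gchCoeff n).aestronglyMeasurable (H.bound_mul_pow_nonneg n)
    (le_trans le_self_add (H.expNorm_gchCoeff_le n)))

/-- The solution is jointly analytic in time and space. -/
theorem analyticAt_seriesSolution (H : GeometricData h a M R) {t : ℝ} (ht : |t| * R < 1) (x : ℝ) :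
    AnalyticAt ℝ (fun p : ℝ × ℝ => seriesSolution h p.1 p.2) (t, x) := by
  set F : ℕ → (ℝ →ᵇ ℂ) →L[ℝ] ℝ := fun n => pairingFunctional (H.integrable_expWeight_gchCoeff n)
  have h1 : AnalyticAt ℝ (fun τ : ℝ => ∑' n, τ ^ n • F n) t :=
    analyticAt_tsum_pow_smul H.rate_pos H.norm_pairingFunctional_gchCoeff_le ht
  have h2 := analyticAt_planeWave H.width_pos x
  have h3 : AnalyticAt ℝ (fun p : ℝ × ℝ =>
      ((∑' n, p.1 ^ n • F n, planeWaveCoeff H.width_pos p.2 0) :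
        ((ℝ →ᵇ ℂ) →L[ℝ] ℝ) × (ℝ →ᵇ ℂ))) (t, x) :=
    (AnalyticAt.comp (f := fun p : ℝ × ℝ => p.1) (x := (t, x)) h1 analyticAt_fst).prod
      (AnalyticAt.comp (f := fun p : ℝ × ℝ => p.2) (x := (t, x)) h2 analyticAt_snd)
  -- Evaluation of a functional at a vector is a continuous bilinear map, hence analytic on the
  -- product.
  have h4 := AnalyticAt.comp (x := (t, x))
    ((ContinuousLinearMap.id ℝ ((ℝ →ᵇ ℂ) →L[ℝ] ℝ)).analyticAt_bilinear _) h3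
  refine h4.congr ?_
  have hnear : ∀ᶠ p : ℝ × ℝ in 𝓝 (t, x), |p.1| * R < 1 := by
    have hc : Continuous fun p : ℝ × ℝ => |p.1| * R := by fun_prop
    exact (hc.tendsto (t, x)).eventually_lt_const ht
  filter_upwards [hnear] with p hp
  have hsum : Summable fun n => p.1 ^ n • F n := by
    refine Summable.of_norm_bounded
      ((summable_geometric_of_lt_one (H.abs_mul_nonneg p.1) hp).mul_left M) fun n => ?_
    rw [norm_smul, norm_pow, Real.norm_eq_abs, mul_pow]
    calc |p.1| ^ n * ‖F n‖ ≤ |p.1| ^ n * (M * R ^ n) := by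
          gcongr
          exact H.norm_pairingFunctional_gchCoeff_le n
      _ = _ := by ring
  have h5 := hsum.hasSum.mapL (ContinuousLinearMap.apply ℝ ℝ (planeWaveCoeff H.width_pos p.2 0))
  refine h5.unique ?_
  convert! H.hasSum_seriesSolution hp p.2 using 1
  funext n
  simp only [ContinuousLinearMap.apply_apply, smul_apply, smul_eq_mul, F]
  rw [pairingFunctional_planeWave]
  rfl

end GeometricData

end JointAnalyticity

/-! ### Assembly of the theorem. -/

section CauchyProblem

theorem exists_geometricData {s : ℝ} (hs : 0 < s) {u₀ : ℝ → ℝ} (hu₀ : u₀ ∈ analyticSpace s) :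
    ∃ (h : ℝ → ℂ) (a M R : ℝ), GeometricData h a M R ∧ ∀ x, (u₀ x : ℂ) = 𝓕⁻ h x := by
  obtain ⟨b, hb, h, hm, hh, hE, hu⟩ := exists_fourier_data hs hu₀
  obtain ⟨a, M, R, ha, hM, hR, hbound⟩ := exists_expNorm_gchMomentum_le hm hb hE
  exact ⟨h, a, M, R, ⟨hm, hh, ha, hM, hR, hbound⟩, hu⟩

theorem seriesSolution_zero {h : ℝ → ℂ} {u₀ : ℝ → ℝ} (hu : ∀ x, (u₀ x : ℂ) = 𝓕⁻ h x) :
    seriesSolution h 0 = u₀ := by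
  funext x
  rw [seriesSolution, tsum_eq_single 0 fun n hn => by rw [zero_pow hn, zero_mul], pow_zero, one_mul,
    seriesCoeff, gchCoeff_zero, ← hu, Complex.ofReal_re]

end CauchyProblem

end

theorem theorem2p1 (s : ℝ) (hs : 0 < s) (u₀ : ℝ → ℝ) (hu₀ : u₀ ∈ analyticSpace s) :
    ∃ ε : ℝ, 0 < ε ∧ ∃ u : ℝ → ℝ → ℝ,
      AnalyticOnNhd ℝ (fun p : ℝ × ℝ => u p.1 p.2) (Ioo (-ε) ε ×ˢ univ) ∧
      ∀ σ : ℝ, 5 / 2 < σ →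
        IsStrongSolution σ ε u₀ u ∧
        ∀ v : ℝ → ℝ → ℝ, IsStrongSolution σ ε u₀ v →
          ∀ t ∈ Ioo (-ε) ε, ∀ x : ℝ, v t x = u t x := by
  obtain ⟨h, a, M, R, H, hu⟩ := exists_geometricData hs hu₀
  have hR := H.rate_pos
  have ht : ∀ t ∈ Ioo (-(1 / (4 * R))) (1 / (4 * R)), |t| * R < 1 := fun t ht => by
    have h1 : |t| < 1 / (4 * R) := abs_lt.2 ⟨ht.1, ht.2⟩
    rw [lt_div_iff₀ (by positivity)] at h1
    linarith
  -- The series converges for |t| < 1/R; the quarter is what the Lipschitz estimate in H^σ asks for.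
  -- Since R comes from the datum alone, ε is independent of σ.
  refine ⟨1 / (4 * R), by positivity, seriesSolution h,
    fun p hp => H.analyticAt_seriesSolution (ht p.1 hp.1) p.2, fun σ hσ => ?_⟩
  have hsol : IsStrongSolution σ (1 / (4 * R)) u₀ (seriesSolution h) :=
    { contDiff := fun t h1 => by
        obtain ⟨B, hB⟩ := H.exists_boundedC2 (ht t h1)
        exact hB.contDiff
      continuous_sobolev := H.continuousIntoSobolev (by linarith)
      initial := seriesSolution_zero hu
      equation := fun t h1 x => H.hasDerivAt_seriesSolution (ht t h1) x }
  exact ⟨hsol, fun v hv => hv.eq_of_initial_eq hσ hsol⟩
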